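/- **Theorem 2.8.** Let $N\ge 1$ be an integer and $\alpha\in\mathbb{R}$. Let $\mathcal{D}_\alpha$ be the set of real functions $u\in C_c^\infty(\mathbb{R}^N)$ with $\int_{\mathbb{R}^N}\frac{|\Delta u|^2}{|x|^{2\alpha}}\,dx<\infty$ and $\int_{\mathbb{R}^N}|x|^{2\alpha+2}|\nabla u|^2\,dx<\infty$, and let $\mathcal{H}_\alpha\subset\mathcal{D}_\alpha$ be the subset of those $u$ that lie in $C_c^\infty(\mathbb{R}^N\setminus\{0\})$. For a constant $C\in\mathbb{R}$ and a function $u$ consider $$\left(\int_{\mathbb{R}^N}\frac{|\Delta u|^2}{|x|^{2\alpha}}\,dx\right)^{1/2}\left(\int_{\mathbb{R}^N}|x|^{2\alpha+2}|\nabla u|^2\,dx\right)^{1/2}\ \ge\ C\int_{\mathbb{R}^N}|\nabla u|^2\,dx. \qquad (*)$$ **Inequality.** Assume that one of the following holds: * Case 1: $\alpha+1>0$, $N-2\alpha>0$ and $N-(\sqrt5-1)\alpha-(\sqrt5+1)>0$; * Case 2: $N+2\alpha<0$, $N+(\sqrt5+1)\alpha+(\sqrt5-1)>0$ and $N-2\sqrt2\,\alpha-2\sqrt2>0$;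 * Case 3: $\alpha+1<0$ and $N+4\alpha+2>0$. Then $(*)$ holds with $C=\frac{|N+4\alpha+2|}{2}$ for all $u\in\mathcal{D}_\alpha$, in particular for all $u\in\mathcal{H}_\alpha$. **Optimality.** The following two statements hold for all $N\ge1$ and $\alpha\in\mathbb{R}$ (whether or not one of the three cases holds). 1. Suppose $\alpha+1>0$ and $N+2\alpha>0$. If $(*)$ holds with a constant $C$ for all $u\in\mathcal{D}_\alpha$, then $C\le\frac{N+4\alpha+2}{2}$; if $N\ge 2\alpha+4$, the same bound on $C$ follows already when $(*)$ holds for all $u\in\mathcal{H}_\alpha$. For $u(x)=\exp\left(-\frac{|x|^{2(\alpha+1)}}{2(\alpha+1)}\right)$ the three integrals in $(*)$ are finite, $\int_{\mathbb{R}^N}|\nabla u|^2\,dx>0$, and $(*)$ is an equality with $C=\frac{N+4\alpha+2}{2}$. 2. Suppose $\alpha+1<0$ and $N+2\alpha<0$. If $(*)$ holds with a constant $C$ for all $u\in\mathcal{D}_\alpha$, then $C\le-\frac{N+4\alpha+2}{2}$. For $u(x)=\exp\left(\frac{|x|^{2(\alpha+1)}}{2(\alpha+1)}\right)$ the three integrals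 in $(*)$ are finite, $\int_{\mathbb{R}^N}|\nabla u|^2\,dx>0$, and $(*)$ is an equality with $C=-\frac{N+4\alpha+2}{2}$. Consequently, whenever one of the three cases holds and $\alpha+1$ and $N+2\alpha$ have the same sign, $\frac{|N+4\alpha+2|}{2}$ is the optimal constant of $(*)$ on $\mathcal{D}_\alpha$. -/

import Mathlib

open MeasureTheory
open scoped ContDiff Laplacian Gradient

noncomputable section

/-- The integrand `|Δu|² / |x|^{2α}`. -/
def laplacianDensity {N : ℕ} (α : ℝ) (u : EuclideanSpace ℝ (Fin N) → ℝ)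
    (x : EuclideanSpace ℝ (Fin N)) : ℝ :=
  |(Δ u) x| ^ 2 / ‖x‖ ^ (2 * α)

/-- The integrand `|x|^{2α+2} |∇u|²`. -/
def weightedGradientDensity {N : ℕ} (α : ℝ) (u : EuclideanSpace ℝ (Fin N) → ℝ)
    (x : EuclideanSpace ℝ (Fin N)) : ℝ :=
  ‖x‖ ^ (2 * α + 2) * ‖∇ u x‖ ^ 2

/-- The integrand `|∇u|²`. -/
def gradientDensity {N : ℕ} (u : EuclideanSpace ℝ (Fin N) → ℝ)
    (x : EuclideanSpace ℝ (Fin N)) : ℝ :=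
  ‖∇ u x‖ ^ 2

/-- Real test functions `u ∈ C_c^∞(ℝ^N)` for which the two weighted integrals
`∫ |Δu|² / |x|^{2α}` and `∫ |x|^{2α+2} |∇u|²` are finite.
(The integral `∫ |∇u|²` is finite for every `u ∈ C_c^∞(ℝ^N)`.) -/
def testSpace (N : ℕ) (α : ℝ) : Set (EuclideanSpace ℝ (Fin N) → ℝ) :=
  {u | ContDiff ℝ ∞ u ∧ HasCompactSupport u ∧
    Integrable (laplacianDensity α u) ∧ Integrable (weightedGradientDensity α u)}

/-- The same space with `C_c^∞(ℝ^N \ {0})` in place of `C_c^∞(ℝ^N)`: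
the support of `u` stays away from the origin. -/
def puncturedTestSpace (N : ℕ) (α : ℝ) : Set (EuclideanSpace ℝ (Fin N) → ℝ) :=
  {u | u ∈ testSpace N α ∧ (0 : EuclideanSpace ℝ (Fin N)) ∉ tsupport u}

/-- The product `(∫ |Δu|² / |x|^{2α})^{1/2} (∫ |x|^{2α+2} |∇u|²)^{1/2}`. -/
def uncertaintyProduct {N : ℕ} (α : ℝ) (u : EuclideanSpace ℝ (Fin N) → ℝ) : ℝ :=
  √(∫ x, laplacianDensity α u x) * √(∫ x, weightedGradientDensity α u x)

/-- The weighted second order uncertainty principle with constant `C` on a class `X`. -/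
def UncertaintyPrinciple {N : ℕ} (α : ℝ) (X : Set (EuclideanSpace ℝ (Fin N) → ℝ))
    (C : ℝ) : Prop :=
  ∀ u ∈ X, uncertaintyProduct α u ≥ C * ∫ x, gradientDensity u x

/-- Equality with constant `C` for `u`, where all three integrals converge and
`∫ |∇u|²` is positive. -/
def AttainsUncertainty {N : ℕ} (α : ℝ) (u : EuclideanSpace ℝ (Fin N) → ℝ)
    (C : ℝ) : Prop :=
  Integrable (laplacianDensity α u) ∧ Integrable (weightedGradientDensity α u) ∧
    Integrable (gradientDensity u) ∧ 0 < ∫ x, gradientDensity u x ∧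
    uncertaintyProduct α u = C * ∫ x, gradientDensity u x

end

/-! Inequality. For real t put q_t = |Δu|²/|x|^{2α} + t²|x|^{2α+2}|∇u|² - t(N+4α+2)|∇u|² and W =
|x|^{-2α-2}. Away from the origin q_t = W|R|² + div(flux), with R the `residualField`
(`hasDivAt_uncertaintyFlux`). Whenever the flux contributes nothing, ∫ q_t ≥ 0 for every t, and the
discriminant of this quadratic in t gives (*). If N > 2α+2 the weight W is locally integrable and
the argument applies to every test function (`uncertaintyPrinciple_of_lt`). This covers Cases 2 and
3 and part of Case 1.

In the rest of Case 1, where 2α < N ≤ 2α+2, the obstruction is e = ∇u(0). Split u = v + w with v =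
⟨e,x⟩exp(-t|x|^{2α+2}/(2α+2)), so that ∇w = O(|x|) and the identity holds for w. Up to divergences,
the polar form of q_t at (v, w) is -W⟨R(w), c⟩ for an explicit field c, the `corrector`
(`hasDivAt_polarFlux`), and q_t(v) is W|c|² plus a constant K times a nonnegative function
(`hasDivAt_selfFlux`). Completing the square, ∫ q_t(u) is the integral of W|R(w) - c|² plus K times
a nonnegative integral. The condition with √5 yields K ≥ 0 (`corrector_energy_nonneg`).

Optimality. With σ = ±1, the function exp(-σ|x|^{2α+2}/(2α+2)) attains equality, because its moments
satisfy a two-term recurrence (`attainsUncertainty_gaussFactor`). It is approximated by test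
functions. A radial function is encoded by its profile -r u'(r) in the variable log r, and every
smooth compactly supported profile comes from a test function that is constant near 0
(`exists_hasRadialProfile`). Truncating the extremal profile at scale L and using dominated
convergence transfers (*) to the extremal. For support away from 0 the profile must have integral
zero; this is arranged by subtracting a bump of the same mass spread over [-2L, -L], whose cost
vanishes as L grows when N ≥ 2α+4. -/

/-! ### Calculus of gradients and divergences on ℝ^N. -/

noncomputable section VectorCalculus

variable {N : ℕ}

/-- The divergence of a vector field on `ℝ^N`. -/
def divergence (F : EuclideanSpace ℝ (Fin N) → EuclideanSpace ℝ (Fin N))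
    (x : EuclideanSpace ℝ (Fin N)) : ℝ :=
  ∑ i, (fderiv ℝ F x (EuclideanSpace.single i 1)) i

/-- `F` is continuously differentiable at `x` with divergence `d`. -/
def HasDivAt (F : EuclideanSpace ℝ (Fin N) → EuclideanSpace ℝ (Fin N)) (d : ℝ)
    (x : EuclideanSpace ℝ (Fin N)) : Prop :=
  ContDiffAt ℝ 1 F x ∧ divergence F x = d

/-- `φ` is continuously differentiable at `x` with gradient `g`. -/
def HasGradAt (φ : EuclideanSpace ℝ (Fin N) → ℝ) (g x : EuclideanSpace ℝ (Fin N)) : Prop :=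
  ContDiffAt ℝ 1 φ x ∧ HasGradientAt φ g x

variable {F G : EuclideanSpace ℝ (Fin N) → (EuclideanSpace ℝ (Fin N))} {d d' : ℝ} {x : (EuclideanSpace ℝ (Fin N))} {φ ψ : EuclideanSpace ℝ (Fin N) → ℝ} {g g' : (EuclideanSpace ℝ (Fin N))}

lemma inner_eq_sum (a b : EuclideanSpace ℝ (Fin N)) : inner ℝ a b = ∑ i, a i * b i := by
  simp [PiLp.inner_apply, mul_comm]

lemma HasGradAt.fderiv_apply (h : HasGradAt φ g x) (y : EuclideanSpace ℝ (Fin N)) : fderiv ℝ φ x y = inner ℝ g y :=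
  h.2.fderiv_apply

lemma HasGradAt.differentiableAt (h : HasGradAt φ g x) : DifferentiableAt ℝ φ x :=
  h.2.differentiableAt

lemma HasGradAt.of_fderiv (h : ContDiffAt ℝ 1 φ x) (h' : ∀ y, fderiv ℝ φ x y = inner ℝ g y) :
    HasGradAt φ g x := by
  refine ⟨h, ?_⟩
  have hd : DifferentiableAt ℝ φ x := h.differentiableAt (by norm_num)
  have : ∇ φ x = g := by
    refine ext_inner_right ℝ fun y => ?_
    rw [inner_gradient_left, h' y]
  exact this ▸ hd.hasGradientAt

lemma ContDiffAt.hasGradAt (h : ContDiffAt ℝ 1 φ x) : HasGradAt φ (∇ φ x) x :=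
  ⟨h, (h.differentiableAt (by norm_num)).hasGradientAt⟩

lemma HasGradAt.congr (h : HasGradAt φ g x) (hg : g = g') : HasGradAt φ g' x := hg ▸ h

lemma HasGradAt.congr_fun (h : HasGradAt φ g x) (hg : ψ =ᶠ[nhds x] φ) : HasGradAt ψ g x :=
  ⟨h.1.congr_of_eventuallyEq hg, h.2.congr_of_eventuallyEq hg⟩

lemma HasDivAt.congr (h : HasDivAt F d x) (hg : d = d') : HasDivAt F d' x := hg ▸ h

lemma HasDivAt.congr_fun (h : HasDivAt F d x) (hg : G =ᶠ[nhds x] F) : HasDivAt G d x := by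
  refine ⟨h.1.congr_of_eventuallyEq hg, ?_⟩
  rw [← h.2, divergence, divergence, hg.fderiv_eq]

lemma hasGradAt_const (c : ℝ) : HasGradAt (fun _ : EuclideanSpace ℝ (Fin N) => c) 0 x :=
  ⟨contDiffAt_const, hasGradientAt_const x c⟩

lemma hasGradAt_inner (e : EuclideanSpace ℝ (Fin N)) : HasGradAt (fun y : EuclideanSpace ℝ (Fin N) => inner ℝ e y) e x := by
  refine .of_fderiv (innerSL ℝ e).contDiff.contDiffAt fun y => ?_
  have : HasFDerivAt (fun y : EuclideanSpace ℝ (Fin N) => inner ℝ e y) (innerSL ℝ e) x := (innerSL ℝ e).hasFDerivAt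
  rw [this.fderiv]; rfl

lemma HasGradAt.add (h : HasGradAt φ g x) (h' : HasGradAt ψ g' x) :
    HasGradAt (fun y => φ y + ψ y) (g + g') x := by
  refine .of_fderiv (h.1.add h'.1) fun y => ?_
  rw [fderiv_fun_add h.differentiableAt h'.differentiableAt]
  simp [h.fderiv_apply, h'.fderiv_apply, inner_add_left]

lemma HasGradAt.sub (h : HasGradAt φ g x) (h' : HasGradAt ψ g' x) :
    HasGradAt (fun y => φ y - ψ y) (g - g') x := by
  refine .of_fderiv (h.1.sub h'.1) fun y => ?_
  rw [fderiv_fun_sub h.differentiableAt h'.differentiableAt]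
  simp [h.fderiv_apply, h'.fderiv_apply, inner_sub_left]

lemma HasGradAt.mul (h : HasGradAt φ g x) (h' : HasGradAt ψ g' x) :
    HasGradAt (fun y => φ y * ψ y) (φ x • g' + ψ x • g) x := by
  refine .of_fderiv (h.1.mul h'.1) fun y => ?_
  rw [fderiv_fun_mul h.differentiableAt h'.differentiableAt]
  simp [h.fderiv_apply, h'.fderiv_apply, inner_add_left, inner_smul_left]

lemma HasGradAt.const_mul (h : HasGradAt φ g x) (c : ℝ) :
    HasGradAt (fun y => c * φ y) (c • g) x :=
  ((hasGradAt_const c).mul h).congr (by simp)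

lemma HasGradAt.comp {f : ℝ → ℝ} {f' : ℝ} (h : HasGradAt φ g x) (hf : ContDiffAt ℝ 1 f (φ x))
    (hf' : HasDerivAt f f' (φ x)) : HasGradAt (fun y => f (φ y)) (f' • g) x := by
  refine .of_fderiv (hf.comp x h.1) fun y => ?_
  have : HasFDerivAt (fun y => f (φ y)) _ x :=
    hf'.comp_hasFDerivAt x h.differentiableAt.hasFDerivAt
  rw [this.fderiv]
  simp [h.fderiv_apply, inner_smul_left]

lemma hasGradAt_norm (hx : x ≠ 0) : HasGradAt (fun y : EuclideanSpace ℝ (Fin N) => ‖y‖) (‖x‖⁻¹ • x) x := by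
  refine .of_fderiv (contDiffAt_norm ℝ hx) fun y => ?_
  have h := fderiv_norm_sq_apply x
  have h1 : HasFDerivAt (fun y : EuclideanSpace ℝ (Fin N) => ‖y‖ ^ 2) (2 • (innerSL ℝ x)) x := hasStrictFDerivAt_norm_sq x |>.hasFDerivAt
  have h2 := ((contDiffAt_norm ℝ hx (n := 1)).differentiableAt (by norm_num)).hasFDerivAt.pow 2
  have h3 := congrArg (fun L => L y) (h1.unique h2)
  have hn : ‖x‖ ≠ 0 := norm_ne_zero_iff.2 hx
  simp at h3
  rw [inner_smul_left]
  simp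
  field_simp
  linarith

lemma hasGradAt_rpow (p : ℝ) (hx : x ≠ 0) :
    HasGradAt (fun y : EuclideanSpace ℝ (Fin N) => ‖y‖ ^ p) ((p * ‖x‖ ^ (p - 2)) • x) x := by
  have hn : 0 < ‖x‖ := norm_pos_iff.2 hx
  have := (hasGradAt_norm hx).comp (f := fun t => t ^ p) (f' := p * ‖x‖ ^ (p - 1))
    (Real.contDiffAt_rpow_const_of_ne hn.ne') (Real.hasDerivAt_rpow_const (Or.inl hn.ne'))
  refine this.congr ?_
  rw [smul_smul, mul_assoc, ← Real.rpow_neg_one, ← Real.rpow_add hn]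
  norm_num [sub_sub, sub_add]

lemma HasDivAt.add (h : HasDivAt F d x) (h' : HasDivAt G d' x) :
    HasDivAt (fun y => F y + G y) (d + d') x := by
  refine ⟨h.1.add h'.1, ?_⟩
  rw [← h.2, ← h'.2, divergence, divergence, divergence, fderiv_fun_add
    (h.1.differentiableAt (by norm_num)) (h'.1.differentiableAt (by norm_num))]
  simp [Finset.sum_add_distrib]

lemma HasDivAt.sub (h : HasDivAt F d x) (h' : HasDivAt G d' x) :
    HasDivAt (fun y => F y - G y) (d - d') x := by
  refine ⟨h.1.sub h'.1, ?_⟩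
  rw [← h.2, ← h'.2, divergence, divergence, divergence, fderiv_fun_sub
    (h.1.differentiableAt (by norm_num)) (h'.1.differentiableAt (by norm_num))]
  simp [Finset.sum_sub_distrib]

lemma HasDivAt.smul (h : HasGradAt φ g x) (h' : HasDivAt F d x) :
    HasDivAt (fun y => φ y • F y) (φ x * d + inner ℝ g (F x)) x := by
  refine ⟨h.1.smul h'.1, ?_⟩
  rw [← h'.2, divergence, divergence, fderiv_fun_smul
    h.differentiableAt (h'.1.differentiableAt (by norm_num))]
  simp [Finset.sum_add_distrib, Finset.mul_sum, h.fderiv_apply, inner_eq_sum g]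

lemma HasDivAt.const_smul (h : HasDivAt F d x) (c : ℝ) :
    HasDivAt (fun y => c • F y) (c * d) x :=
  (HasDivAt.smul (hasGradAt_const c) h).congr (by simp)

lemma hasDivAt_id : HasDivAt (fun y : EuclideanSpace ℝ (Fin N) => y) N x := by
  refine ⟨contDiffAt_id, ?_⟩
  simp [divergence]

lemma hasDivAt_const (e : EuclideanSpace ℝ (Fin N)) : HasDivAt (fun _ : EuclideanSpace ℝ (Fin N) => e) 0 x := by
  refine ⟨contDiffAt_const, ?_⟩
  simp [divergence]

lemma gradient_eq_toDual (u : EuclideanSpace ℝ (Fin N) → ℝ) :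
    ∇ u = fun x => (InnerProductSpace.toDual ℝ (EuclideanSpace ℝ (Fin N))).symm (fderiv ℝ u x) := rfl

lemma ContDiffAt.gradient {u : EuclideanSpace ℝ (Fin N) → ℝ} {n : WithTop ℕ∞} {m : WithTop ℕ∞} (hu : ContDiffAt ℝ n u x)
    (hmn : m + 1 ≤ n) : ContDiffAt ℝ m (∇ u) x := by
  rw [gradient_eq_toDual]
  exact (InnerProductSpace.toDual ℝ (EuclideanSpace ℝ (Fin N))).symm.toContinuousLinearEquiv.contDiff.contDiffAt.comp x
    (hu.fderiv_right hmn)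

lemma fderiv_gradient_inner {u : EuclideanSpace ℝ (Fin N) → ℝ} (hu : ContDiffAt ℝ 2 u x) (a b : EuclideanSpace ℝ (Fin N)) :
    inner ℝ (fderiv ℝ (∇ u) x a) b = fderiv ℝ (fderiv ℝ u) x a b := by
  have h1 : DifferentiableAt ℝ (∇ u) x :=
    (hu.gradient (m := 1) (by norm_num)).differentiableAt (by norm_num)
  have h2 : DifferentiableAt ℝ (fderiv ℝ u) x :=
    (hu.fderiv_right (m := 1) (by norm_num)).differentiableAt (by norm_num)
  have h3 : (fun y => inner ℝ (∇ u y) b) = fun y => fderiv ℝ u y b := by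
    ext y; rw [inner_gradient_left]
  have h4 := congrArg (fun f => fderiv ℝ f x a) h3
  rw [fderiv_inner_apply ℝ h1 (differentiableAt_const b)] at h4
  rw [fderiv_clm_apply h2 (differentiableAt_const b)] at h4
  simpa using h4

lemma hasDivAt_gradient {u : EuclideanSpace ℝ (Fin N) → ℝ} (hu : ContDiffAt ℝ 2 u x) : HasDivAt (∇ u) ((Δ u) x) x := by
  refine ⟨hu.gradient (by norm_num), ?_⟩
  rw [InnerProductSpace.laplacian_eq_iteratedFDeriv_orthonormalBasis u
    (EuclideanSpace.basisFun (Fin N) ℝ), divergence]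
  refine Finset.sum_congr rfl fun i _ => ?_
  rw [iteratedFDeriv_two_apply]
  have := fderiv_gradient_inner hu (EuclideanSpace.single i 1) (EuclideanSpace.single i 1)
  simp [EuclideanSpace.inner_single_right] at this
  simpa using this

lemma fderiv_gradient_symm {u : EuclideanSpace ℝ (Fin N) → ℝ} (hu : ContDiffAt ℝ 2 u x) (a b : EuclideanSpace ℝ (Fin N)) :
    inner ℝ (fderiv ℝ (∇ u) x a) b = inner ℝ (fderiv ℝ (∇ u) x b) a := by
  rw [fderiv_gradient_inner hu, fderiv_gradient_inner hu]
  exact (hu.isSymmSndFDerivAt (by simp)).eq a b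

/-- The radial derivative `x ↦ ⟨x, ∇u(x)⟩`. -/
def euler (u : EuclideanSpace ℝ (Fin N) → ℝ) (x : EuclideanSpace ℝ (Fin N)) : ℝ :=
  inner ℝ x (∇ u x)

lemma ContDiffAt.euler {u : EuclideanSpace ℝ (Fin N) → ℝ} {n m : WithTop ℕ∞} (hu : ContDiffAt ℝ n u x)
    (hmn : m + 1 ≤ n) : ContDiffAt ℝ m (euler u) x :=
  contDiffAt_id.inner ℝ (hu.gradient hmn)

/-- By symmetry of the Hessian, D²u·x is ∇(x·∇u) - ∇u. This removes Hessians from all later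
identities, which are then polynomial in inner products of a few vectors. -/
lemma gradient_euler {u : EuclideanSpace ℝ (Fin N) → ℝ} (hu : ContDiffAt ℝ 2 u x) :
    ∇ (euler u) x = ∇ u x + fderiv ℝ (∇ u) x x := by
  have h1 : DifferentiableAt ℝ (∇ u) x :=
    (hu.gradient (m := 1) (by norm_num)).differentiableAt (by norm_num)
  refine ext_inner_right ℝ fun y => ?_
  rw [inner_gradient_left]
  unfold euler
  rw [fderiv_inner_apply ℝ differentiableAt_fun_id h1, inner_add_left]
  simp only [fderiv_fun_id]
  rw [real_inner_comm, fderiv_gradient_symm hu]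
  simp [real_inner_comm, add_comm]

/-- The gradient is left anonymous because only its pairing with x is ever used, and there both
Hessians are contracted with x. -/
lemma hasGradAt_inner_gradient {u χ : EuclideanSpace ℝ (Fin N) → ℝ} (hu : ContDiffAt ℝ 2 u x) (hχ : ContDiffAt ℝ 2 χ x) :
    ∃ g, HasGradAt (fun y => inner ℝ (∇ u y) (∇ χ y)) g x ∧
      inner ℝ g x = inner ℝ (∇ (euler u) x - ∇ u x) (∇ χ x) +
        inner ℝ (∇ (euler χ) x - ∇ χ x) (∇ u x) := by
  have hu' := hu.gradient (m := 1) (by norm_num)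
  have hχ' := hχ.gradient (m := 1) (by norm_num)
  have h := (hu'.inner ℝ hχ').hasGradAt
  refine ⟨_, h, ?_⟩
  rw [inner_gradient_left, fderiv_inner_apply ℝ (hu'.differentiableAt (by norm_num))
    (hχ'.differentiableAt (by norm_num)), gradient_euler hu, gradient_euler hχ]
  simp [add_comm]

end VectorCalculus

/-! ### The divergence theorem with a possible singularity at the origin. -/

noncomputable section DivergenceTheorem

variable {N : ℕ}

lemma HasDivAt.fderiv_apply_sum {F : EuclideanSpace ℝ (Fin N) → EuclideanSpace ℝ (Fin N)}
    {d : ℝ} {x : EuclideanSpace ℝ (Fin N)} (h : HasDivAt F d x) :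
    d = ∑ i, fderiv ℝ (fun y => F y i) x (EuclideanSpace.single i 1) := by
  rw [← h.2, divergence]
  refine Finset.sum_congr rfl fun i _ => ?_
  have hd := h.1.differentiableAt (by norm_num)
  have : HasFDerivAt (fun y => F y i) ((EuclideanSpace.proj i).comp (fderiv ℝ F x)) x :=
    (EuclideanSpace.proj (𝕜 := ℝ) i).hasFDerivAt.comp x hd.hasFDerivAt
  rw [this.fderiv]; rfl

lemma integral_divergence_eq_zero_of_compact
    {F : EuclideanSpace ℝ (Fin N) → EuclideanSpace ℝ (Fin N)}
    {d : EuclideanSpace ℝ (Fin N) → ℝ} (hF : ∀ x, HasDivAt F (d x) x)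
    (hc : HasCompactSupport F) : ∫ x, d x = 0 := by
  have hC : ContDiff ℝ 1 F := contDiff_iff_contDiffAt.2 fun x => (hF x).1
  have hi : ∀ i, ContDiff ℝ 1 (fun y => F y i) := fun i =>
    (EuclideanSpace.proj (𝕜 := ℝ) i).contDiff.comp hC
  have hci : ∀ i, HasCompactSupport (fun y => F y i) := fun i =>
    hc.comp_left (g := fun z : EuclideanSpace ℝ (Fin N) => z i) rfl
  have hint : ∀ i, Integrable (fun x => fderiv ℝ (fun y => F y i) x (EuclideanSpace.single i 1)) :=
    fun i => Continuous.integrable_of_hasCompactSupport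
      (((hi i).continuous_fderiv (by norm_num)).clm_apply continuous_const)
      ((hci i).fderiv_apply ℝ _)
  have : d = fun x => ∑ i, fderiv ℝ (fun y => F y i) x (EuclideanSpace.single i 1) := by
    ext x; exact (hF x).fderiv_apply_sum
  rw [this, integral_finsetSum _ fun i _ => hint i]
  refine Finset.sum_eq_zero fun i _ => ?_
  -- Integration by parts against the constant 1 shows that the integral of a partial derivative
  -- vanishes.
  have := integral_mul_fderiv_eq_neg_fderiv_mul_of_integrable (𝕜 := ℝ) (μ := volume)
    (f := fun _ => (1 : ℝ)) (g := fun y => F y i) (v := EuclideanSpace.single i 1)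
    (by simp) (by simpa using hint i)
    (by simpa using (hi i).continuous.integrable_of_hasCompactSupport (hci i))
    (fun _ _ => differentiableAt_const _)
    (fun x _ => (hi i).differentiable (by norm_num) x)
  simpa using this

/-- A fixed smooth bump function, equal to `1` near the origin. -/
def originBump (N : ℕ) : ContDiffBump (0 : EuclideanSpace ℝ (Fin N)) := ⟨1, 2, by norm_num, by norm_num⟩

/-- Smooth cutoffs supported in annuli that exhaust the punctured space. -/
def annulusCutoff (N n : ℕ) (x : EuclideanSpace ℝ (Fin N)) : ℝ :=
  originBump N ((n + 1 : ℝ)⁻¹ • x) * (1 - originBump N ((n + 1 : ℝ) • x))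

lemma hasGradAt_bump_smul (a : ℝ) (x : EuclideanSpace ℝ (Fin N)) :
    HasGradAt (fun y => originBump N (a • y)) (a • ∇ (originBump N) (a • x)) x := by
  refine .of_fderiv ?_ fun y => ?_
  · exact ((originBump N).contDiff.comp (contDiff_const_smul a)).contDiffAt
  · have h1 : HasFDerivAt (fun y : EuclideanSpace ℝ (Fin N) => a • y) (a • ContinuousLinearMap.id ℝ _) x :=
      (a • ContinuousLinearMap.id ℝ _).hasFDerivAt
    have h0 : HasFDerivAt (originBump N) (fderiv ℝ (originBump N) (a • x)) (a • x) :=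
      (((originBump N).contDiff (n := 1)).differentiable (by norm_num) (a • x)).hasFDerivAt
    have h2 := HasFDerivAt.comp (f := fun y => a • y) x h0 h1
    have h3 : (fun y => originBump N (a • y)) = (originBump N) ∘ fun y => a • y := rfl
    rw [h3, h2.fderiv, inner_smul_left, inner_gradient_left]
    simp

lemma gradient_bump_eq_zero {y : EuclideanSpace ℝ (Fin N)} (hy : 2 < ‖y‖) :
    ∇ (originBump N) y = 0 := by
  refine ext_inner_right ℝ fun z => ?_
  rw [inner_gradient_left, inner_zero_left]
  have : y ∉ tsupport (originBump N) := by
    rw [(originBump N).tsupport_eq]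
    simp [originBump, hy]
  rw [fderiv_of_notMem_tsupport (𝕜 := ℝ) this]; rfl

lemma gradient_bump_eq_zero' {y : EuclideanSpace ℝ (Fin N)} (hy : ‖y‖ < 1) :
    ∇ (originBump N) y = 0 := by
  refine ext_inner_right ℝ fun z => ?_
  rw [inner_gradient_left, inner_zero_left]
  have : (originBump N : EuclideanSpace ℝ (Fin N) → ℝ) =ᶠ[nhds y] fun _ => 1 :=
    (originBump N).eventuallyEq_one_of_mem_ball (by simpa [originBump] using hy)
  rw [this.fderiv_eq]; simp

/-- The quantity |y||∇φ(y)| is invariant under dilations, so this one bound controls every rescaled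
bump and makes the bound c/|x| on the cutoff gradients uniform in n. -/
lemma exists_bump_gradient_bound (N : ℕ) : ∃ c : ℝ, 0 ≤ c ∧ ∀ y, ‖y‖ * ‖∇ (originBump N) y‖ ≤ c := by
  have hc : Continuous fun y => ‖y‖ * ‖∇ (originBump N) y‖ := by
    refine continuous_norm.mul (Continuous.norm ?_)
    have h : ∀ x, ContDiffAt ℝ 1 (originBump N : EuclideanSpace ℝ (Fin N) → ℝ) x :=
      fun x => (originBump N).contDiff.contDiffAt
    exact (contDiff_iff_contDiffAt.2 fun x => (h x).gradient (m := 0) (by norm_num)).continuous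
  obtain ⟨c, hc'⟩ := (isCompact_closedBall (0 : EuclideanSpace ℝ (Fin N)) 2).bddAbove_image
    hc.continuousOn
  refine ⟨max c 0, le_max_right _ _, fun y => ?_⟩
  by_cases hy : ‖y‖ ≤ 2
  · exact (hc' ⟨y, by simpa using hy, rfl⟩).trans (le_max_left _ _)
  · rw [gradient_bump_eq_zero (not_le.1 hy)]; simp

lemma annulusCutoff_mem (n : ℕ) (x : EuclideanSpace ℝ (Fin N)) :
    0 ≤ annulusCutoff N n x ∧ annulusCutoff N n x ≤ 1 := by
  have h1 := (originBump N).nonneg' ((n + 1 : ℝ)⁻¹ • x)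
  have h2 := (originBump N).le_one (x := (n + 1 : ℝ)⁻¹ • x)
  have h3 := (originBump N).nonneg' ((n + 1 : ℝ) • x)
  have h4 := (originBump N).le_one (x := (n + 1 : ℝ) • x)
  unfold annulusCutoff
  constructor <;> nlinarith

/-- The gradient of `annulusCutoff`. -/
def annulusCutoffGrad (N n : ℕ) (x : EuclideanSpace ℝ (Fin N)) : EuclideanSpace ℝ (Fin N) :=
  originBump N ((n + 1 : ℝ)⁻¹ • x) • (0 - (n + 1 : ℝ) • ∇ (originBump N) ((n + 1 : ℝ) • x)) +
    (1 - originBump N ((n + 1 : ℝ) • x)) •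
      ((n + 1 : ℝ)⁻¹ • ∇ (originBump N) ((n + 1 : ℝ)⁻¹ • x))

lemma hasGradAt_annulusCutoff (n : ℕ) (x : EuclideanSpace ℝ (Fin N)) :
    HasGradAt (annulusCutoff N n) (annulusCutoffGrad N n x) x :=
  (hasGradAt_bump_smul _ x).mul ((hasGradAt_const 1).sub (hasGradAt_bump_smul _ x))

lemma exists_annulusCutoffGrad_bound (N : ℕ) :
    ∃ c : ℝ, ∀ n x, x ≠ 0 → ‖annulusCutoffGrad N n x‖ ≤ c / ‖x‖ := by
  obtain ⟨c, hc0, hc⟩ := exists_bump_gradient_bound N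
  have key : ∀ (a : ℝ) (x : EuclideanSpace ℝ (Fin N)), 0 < a → x ≠ 0 →
      ‖a • ∇ (originBump N) (a • x)‖ ≤ c / ‖x‖ := by
    intro a x ha hx
    rw [le_div_iff₀ (norm_pos_iff.2 hx)]
    have := hc (a • x)
    rw [norm_smul, Real.norm_of_nonneg ha.le] at *
    linarith
  refine ⟨c + c, fun n x hx => ?_⟩
  have hn : (0 : ℝ) < n + 1 := by positivity
  have h1 := (originBump N).nonneg' ((n + 1 : ℝ)⁻¹ • x)
  have h2 := (originBump N).le_one (x := (n + 1 : ℝ)⁻¹ • x)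
  have h3 := (originBump N).nonneg' ((n + 1 : ℝ) • x)
  have h4 := (originBump N).le_one (x := (n + 1 : ℝ) • x)
  rw [add_div]
  refine (norm_add_le _ _).trans (add_le_add ?_ ?_)
  · rw [norm_smul, zero_sub, norm_neg, Real.norm_of_nonneg h1]
    exact (mul_le_of_le_one_left (norm_nonneg _) h2).trans (key _ x hn hx)
  · rw [norm_smul, Real.norm_of_nonneg (by linarith)]
    exact (mul_le_of_le_one_left (norm_nonneg _) (by linarith)).trans
      (key _ x (inv_pos.2 hn) hx)

lemma eventually_annulusCutoff {x : EuclideanSpace ℝ (Fin N)} (hx : x ≠ 0) :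
    ∀ᶠ n : ℕ in Filter.atTop, annulusCutoff N n x = 1 ∧ annulusCutoffGrad N n x = 0 := by
  have hx' := norm_pos_iff.2 hx
  obtain ⟨m, hm⟩ := exists_nat_gt (max ‖x‖ (2 / ‖x‖))
  filter_upwards [Filter.eventually_ge_atTop m] with n hn
  have hn' : (m : ℝ) ≤ n := by exact_mod_cast hn
  have hpos : (0 : ℝ) < n + 1 := by positivity
  have a1 : ‖x‖ < n + 1 := by linarith [le_max_left ‖x‖ (2 / ‖x‖)]
  have a2 : 2 / ‖x‖ < n + 1 := by linarith [le_max_right ‖x‖ (2 / ‖x‖)]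
  have b1 : ‖(n + 1 : ℝ)⁻¹ • x‖ < 1 := by
    rw [norm_smul, Real.norm_of_nonneg (by positivity), inv_mul_lt_iff₀ hpos]; linarith
  have b2 : 2 < ‖(n + 1 : ℝ) • x‖ := by
    rw [norm_smul, Real.norm_of_nonneg hpos.le]; rwa [div_lt_iff₀ hx'] at a2
  have c1 : originBump N ((n + 1 : ℝ)⁻¹ • x) = 1 :=
    (originBump N).one_of_mem_closedBall (by simpa [originBump] using b1.le)
  have c2 : originBump N ((n + 1 : ℝ) • x) = 0 :=
    (originBump N).zero_of_le_dist (by simpa [originBump] using b2.le)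
  unfold annulusCutoff annulusCutoffGrad
  rw [c1, c2, gradient_bump_eq_zero b2, gradient_bump_eq_zero' b1]
  simp

lemma annulusCutoff_support (n : ℕ) {x : EuclideanSpace ℝ (Fin N)}
    (h : annulusCutoff N n x ≠ 0) : ‖x‖ ≤ 2 * (n + 1) ∧ 1 / (n + 1) ≤ ‖x‖ := by
  have hpos : (0 : ℝ) < n + 1 := by positivity
  constructor
  · by_contra! hx
    refine h ?_
    have : originBump N ((n + 1 : ℝ)⁻¹ • x) = 0 := by
      refine (originBump N).zero_of_le_dist ?_
      simp only [originBump, dist_zero_right]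
      rw [norm_smul, Real.norm_of_nonneg (by positivity), le_inv_mul_iff₀ hpos]; linarith
    simp [annulusCutoff, this]
  · by_contra! hx
    refine h ?_
    have : originBump N ((n + 1 : ℝ) • x) = 1 := by
      refine (originBump N).one_of_mem_closedBall ?_
      simp only [originBump, mem_closedBall_zero_iff]
      rw [norm_smul, Real.norm_of_nonneg hpos.le]
      rw [lt_div_iff₀ hpos] at hx; linarith
    simp [annulusCutoff, this]

/-- The divergence theorem on the punctured space, for fields whose flux through small and
large spheres is negligible in the mean. -/
theorem integral_divergence_eq_zero [Nontrivial (EuclideanSpace ℝ (Fin N))]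
    {F : EuclideanSpace ℝ (Fin N) → EuclideanSpace ℝ (Fin N)}
    {d : EuclideanSpace ℝ (Fin N) → ℝ} (hF : ∀ x, x ≠ 0 → HasDivAt F (d x) x)
    (h1 : Integrable fun x => ‖F x‖ / ‖x‖) (h2 : Integrable d) : ∫ x, d x = 0 := by
  have hne : ∀ᵐ x : EuclideanSpace ℝ (Fin N), x ≠ 0 := Measure.ae_ne volume 0
  -- the truncated fields
  have hstep : ∀ n : ℕ, ∫ x, (annulusCutoff N n x * d x + inner ℝ (annulusCutoffGrad N n x) (F x)) = 0 := by
    intro n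
    refine integral_divergence_eq_zero_of_compact
      (F := fun x => annulusCutoff N n x • F x) (fun x => ?_) ?_
    · by_cases hx : x = 0
      · subst hx
        have hev : ∀ᶠ y in nhds (0 : EuclideanSpace ℝ (Fin N)), annulusCutoff N n y = 0 := by
          have : ∀ᶠ y in nhds (0 : EuclideanSpace ℝ (Fin N)), ‖y‖ < 1 / (n + 1) := by
            have := Metric.ball_mem_nhds (0 : EuclideanSpace ℝ (Fin N))
              (show (0 : ℝ) < 1 / (n + 1) by positivity)
            filter_upwards [this] with y hy
            simpa using hy
          filter_upwards [this] with y hy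
          by_contra h
          exact absurd (annulusCutoff_support n h).2 (not_le.2 hy)
        have hg : annulusCutoffGrad N n (0 : EuclideanSpace ℝ (Fin N)) = 0 := by
          have e1 := (hasGradAt_annulusCutoff (N := N) n 0).2.gradient
          have e2 : annulusCutoff N n =ᶠ[nhds (0 : EuclideanSpace ℝ (Fin N))] fun _ => 0 := hev
          rw [← e1, e2.gradient_eq]; simp
        rw [hg, hev.self_of_nhds]
        refine ((hasDivAt_const 0).congr_fun (G := fun x => annulusCutoff N n x • F x) ?_).congr
          (by simp)
        filter_upwards [hev] with y hy
        simp [hy]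
      · exact HasDivAt.smul (hasGradAt_annulusCutoff n x) (hF x hx)
    · refine HasCompactSupport.of_support_subset_isCompact
        (isCompact_closedBall (0 : EuclideanSpace ℝ (Fin N)) (2 * (n + 1))) fun x hx => ?_
      have : annulusCutoff N n x ≠ 0 := fun h => hx (by simp [h])
      simpa using (annulusCutoff_support n this).1
  obtain ⟨c, hc⟩ := exists_annulusCutoffGrad_bound N
  have hmeasF : AEStronglyMeasurable F volume := by
    have : ContinuousOn F {0}ᶜ := fun x hx => (hF x hx).1.continuousAt.continuousWithinAt
    have := this.aestronglyMeasurable (μ := volume) (measurableSet_singleton _).compl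
    rwa [Measure.restrict_eq_self_of_ae_mem] at this
    exact hne
  have hm1 : ∀ n, Continuous (annulusCutoff N n) := fun n =>
    continuous_iff_continuousAt.2 fun x => (hasGradAt_annulusCutoff n x).1.continuousAt
  have hbc : Continuous (∇ (originBump N : EuclideanSpace ℝ (Fin N) → ℝ)) := by
    have h : ∀ x, ContDiffAt ℝ 1 (originBump N : EuclideanSpace ℝ (Fin N) → ℝ) x :=
      fun x => (originBump N).contDiff.contDiffAt
    exact (contDiff_iff_contDiffAt.2 fun x => (h x).gradient (m := 0) (by norm_num)).continuous
  have hm2 : ∀ n, Continuous (annulusCutoffGrad N n) := by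
    intro n
    have := (originBump N).continuous
    unfold annulusCutoffGrad
    fun_prop
  have hlim : Filter.Tendsto (fun n : ℕ => ∫ x, (annulusCutoff N n x * d x + inner ℝ (annulusCutoffGrad N n x) (F x)))
      Filter.atTop (nhds (∫ x, d x)) := by
    -- The second term of the majorant comes from the bound c/|x| on the cutoff gradient; it is the
    -- reason for assuming |F|/|x| integrable.
    refine tendsto_integral_of_dominated_convergence (fun x => ‖d x‖ + c * (‖F x‖ / ‖x‖)) ?_ ?_ ?_ ?_
    · intro n
      exact ((hm1 n).aestronglyMeasurable.mul h2.1).add ((hm2 n).aestronglyMeasurable.inner hmeasF)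
    · exact h2.norm.add (h1.const_mul c)
    · intro n
      filter_upwards [hne] with x hx
      refine (norm_add_le _ _).trans (add_le_add ?_ ?_)
      · rw [norm_mul, Real.norm_of_nonneg (annulusCutoff_mem n x).1]
        exact mul_le_of_le_one_left (norm_nonneg _) (annulusCutoff_mem n x).2
      · refine (norm_inner_le_norm _ _).trans ?_
        calc _ ≤ c / ‖x‖ * ‖F x‖ := mul_le_mul_of_nonneg_right (hc n x hx) (norm_nonneg _)
          _ = _ := by ring
    · filter_upwards [hne] with x hx
      refine tendsto_const_nhds.congr' ?_
      filter_upwards [eventually_annulusCutoff hx] with n hn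
      simp [hn.1, hn.2]
  simp only [hstep] at hlim
  exact (tendsto_nhds_unique hlim tendsto_const_nhds)

end DivergenceTheorem

/-! ### The pointwise identity behind the inequality. -/

noncomputable section KeyIdentity

variable {N : ℕ} {x : EuclideanSpace ℝ (Fin N)} {u χ : EuclideanSpace ℝ (Fin N) → ℝ}

lemma real_inner_self_rpow (x : EuclideanSpace ℝ (Fin N)) : inner ℝ x x = ‖x‖ ^ (2 : ℝ) := by
  rw [real_inner_self_eq_norm_sq]; norm_cast

lemma hasDivAt_rpow_smul_self {ψ : EuclideanSpace ℝ (Fin N) → ℝ} {g : EuclideanSpace ℝ (Fin N)}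
    (hx : x ≠ 0) (hψ : HasGradAt ψ g x) (m : ℝ) :
    HasDivAt (fun y => ‖y‖ ^ m • ψ y • y) (‖x‖ ^ m * ((N + m) * ψ x + inner ℝ g x)) x := by
  have hn := norm_pos_iff.2 hx
  refine (HasDivAt.smul (hasGradAt_rpow m hx) (HasDivAt.smul hψ hasDivAt_id)).congr ?_
  have : ‖x‖ ^ (m - 2) * ‖x‖ ^ (2 : ℝ) = ‖x‖ ^ m := by rw [← Real.rpow_add hn]; ring_nf
  simp only [inner_smul_left, inner_smul_right, real_inner_self_rpow]
  simp only [← this, conj_trivial]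
  ring

/-- This is a polarised, weighted Rellich–Pohozaev identity. The second derivatives of χ produced by
the two halves of the field cancel, and those of u survive only in Δu and ∇(x·∇u). -/
lemma hasDivAt_pohozaev (hx : x ≠ 0) (hu : ContDiffAt ℝ 2 u x) (hχ : ContDiffAt ℝ 2 χ x) (m : ℝ) :
    HasDivAt (fun y => ‖y‖ ^ m • (euler χ y • ∇ u y - inner ℝ (∇ u y) (∇ χ y) • y))
      (‖x‖ ^ m * (euler χ x * (Δ u) x - (N - 2 + m) * inner ℝ (∇ u x) (∇ χ x) -
        inner ℝ (∇ (euler u) x) (∇ χ x)) + m * ‖x‖ ^ (m - 2) * (euler χ x * euler u x)) x := by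
  have hn := norm_pos_iff.2 hx
  obtain ⟨g, hg, hgx⟩ := hasGradAt_inner_gradient hu hχ
  refine (HasDivAt.smul (hasGradAt_rpow m hx) ((HasDivAt.smul
    (hχ.euler (m := 1) (by norm_num)).hasGradAt (hasDivAt_gradient hu)).sub
    (HasDivAt.smul hg hasDivAt_id))).congr ?_
  have : ‖x‖ ^ (m - 2) * ‖x‖ ^ (2 : ℝ) = ‖x‖ ^ m := by rw [← Real.rpow_add hn]; ring_nf
  simp only [inner_smul_left, inner_smul_right, inner_sub_right, real_inner_self_rpow, hgx,
    inner_sub_left, conj_trivial]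
  rw [show inner ℝ x (∇ u x) = euler u x from rfl, real_inner_comm (∇ χ x) (∇ u x)]
  simp only [← this]
  ring

/-- The auxiliary function `2 x·∇u + (N - 4 - 2α) u`. -/
def auxFun (α : ℝ) (u : EuclideanSpace ℝ (Fin N) → ℝ) (x : EuclideanSpace ℝ (Fin N)) : ℝ :=
  2 * euler u x + (N - 4 - 2 * α) * u x

/-- The vector field `2∇(x·∇u) + (N - 4 - 2α)∇u + t|x|^{2α+2}∇u - xΔu`. -/
def residualField (α t : ℝ) (u : EuclideanSpace ℝ (Fin N) → ℝ) (x : EuclideanSpace ℝ (Fin N)) :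
    EuclideanSpace ℝ (Fin N) :=
  ∇ (auxFun α u) x + (t * ‖x‖ ^ (2 * α + 2)) • ∇ u x - (Δ u) x • x

/-- The density `|Δu|²/|x|^{2α} + t²|x|^{2α+2}|∇u|² - t (N + 4α + 2)|∇u|²`. -/
def uncertaintyDensity (α t : ℝ) (u : EuclideanSpace ℝ (Fin N) → ℝ)
    (x : EuclideanSpace ℝ (Fin N)) : ℝ :=
  laplacianDensity α u x + t ^ 2 * weightedGradientDensity α u x -
    t * (N + 4 * α + 2) * gradientDensity u x

/-- The flux in the divergence identity `hasDivAt_uncertaintyFlux`. -/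
def uncertaintyFlux (α t : ℝ) (u : EuclideanSpace ℝ (Fin N) → ℝ)
    (x : EuclideanSpace ℝ (Fin N)) : EuclideanSpace ℝ (Fin N) :=
  (2 : ℝ) • (‖x‖ ^ (-2 * α - 2) •
      (euler (auxFun α u) x • ∇ u x - inner ℝ (∇ u x) (∇ (auxFun α u) x) • x)) +
    (N - 4 - 2 * α : ℝ) • (‖x‖ ^ (-2 * α - 2) • inner ℝ (∇ u x) (∇ u x) • x) +
    (2 * (2 * α + 2)) • (‖x‖ ^ (-2 * α - 4) • (euler u x * euler u x) • x) +
    t • ((2 : ℝ) • (euler u x • ∇ u x) - (3 : ℝ) • (inner ℝ (∇ u x) (∇ u x) • x))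

lemma contDiffAt_auxFun {m n : WithTop ℕ∞} (α : ℝ) (hu : ContDiffAt ℝ n u x) (h : m + 1 ≤ n) :
    ContDiffAt ℝ m (auxFun α u) x :=
  (contDiffAt_const.mul (hu.euler h)).add
    (contDiffAt_const.mul (hu.of_le (le_self_add.trans h)))

lemma gradient_auxFun (α : ℝ) (hu : ContDiffAt ℝ 2 u x) :
    ∇ (auxFun α u) x = (2 : ℝ) • ∇ (euler u) x + (N - 4 - 2 * α : ℝ) • ∇ u x := by
  have h1 := (hu.euler (m := 1) (by norm_num)).hasGradAt
  have h2 := (hu.of_le (m := 1) (by norm_num)).hasGradAt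
  exact ((h1.const_mul 2).add (h2.const_mul _)).2.gradient

/-- Write G for the gradient of `auxFun`. In W|R|² the mixed term of G and xΔu is treated by the
Pohozaev identity with m = -2α-2 and χ the auxiliary function. The constant N-4-2α in `auxFun` is
the coefficient N-2+m occurring there, so the identity reproduces -W|G|² up to a multiple of W⟨∇u,
G⟩. The next two fluxes absorb that multiple and the derivative of the weight. The terms linear in t
form a divergence exactly when the coefficient of |∇u|² in the density is N+4α+2. -/
theorem hasDivAt_uncertaintyFlux (α t : ℝ) (hx : x ≠ 0) (hu : ContDiffAt ℝ 3 u x) :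
    HasDivAt (uncertaintyFlux α t u)
      (uncertaintyDensity α t u x - ‖x‖ ^ (-2 * α - 2) * ‖residualField α t u x‖ ^ 2) x := by
  have hn := norm_pos_iff.2 hx
  have hu2 : ContDiffAt ℝ 2 u x := hu.of_le (by norm_num)
  have hχ : ContDiffAt ℝ 2 (auxFun α u) x := contDiffAt_auxFun α hu (by norm_num)
  obtain ⟨g, hg, hgx⟩ := hasGradAt_inner_gradient hu2 hu2
  have hT := (hu2.euler (m := 1) (by norm_num)).hasGradAt
  have d1 := (hasDivAt_pohozaev hx hu2 hχ (-2 * α - 2)).const_smul 2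
  have d2 := (hasDivAt_rpow_smul_self hx hg (-2 * α - 2)).const_smul (N - 4 - 2 * α : ℝ)
  have d3 := (hasDivAt_rpow_smul_self hx (hT.mul hT) (-2 * α - 4)).const_smul (2 * (2 * α + 2))
  have d4 := (((HasDivAt.smul hT (hasDivAt_gradient hu2)).const_smul 2).sub
    ((HasDivAt.smul hg hasDivAt_id).const_smul 3)).const_smul t
  refine (((d1.add d2).add d3).add d4).congr ?_
  have e1 : ‖x‖ ^ (-2 * α - 2) = ‖x‖ ^ (-2 * α - 4) * ‖x‖ ^ (2 : ℝ) := by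
    rw [← Real.rpow_add hn]; ring_nf
  have e2 : ‖x‖ ^ (2 * α + 2) = (‖x‖ ^ (-2 * α - 4) * ‖x‖ ^ (2 : ℝ))⁻¹ := by
    rw [← e1, ← Real.rpow_neg hn.le]; ring_nf
  have e3 : ‖x‖ ^ (2 * α) = (‖x‖ ^ (-2 * α - 4) * ‖x‖ ^ (2 : ℝ) * ‖x‖ ^ (2 : ℝ))⁻¹ := by
    rw [← e1, ← Real.rpow_add hn, ← Real.rpow_neg hn.le]; ring_nf
  have e4 : ‖x‖ ^ (-2 * α - 2 - 2) = ‖x‖ ^ (-2 * α - 4) := by ring_nf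
  have eT : euler (auxFun α u) x = 2 * inner ℝ x (∇ (euler u) x) + (N - 4 - 2 * α) * euler u x := by
    rw [euler, gradient_auxFun α hu2, inner_add_right, inner_smul_right, inner_smul_right, euler]
  have eN : ‖residualField α t u x‖ ^ 2 = inner ℝ (residualField α t u x) (residualField α t u x) :=
    (real_inner_self_eq_norm_sq _).symm
  have hc : 0 < ‖x‖ ^ (-2 * α - 4) := Real.rpow_pos_of_pos hn _
  have hr : 0 < ‖x‖ ^ (2 : ℝ) := Real.rpow_pos_of_pos hn _
  rw [eN]
  unfold uncertaintyDensity laplacianDensity weightedGradientDensity gradientDensity residualField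
  rw [sq_abs, ← real_inner_self_eq_norm_sq (∇ u x), eT, e3, e4, gradient_auxFun α hu2]
  simp only [inner_smul_left, inner_smul_right, inner_sub_right, real_inner_self_rpow x, hgx,
    inner_sub_left, conj_trivial, inner_add_left, inner_add_right]
  rw [real_inner_comm x (∇ (euler u) x), real_inner_comm x (∇ u x),
    real_inner_comm (∇ u x) (∇ (euler u) x), e1, e2]
  rw [show inner ℝ x (∇ u x) = euler u x from rfl]
  generalize ‖x‖ ^ (-2 * α - 4) = c at *
  generalize ‖x‖ ^ (2 : ℝ) = r at *
  field_simp
  ring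

end KeyIdentity

/-! ### Integrability criteria, and the inequality for N > 2α+2. -/

noncomputable section Integrability

variable {N : ℕ}

lemma nontrivial_of_one_le (hN : 1 ≤ N) : Nontrivial (EuclideanSpace ℝ (Fin N)) := by
  have : Nonempty (Fin N) := ⟨⟨0, hN⟩⟩
  infer_instance

lemma integrable_piecewise_rpow (hN : 1 ≤ N) {a b : ℝ} (ha : -N < a) (hb : b < -N) :
    Integrable fun x : EuclideanSpace ℝ (Fin N) => if ‖x‖ ≤ 1 then ‖x‖ ^ a else ‖x‖ ^ b := by
  have := nontrivial_of_one_le hN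
  refine (integrable_fun_norm_addHaar (volume : Measure (EuclideanSpace ℝ (Fin N)))
    (f := fun r => if r ≤ 1 then r ^ a else r ^ b)).2 ?_
  rw [finrank_euclideanSpace_fin]
  have hcast : ((N - 1 : ℕ) : ℝ) = N - 1 := by push_cast [hN]; ring
  rw [← Set.Ioc_union_Ioi_eq_Ioi (zero_le_one' ℝ)]
  refine IntegrableOn.union ?_ ?_
  · have h : IntegrableOn (fun r : ℝ => r ^ ((N : ℝ) - 1 + a)) (Set.Ioc 0 1) := by
      rw [← intervalIntegrable_iff_integrableOn_Ioc_of_le zero_le_one]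
      exact intervalIntegral.intervalIntegrable_rpow' (by linarith)
    refine h.congr_fun (fun r hr => ?_) measurableSet_Ioc
    simp only [hr.2, if_true, smul_eq_mul]
    rw [Real.rpow_add hr.1, ← hcast, Real.rpow_natCast]
  · have h : IntegrableOn (fun r : ℝ => r ^ ((N : ℝ) - 1 + b)) (Set.Ioi 1) :=
      integrableOn_Ioi_rpow_of_lt (by linarith) one_pos
    refine h.congr_fun (fun r hr => ?_) measurableSet_Ioi
    have hr' : (1 : ℝ) < r := hr
    simp only [not_le.2 hr', if_false, smul_eq_mul]
    rw [Real.rpow_add (by linarith), ← hcast, Real.rpow_natCast]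

lemma integrable_of_rpow_bounds (hN : 1 ≤ N) {F : Type*} [NormedAddCommGroup F]
    {f : EuclideanSpace ℝ (Fin N) → F}
    (hf : AEStronglyMeasurable f volume) {a b K : ℝ} (ha : -N < a) (hb : b < -N)
    (h0 : ∀ x, x ≠ 0 → ‖x‖ ≤ 1 → ‖f x‖ ≤ K * ‖x‖ ^ a)
    (h1 : ∀ x, 1 ≤ ‖x‖ → ‖f x‖ ≤ K * ‖x‖ ^ b) : Integrable f := by
  have := nontrivial_of_one_le hN
  refine ((integrable_piecewise_rpow hN ha hb).const_mul K).mono' hf ?_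
  filter_upwards [Measure.ae_ne volume (0 : EuclideanSpace ℝ (Fin N))] with x hx
  by_cases h : ‖x‖ ≤ 1
  · simpa [h] using h0 x hx h
  · simpa [h] using h1 x (not_le.1 h).le

lemma aestronglyMeasurable_of_continuousOn_ne_zero [Nontrivial (EuclideanSpace ℝ (Fin N))]
    {F : Type*} [NormedAddCommGroup F] [SecondCountableTopology F]
    {f : EuclideanSpace ℝ (Fin N) → F} (hf : ∀ x, x ≠ 0 → ContinuousAt f x) :
    AEStronglyMeasurable f volume := by
  have : ContinuousOn f {0}ᶜ := fun x hx => (hf x hx).continuousWithinAt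
  have := this.aestronglyMeasurable (μ := volume) (measurableSet_singleton _).compl
  rwa [Measure.restrict_eq_self_of_ae_mem] at this
  exact Measure.ae_ne volume 0

/-- A function bounded by a locally integrable power times a compactly supported function. -/
lemma integrable_of_compact_rpow_bound (hN : 1 ≤ N) {F : Type*} [NormedAddCommGroup F]
    {f : EuclideanSpace ℝ (Fin N) → F} (hf : AEStronglyMeasurable f volume)
    {a : ℝ} (ha : -N < a) {g : EuclideanSpace ℝ (Fin N) → ℝ}
    (hg : Continuous g) (hgc : HasCompactSupport g)
    (h : ∀ x, x ≠ 0 → ‖f x‖ ≤ g x * ‖x‖ ^ a) : Integrable f := by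
  obtain ⟨K, hK⟩ := hg.bounded_above_of_compact_support hgc
  -- The extra power turns compact support into decay of order N+1 at infinity, even after
  -- multiplication by |x|^a.
  have hg2 : Continuous fun x : EuclideanSpace ℝ (Fin N) => g x * (1 + ‖x‖) ^ (|a| + N + 1) := by
    refine hg.mul (Continuous.rpow_const (by fun_prop) fun x => Or.inl (by positivity))
  obtain ⟨K', hK'⟩ := hg2.bounded_above_of_compact_support (hgc.mul_right)
  refine integrable_of_rpow_bounds hN hf (K := max K K') ha (b := -(N + 1 : ℝ)) (by linarith)
    (fun x hx hx1 => ?_) (fun x hx => ?_)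
  · refine (h x hx).trans (mul_le_mul_of_nonneg_right ?_ (by positivity))
    exact (le_abs_self _).trans ((hK x).trans (le_max_left _ _))
  · have hx0 : 0 < ‖x‖ := by linarith
    have h1 := h x (norm_pos_iff.1 hx0)
    have hg0 : 0 ≤ g x := by
      by_contra! hneg
      have := norm_nonneg (f x)
      nlinarith [Real.rpow_pos_of_pos hx0 a]
    have h2 : g x * (1 + ‖x‖) ^ (|a| + N + 1) ≤ max K K' :=
      (le_abs_self _).trans ((hK' x).trans (le_max_right _ _))
    refine h1.trans ?_
    rw [Real.rpow_neg hx0.le, ← div_eq_mul_inv, le_div_iff₀ (by positivity)]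
    refine le_trans ?_ h2
    rw [mul_assoc, ← Real.rpow_add hx0]
    refine mul_le_mul_of_nonneg_left ?_ hg0
    calc ‖x‖ ^ (a + (N + 1 : ℝ)) ≤ ‖x‖ ^ (|a| + N + 1) :=
          Real.rpow_le_rpow_of_exponent_le hx (by linarith [le_abs_self a])
      _ ≤ _ := Real.rpow_le_rpow hx0.le (by linarith) (by positivity)

/-- Raise y/q ≤ exp(y/q) to the power q. -/
lemma exp_neg_le_rpow {q : ℝ} (hq : 0 < q) {y : ℝ} (hy : 0 < y) :
    Real.exp (-y) ≤ q ^ q * y ^ (-q) := by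
  have h1 : y / q ≤ Real.exp (y / q) := by linarith [Real.add_one_le_exp (y / q)]
  have h2 : (y / q) ^ q ≤ Real.exp y := by
    calc (y / q) ^ q ≤ (Real.exp (y / q)) ^ q :=
          Real.rpow_le_rpow (by positivity) h1 hq.le
      _ = Real.exp y := by rw [← Real.exp_mul]; field_simp
  rw [Real.exp_neg, Real.rpow_neg hy.le, ← div_eq_mul_inv, inv_le_comm₀ (Real.exp_pos _) (by positivity)]
  rw [Real.div_rpow hy.le hq.le] at h2
  rwa [inv_div]

lemma uncertainty_of_quadratic {A B D C : ℝ} (hA : 0 ≤ A)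
    (h : ∀ t : ℝ, 0 ≤ A + t ^ 2 * B - t * (2 * C) * D) : |C| * D ≤ √A * √B := by
  have h1 := discrim_le_zero (a := B) (b := -(2 * C * D)) (c := A) fun t => by
    have := h t; nlinarith
  rw [discrim] at h1
  rw [← Real.sqrt_mul hA]
  refine Real.le_sqrt_of_sq_le ?_
  rw [mul_pow, sq_abs]
  nlinarith

/-- For t ≤ 0 every term is already nonnegative when C ≥ 0. Only t > 0 remains to be checked, which
matters because the function subtracted from u in the critical range decays only for t > 0. -/
lemma uncertainty_of_quadratic_pos {A B D C : ℝ} (hA : 0 ≤ A) (hB : 0 ≤ B)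
    (hD : 0 ≤ D) (hC : 0 ≤ C) (h : ∀ t : ℝ, 0 < t → 0 ≤ A + t ^ 2 * B - t * (2 * C) * D) :
    |C| * D ≤ √A * √B := by
  refine uncertainty_of_quadratic hA fun t => ?_
  rcases lt_or_ge 0 t with ht | ht
  · exact h t ht
  · have h1 : 0 ≤ C * D := by positivity
    have h2 : 0 ≤ t ^ 2 * B := by positivity
    nlinarith

lemma laplacianDensity_nonneg (α : ℝ) (u : EuclideanSpace ℝ (Fin N) → ℝ) (x) :
    0 ≤ laplacianDensity α u x := by unfold laplacianDensity; positivity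

lemma weightedGradientDensity_nonneg (α : ℝ) (u : EuclideanSpace ℝ (Fin N) → ℝ) (x) :
    0 ≤ weightedGradientDensity α u x := by unfold weightedGradientDensity; positivity

lemma gradientDensity_nonneg (u : EuclideanSpace ℝ (Fin N) → ℝ) (x) :
    0 ≤ gradientDensity u x := by unfold gradientDensity; positivity

lemma continuous_gradient {u : EuclideanSpace ℝ (Fin N) → ℝ} (hu : ContDiff ℝ 1 u) :
    Continuous (∇ u) :=
  (contDiff_iff_contDiffAt.2 fun x => hu.contDiffAt.gradient (x := x) (m := 0) (by norm_num)).continuous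

lemma hasCompactSupport_gradient {u : EuclideanSpace ℝ (Fin N) → ℝ} (hc : HasCompactSupport u) :
    HasCompactSupport (∇ u) := by
  rw [gradient_eq_toDual]
  exact (hc.fderiv ℝ).comp_left (map_zero _)

lemma integrable_gradientDensity {u : EuclideanSpace ℝ (Fin N) → ℝ} (hu : ContDiff ℝ 1 u)
    (hc : HasCompactSupport u) : Integrable (gradientDensity u) := by
  refine Continuous.integrable_of_hasCompactSupport ((continuous_gradient hu).norm.pow 2) ?_
  exact (hasCompactSupport_gradient hc).comp_left (g := fun v => ‖v‖ ^ 2) (by simp)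

lemma integral_uncertaintyDensity {α t : ℝ} {u : EuclideanSpace ℝ (Fin N) → ℝ}
    (h1 : Integrable (laplacianDensity α u)) (h2 : Integrable (weightedGradientDensity α u))
    (h3 : Integrable (gradientDensity u)) :
    ∫ x, uncertaintyDensity α t u x = (∫ x, laplacianDensity α u x) +
      t ^ 2 * (∫ x, weightedGradientDensity α u x) -
        t * (N + 4 * α + 2) * ∫ x, gradientDensity u x := by
  unfold uncertaintyDensity
  rw [integral_sub (f := fun x => laplacianDensity α u x + t ^ 2 * weightedGradientDensity α u x)
    (h1.add (h2.const_mul _)) (h3.const_mul _), integral_add h1 (h2.const_mul _),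
    integral_const_mul, integral_const_mul]

theorem integral_uncertaintyDensity_eq [Nontrivial (EuclideanSpace ℝ (Fin N))] {α t : ℝ}
    {u : EuclideanSpace ℝ (Fin N) → ℝ} (hu : ∀ x, x ≠ 0 → ContDiffAt ℝ 3 u x)
    (hF : Integrable fun x => ‖uncertaintyFlux α t u x‖ / ‖x‖)
    (hq : Integrable (uncertaintyDensity α t u))
    (hV : Integrable fun x => ‖x‖ ^ (-2 * α - 2) * ‖residualField α t u x‖ ^ 2) :
    ∫ x, uncertaintyDensity α t u x =
      ∫ x, ‖x‖ ^ (-2 * α - 2) * ‖residualField α t u x‖ ^ 2 := by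
  have := integral_divergence_eq_zero (fun x hx => hasDivAt_uncertaintyFlux α t hx (hu x hx))
    hF (hq.sub hV)
  rw [integral_sub hq hV] at this
  linarith

/-- Each term of the flux contains a factor x, explicitly or inside a radial derivative. Division by
|x| therefore leaves only quadratic expressions in gradients, with weight |x|^{-2α-2} or 1. -/
lemma norm_uncertaintyFlux_le (α t : ℝ) (u : EuclideanSpace ℝ (Fin N) → ℝ)
    {x : EuclideanSpace ℝ (Fin N)} (hx : x ≠ 0) :
    ‖uncertaintyFlux α t u x‖ / ‖x‖ ≤
      ‖x‖ ^ (-2 * α - 2) * (4 * (‖∇ u x‖ * ‖∇ (auxFun α u) x‖) + |N - 4 - 2 * α| * ‖∇ u x‖ ^ 2 +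
        |2 * (2 * α + 2)| * ‖∇ u x‖ ^ 2) + |t| * (5 * ‖∇ u x‖ ^ 2) := by
  have hn := norm_pos_iff.2 hx
  rw [div_le_iff₀ hn]
  have e4 : ‖x‖ ^ (-2 * α - 2) = ‖x‖ ^ (-2 * α - 4) * ‖x‖ ^ 2 := by
    rw [← Real.rpow_natCast, ← Real.rpow_add hn]; push_cast; ring_nf
  have hE : |euler u x| ≤ ‖x‖ * ‖∇ u x‖ := abs_real_inner_le_norm _ _
  have hE' : |euler (auxFun α u) x| ≤ ‖x‖ * ‖∇ (auxFun α u) x‖ := abs_real_inner_le_norm _ _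
  have hI : |inner ℝ (∇ u x) (∇ (auxFun α u) x)| ≤ ‖∇ u x‖ * ‖∇ (auxFun α u) x‖ :=
    abs_real_inner_le_norm _ _
  have hI2 : |inner ℝ (∇ u x) (∇ u x)| = ‖∇ u x‖ ^ 2 := by
    rw [real_inner_self_eq_norm_sq, abs_of_nonneg (by positivity)]
  set p := ‖∇ u x‖
  set c := ‖∇ (auxFun α u) x‖
  have hp : 0 ≤ p := norm_nonneg _
  have hc : 0 ≤ c := norm_nonneg _
  set k := ‖x‖ ^ (-2 * α - 4)
  have hk : 0 < k := Real.rpow_pos_of_pos hn _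
  have b1 : ‖(2 : ℝ) • (‖x‖ ^ (-2 * α - 2) • (euler (auxFun α u) x • ∇ u x -
      inner ℝ (∇ u x) (∇ (auxFun α u) x) • x))‖ ≤ ‖x‖ ^ (-2 * α - 2) * (4 * (p * c)) * ‖x‖ := by
    rw [norm_smul, norm_smul, Real.norm_of_nonneg (Real.rpow_nonneg hn.le _)]
    have : ‖euler (auxFun α u) x • ∇ u x - inner ℝ (∇ u x) (∇ (auxFun α u) x) • x‖ ≤
        2 * (p * c * ‖x‖) := by
      refine (norm_sub_le _ _).trans ?_
      rw [norm_smul, norm_smul, Real.norm_eq_abs, Real.norm_eq_abs]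
      have := mul_le_mul_of_nonneg_right hE' hp
      have := mul_le_mul_of_nonneg_right hI hn.le
      linarith
    calc _ ≤ ‖(2 : ℝ)‖ * (‖x‖ ^ (-2 * α - 2) * (2 * (p * c * ‖x‖))) := by gcongr
      _ = _ := by norm_num; ring
  have b2 : ‖(N - 4 - 2 * α : ℝ) • (‖x‖ ^ (-2 * α - 2) • inner ℝ (∇ u x) (∇ u x) • x)‖ ≤
      ‖x‖ ^ (-2 * α - 2) * (|N - 4 - 2 * α| * p ^ 2) * ‖x‖ := by
    rw [norm_smul, norm_smul, norm_smul, Real.norm_of_nonneg (Real.rpow_nonneg hn.le (-2 * α - 2)),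
      Real.norm_eq_abs, Real.norm_eq_abs, hI2]
    exact le_of_eq (by ring)
  have b3 : ‖(2 * (2 * α + 2)) • (‖x‖ ^ (-2 * α - 4) • (euler u x * euler u x) • x)‖ ≤
      ‖x‖ ^ (-2 * α - 2) * (|2 * (2 * α + 2)| * p ^ 2) * ‖x‖ := by
    rw [norm_smul, norm_smul, norm_smul, Real.norm_of_nonneg (Real.rpow_nonneg hn.le (-2 * α - 4)),
      Real.norm_eq_abs, Real.norm_eq_abs, e4, abs_mul (euler u x)]
    have : |euler u x| * |euler u x| ≤ (‖x‖ * p) * (‖x‖ * p) :=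
      mul_le_mul hE hE (abs_nonneg _) (by positivity)
    calc _ ≤ |2 * (2 * α + 2)| * (k * ((‖x‖ * p) * (‖x‖ * p) * ‖x‖)) := by gcongr
      _ = _ := by ring
  have b4 : ‖t • ((2 : ℝ) • (euler u x • ∇ u x) - (3 : ℝ) • (inner ℝ (∇ u x) (∇ u x) • x))‖ ≤
      |t| * (5 * p ^ 2) * ‖x‖ := by
    rw [norm_smul, Real.norm_eq_abs, mul_assoc]
    refine mul_le_mul_of_nonneg_left ?_ (abs_nonneg _)
    refine (norm_sub_le _ _).trans ?_
    rw [norm_smul, norm_smul, norm_smul, norm_smul, Real.norm_eq_abs (euler u x),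
      Real.norm_eq_abs (inner ℝ (∇ u x) (∇ u x)), hI2]
    have := mul_le_mul_of_nonneg_right hE hp
    norm_num
    nlinarith
  unfold uncertaintyFlux
  refine (norm_add_le _ _).trans ?_
  refine (add_le_add ((norm_add_le _ _).trans (add_le_add ((norm_add_le _ _).trans
    (add_le_add b1 b2)) b3)) b4).trans (le_of_eq (by ring))

lemma ContDiffAt.continuousAt_laplacian {u : EuclideanSpace ℝ (Fin N) → ℝ}
    {x : EuclideanSpace ℝ (Fin N)} (hu : ContDiffAt ℝ 2 u x) : ContinuousAt (Δ u) x := by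
  have : Δ u = fun x => ∑ i, fderiv ℝ (fderiv ℝ u) x (EuclideanSpace.single i 1) (EuclideanSpace.single i 1) := by
    ext x
    rw [InnerProductSpace.laplacian_eq_iteratedFDeriv_orthonormalBasis u
      (EuclideanSpace.basisFun (Fin N) ℝ)]
    simp [iteratedFDeriv_two_apply]
  rw [this]
  have h : ContinuousAt (fderiv ℝ (fderiv ℝ u)) x :=
    ((hu.fderiv_right (m := 1) (by norm_num)).fderiv_right (m := 0) (by norm_num)).continuousAt
  fun_prop

lemma continuous_laplacian {u : EuclideanSpace ℝ (Fin N) → ℝ} (hu : ContDiff ℝ 2 u) :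
    Continuous (Δ u) :=
  continuous_iff_continuousAt.2 fun _ => hu.contDiffAt.continuousAt_laplacian

lemma ContDiffAt.continuousAt_residualField {α t : ℝ} {u : EuclideanSpace ℝ (Fin N) → ℝ}
    {x : EuclideanSpace ℝ (Fin N)} (hx : x ≠ 0) (hu : ContDiffAt ℝ 2 u x) :
    ContinuousAt (residualField α t u) x := by
  have h1 : ContinuousAt (∇ (auxFun α u)) x :=
    ((contDiffAt_auxFun (m := 1) α hu (by norm_num)).gradient (m := 0) (by norm_num)).continuousAt
  have h2 : ContinuousAt (∇ u) x := (hu.gradient (m := 1) (by norm_num)).continuousAt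
  have h3 := hu.continuousAt_laplacian
  have h4 : ContinuousAt (fun y : EuclideanSpace ℝ (Fin N) => ‖y‖ ^ (2 * α + 2)) x :=
    (hasGradAt_rpow _ hx).1.continuousAt
  unfold residualField
  fun_prop

lemma ContDiffAt.continuousAt_uncertaintyFlux {α t : ℝ} {u : EuclideanSpace ℝ (Fin N) → ℝ}
    {x : EuclideanSpace ℝ (Fin N)} (hx : x ≠ 0) (hu : ContDiffAt ℝ 3 u x) :
    ContinuousAt (uncertaintyFlux α t u) x :=
  (hasDivAt_uncertaintyFlux α t hx hu).1.continuousAt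

/-- The integrated identity for test functions when `N > 2α + 2`. -/
theorem uncertaintyPrinciple_of_lt (hN : 1 ≤ N) {α : ℝ} (h : 2 * α + 2 < N) :
    UncertaintyPrinciple α (testSpace N α) (|N + 4 * α + 2| / 2) := by
  have := nontrivial_of_one_le hN
  rintro u ⟨hu, hc, hA, hB⟩
  have hu3 : ContDiff ℝ 3 u := by exact_mod_cast contDiff_infty.1 hu 3
  have hu2 : ContDiff ℝ 2 u := hu3.of_le (by norm_num)
  have hu1 : ContDiff ℝ 1 u := hu3.of_le (by norm_num)
  have hχ : ContDiff ℝ 1 (auxFun α u) :=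
    contDiff_iff_contDiffAt.2 fun x => contDiffAt_auxFun α hu2.contDiffAt (by norm_num)
  have hχc : HasCompactSupport (auxFun α u) := by
    refine HasCompactSupport.of_support_subset_isCompact hc fun x hx => ?_
    by_contra hx'
    have h0 : u =ᶠ[nhds x] fun _ => 0 := notMem_tsupport_iff_eventuallyEq.1 hx'
    refine hx ?_
    simp [auxFun, euler, h0.gradient_eq, h0.self_of_nhds]
  have hD := integrable_gradientDensity hu1 hc
  have hp := continuous_gradient hu1
  have hpc := hasCompactSupport_gradient hc
  have hg := continuous_gradient hχ
  have hgc := hasCompactSupport_gradient hχc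
  have hL := continuous_laplacian hu2
  have hLc : HasCompactSupport (Δ u) := by
    refine HasCompactSupport.of_support_subset_isCompact hc fun x hx => ?_
    by_contra hx'
    have h0 : u =ᶠ[nhds x] fun _ => 0 := notMem_tsupport_iff_eventuallyEq.1 hx'
    refine hx ?_
    rw [(InnerProductSpace.laplacian_congr_nhds h0).self_of_nhds]
    simp
  -- This local integrability of the weight is the only use of the lower bound on N.
  have hk : -(N : ℝ) < -2 * α - 2 := by linarith
  have key : ∀ t : ℝ, 0 ≤ ∫ x, uncertaintyDensity α t u x := by
    intro t
    rw [integral_uncertaintyDensity_eq (fun x _ => hu3.contDiffAt)]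
    · exact integral_nonneg fun x => by positivity
    · have i1 : Integrable fun x : EuclideanSpace ℝ (Fin N) => ‖x‖ ^ (-2 * α - 2) *
          (4 * (‖∇ u x‖ * ‖∇ (auxFun α u) x‖) + |N - 4 - 2 * α| * ‖∇ u x‖ ^ 2 +
          |2 * (2 * α + 2)| * ‖∇ u x‖ ^ 2) := by
        refine integrable_of_compact_rpow_bound hN
          (aestronglyMeasurable_of_continuousOn_ne_zero fun x hx => ?_) hk
          (g := fun x => 4 * (‖∇ u x‖ * ‖∇ (auxFun α u) x‖) + |N - 4 - 2 * α| * ‖∇ u x‖ ^ 2 +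
          |2 * (2 * α + 2)| * ‖∇ u x‖ ^ 2) (by fun_prop) ?_ fun x hx => ?_
        · have := (hasGradAt_rpow (-2 * α - 2) hx).1.continuousAt
          fun_prop
        · refine hpc.mono' (fun x hx => subset_tsupport _ ?_)
          intro h0
          simp [h0] at hx
        · rw [Real.norm_of_nonneg (by positivity), mul_comm]
      refine (i1.add ((hD.const_mul 5).const_mul |t|)).mono'
        (aestronglyMeasurable_of_continuousOn_ne_zero fun x hx => ?_) ?_
      · exact (hu3.contDiffAt.continuousAt_uncertaintyFlux hx).norm.div continuousAt_id.norm
          (norm_ne_zero_iff.2 hx)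
      · filter_upwards [Measure.ae_ne volume (0 : EuclideanSpace ℝ (Fin N))] with x hx
        rw [Real.norm_of_nonneg (by positivity)]
        exact norm_uncertaintyFlux_le α t u hx
    · exact (hA.add (hB.const_mul _)).sub (hD.const_mul _)
    · have i1 : Integrable fun x : EuclideanSpace ℝ (Fin N) => ‖x‖ ^ (-2 * α - 2) *
          (3 * (‖∇ (auxFun α u) x‖ ^ 2 + ((Δ u) x * ‖x‖) ^ 2)) := by
        refine integrable_of_compact_rpow_bound hN
          (aestronglyMeasurable_of_continuousOn_ne_zero fun x hx => ?_) hk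
          (g := fun x => 3 * (‖∇ (auxFun α u) x‖ ^ 2 + ((Δ u) x * ‖x‖) ^ 2)) (by fun_prop) ?_
          fun x hx => ?_
        · have := (hasGradAt_rpow (-2 * α - 2) hx).1.continuousAt
          fun_prop
        · have := ((hgc.norm.comp_left (g := fun t : ℝ => t ^ 2) (by simp)).add
            ((hLc.mul_right (f' := fun x => ‖x‖)).comp_left (g := fun t : ℝ => t ^ 2) (by simp)))
          exact this.mul_left (f := fun _ => 3)
        · rw [Real.norm_of_nonneg (by positivity), mul_comm]
      refine (i1.add (hB.const_mul (3 * t ^ 2))).mono'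
        (aestronglyMeasurable_of_continuousOn_ne_zero fun x hx => ?_) ?_
      · have := (hasGradAt_rpow (-2 * α - 2) hx).1.continuousAt
        have := hu2.contDiffAt.continuousAt_residualField (α := α) (t := t) hx
        fun_prop
      · filter_upwards [Measure.ae_ne volume (0 : EuclideanSpace ℝ (Fin N))] with x hx
        have hn := norm_pos_iff.2 hx
        rw [Real.norm_of_nonneg (by positivity)]
        -- The term with t is kept separate: its square times the weight is t² times the weighted
        -- gradient density, integrable by assumption, while the other two are bounded with compact
        -- support.
        have hb : ‖residualField α t u x‖ ^ 2 ≤ 3 * (‖∇ (auxFun α u) x‖ ^ 2 +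
            (t * ‖x‖ ^ (2 * α + 2) * ‖∇ u x‖) ^ 2 + ((Δ u) x * ‖x‖) ^ 2) := by
          have h1 : ‖residualField α t u x‖ ≤ ‖∇ (auxFun α u) x‖ +
              |t * ‖x‖ ^ (2 * α + 2) * ‖∇ u x‖| + |(Δ u) x * ‖x‖| := by
            refine (norm_sub_le _ _).trans (add_le_add ((norm_add_le _ _).trans
              (add_le_add le_rfl ?_)) ?_)
            · rw [norm_smul, Real.norm_eq_abs, abs_mul _ ‖∇ u x‖, abs_norm]
            · rw [norm_smul, Real.norm_eq_abs, abs_mul _ ‖x‖, abs_norm]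
          have e1 : |(Δ u) x * ‖x‖| ^ 2 = ((Δ u) x * ‖x‖) ^ 2 := sq_abs _
          rw [← sq_abs (t * _ * _), ← e1]
          have := pow_le_pow_left₀ (norm_nonneg _) h1 2
          refine this.trans ?_
          nlinarith [sq_nonneg (‖∇ (auxFun α u) x‖ - |t * ‖x‖ ^ (2 * α + 2) * ‖∇ u x‖|),
            sq_nonneg (‖∇ (auxFun α u) x‖ - |(Δ u) x * ‖x‖|),
            sq_nonneg (|t * ‖x‖ ^ (2 * α + 2) * ‖∇ u x‖| - |(Δ u) x * ‖x‖|)]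
        have e : ‖x‖ ^ (-2 * α - 2) * ‖x‖ ^ (2 * α + 2) = 1 := by
          rw [← Real.rpow_add hn]; ring_nf; simp
        refine (mul_le_mul_of_nonneg_left hb (Real.rpow_nonneg hn.le _)).trans (le_of_eq ?_)
        simp only [Pi.add_apply, weightedGradientDensity]
        linear_combination (3 * t ^ 2 * ‖x‖ ^ (2 * α + 2) * ‖∇ u x‖ ^ 2) * e
  rw [ge_iff_le, ← abs_two, ← abs_div]
  refine uncertainty_of_quadratic (integral_nonneg (laplacianDensity_nonneg α u))
    fun t => ?_
  have := key t
  rw [integral_uncertaintyDensity hA hB hD] at this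
  linarith

end Integrability

/-! ### Linear functions with Gaussian decay, and their cross terms with a general function. -/

noncomputable section LinearProfile

variable {N : ℕ} {α t : ℝ} {x e : EuclideanSpace ℝ (Fin N)}

/-- The factor `exp(-t|x|^{2α+2}/(2α+2))`. -/
def gaussFactor (α t : ℝ) (x : EuclideanSpace ℝ (Fin N)) : ℝ :=
  Real.exp (-(t / (2 * α + 2)) * ‖x‖ ^ (2 * α + 2))

/-- A quadratic polynomial in `t|x|^{2α+2}` times `gaussFactor`. -/
def gaussProfile (α t a b c : ℝ) (x : EuclideanSpace ℝ (Fin N)) : ℝ :=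
  gaussFactor α t x * (a + b * (t * ‖x‖ ^ (2 * α + 2)) + c * (t * ‖x‖ ^ (2 * α + 2)) ^ 2)

lemma rpow_two_mul_add_two (hx : x ≠ 0) : ‖x‖ ^ (2 * α + 2) = ‖x‖ ^ (2 * α) * ‖x‖ ^ (2 : ℝ) := by
  rw [← Real.rpow_add (norm_pos_iff.2 hx)]

lemma hasGradAt_weight (hx : x ≠ 0) :
    HasGradAt (fun y : EuclideanSpace ℝ (Fin N) => t * ‖y‖ ^ (2 * α + 2))
      (((2 * α + 2) * (t * ‖x‖ ^ (2 * α))) • x) x := by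
  refine ((hasGradAt_rpow (2 * α + 2) hx).const_mul t).congr ?_
  rw [smul_smul, add_sub_cancel_right]; ring_nf

lemma hasGradAt_gaussFactor (hα : 2 * α + 2 ≠ 0) (hx : x ≠ 0) :
    HasGradAt (gaussFactor α t) ((-(t * ‖x‖ ^ (2 * α)) * gaussFactor α t x) • x) x := by
  have h := ((hasGradAt_rpow (2 * α + 2) hx).const_mul (-(t / (2 * α + 2)))).comp
    Real.contDiff_exp.contDiffAt (Real.hasDerivAt_exp _)
  refine h.congr ?_
  rw [smul_smul, smul_smul, add_sub_cancel_right, gaussFactor]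
  congr 1
  have h1 : -(t / (2 * α + 2)) * (2 * α + 2) = -t := by rw [neg_mul, div_mul_cancel₀ _ hα]
  linear_combination (Real.exp (-(t / (2 * α + 2)) * ‖x‖ ^ (2 * α + 2)) * ‖x‖ ^ (2 * α)) * h1

lemma hasGradAt_gaussProfile (hα : 2 * α + 2 ≠ 0) (hx : x ≠ 0) (a b c : ℝ) :
    HasGradAt (gaussProfile α t a b c) ((t * ‖x‖ ^ (2 * α) * gaussFactor α t x *
      (-(a + b * (t * ‖x‖ ^ (2 * α + 2)) + c * (t * ‖x‖ ^ (2 * α + 2)) ^ 2) +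
        (2 * α + 2) * (b + 2 * c * (t * ‖x‖ ^ (2 * α + 2))))) • x) x := by
  have hw := hasGradAt_weight (α := α) (t := t) hx
  have h := (hasGradAt_gaussFactor (t := t) hα hx).mul
    (((hasGradAt_const a).add (hw.const_mul b)).add ((hw.mul hw).const_mul c))
  refine (h.congr_fun (ψ := gaussProfile α t a b c) ?_).congr ?_
  · exact Filter.Eventually.of_forall fun y => by simp only [gaussProfile]; ring
  · module

/-- The function `⟨e, x⟩ exp(-t|x|^{2α+2}/(2α+2))`. -/
def linearGauss (α t : ℝ) (e x : EuclideanSpace ℝ (Fin N)) : ℝ := inner ℝ e x * gaussFactor α t x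

lemma contDiffAt_linearGauss {n : WithTop ℕ∞} (hx : x ≠ 0) :
    ContDiffAt ℝ n (linearGauss α t e) x := by
  have h1 : ContDiffAt ℝ n (fun y : EuclideanSpace ℝ (Fin N) => inner ℝ e y) x :=
    (innerSL ℝ e).contDiff.contDiffAt
  have h2 : ContDiffAt ℝ n (fun y : EuclideanSpace ℝ (Fin N) => ‖y‖ ^ (2 * α + 2)) x :=
    ContDiffAt.rpow_const_of_ne (contDiffAt_norm ℝ hx) (norm_ne_zero_iff.2 hx)
  exact h1.mul (Real.contDiff_exp.contDiffAt.comp x (contDiffAt_const.mul h2))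

lemma hasGradAt_linearGauss (hα : 2 * α + 2 ≠ 0) (hx : x ≠ 0) :
    HasGradAt (linearGauss α t e) (gaussFactor α t x • e -
      (gaussFactor α t x * (t * ‖x‖ ^ (2 * α)) * inner ℝ e x) • x) x := by
  refine ((hasGradAt_inner e).mul (hasGradAt_gaussFactor hα hx)).congr ?_
  module

lemma gradient_linearGauss (hα : 2 * α + 2 ≠ 0) (hx : x ≠ 0) :
    ∇ (linearGauss α t e) x = gaussFactor α t x • e -
      (gaussFactor α t x * (t * ‖x‖ ^ (2 * α)) * inner ℝ e x) • x :=
  (hasGradAt_linearGauss hα hx).2.gradient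

lemma euler_linearGauss (hα : 2 * α + 2 ≠ 0) (hx : x ≠ 0) :
    euler (linearGauss α t e) x = inner ℝ e x * gaussProfile α t 1 (-1) 0 x := by
  rw [euler, gradient_linearGauss hα hx, inner_sub_right, inner_smul_right, inner_smul_right,
    real_inner_self_rpow, real_inner_comm, gaussProfile, rpow_two_mul_add_two hx]
  ring

lemma gradient_euler_linearGauss (hα : 2 * α + 2 ≠ 0) (hx : x ≠ 0) :
    ∇ (euler (linearGauss α t e)) x =
      (gaussFactor α t x * (1 - t * ‖x‖ ^ (2 * α + 2))) • e -
      (gaussFactor α t x * (t * ‖x‖ ^ (2 * α)) * inner ℝ e x *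
        (1 - t * ‖x‖ ^ (2 * α + 2) + (2 * α + 2))) • x := by
  have h := (hasGradAt_inner e).mul (hasGradAt_gaussProfile (t := t) hα hx 1 (-1) 0)
  have h' := h.congr_fun (ψ := euler (linearGauss α t e)) (by
    filter_upwards [isOpen_compl_singleton.mem_nhds hx] with y hy
    exact euler_linearGauss hα hy)
  rw [h'.2.gradient, gaussProfile]
  module

lemma laplacian_linearGauss (hα : 2 * α + 2 ≠ 0) (hx : x ≠ 0) :
    (Δ (linearGauss α t e)) x = inner ℝ e x * (t * ‖x‖ ^ (2 * α)) *
      (t * ‖x‖ ^ (2 * α + 2) - (2 * α + 2) - N) * gaussFactor α t x := by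
  have h0 := hasDivAt_gradient (contDiffAt_linearGauss (α := α) (t := t) (e := e) (n := 2) hx)
  have hg := hasGradAt_gaussFactor (t := t) hα hx
  have h1 := (HasDivAt.smul hg (hasDivAt_const e)).sub (HasDivAt.smul ((hg.mul
    ((hasGradAt_rpow (2 * α) hx).const_mul t)).mul (hasGradAt_inner e)) hasDivAt_id)
  have h2 := h1.congr_fun (G := ∇ (linearGauss α t e)) (by
    filter_upwards [isOpen_compl_singleton.mem_nhds hx] with y hy
    exact gradient_linearGauss hα hy)
  rw [← h0.2, h2.2]
  have hn := norm_pos_iff.2 hx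
  have e1 : ‖x‖ ^ (2 * α) = ‖x‖ ^ (2 * α - 2) * ‖x‖ ^ (2 : ℝ) := by
    rw [← Real.rpow_add hn]; ring_nf
  rw [rpow_two_mul_add_two hx]
  simp only [inner_smul_left, inner_add_left, real_inner_self_rpow, conj_trivial,
    real_inner_comm e x, e1]
  ring

/-- A vector field pairing with `residualField` like `linearGauss` does in `uncertaintyDensity`. -/
def corrector (α t a b : ℝ) (e x : EuclideanSpace ℝ (Fin N)) : EuclideanSpace ℝ (Fin N) :=
  gaussProfile α t 0 a b x • e -
    (b * (t * ‖x‖ ^ (2 * α)) * inner ℝ e x * gaussProfile α t 0 1 0 x) • x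

/-- The polarization of `uncertaintyDensity`. -/
def polarDensity (α t : ℝ) (v w : EuclideanSpace ℝ (Fin N) → ℝ)
    (x : EuclideanSpace ℝ (Fin N)) : ℝ :=
  (Δ v) x * (Δ w) x / ‖x‖ ^ (2 * α) + (t ^ 2 * ‖x‖ ^ (2 * α + 2) -
    t * (N + 4 * α + 2)) * inner ℝ (∇ v x) (∇ w x)

/-- The flux relating `polarDensity` with `linearGauss` and the pairing with `corrector`. -/
def polarFlux (α t a b : ℝ) (e : EuclideanSpace ℝ (Fin N)) (w : EuclideanSpace ℝ (Fin N) → ℝ)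
    (x : EuclideanSpace ℝ (Fin N)) : EuclideanSpace ℝ (Fin N) :=
  t • (((gaussProfile α t (-(2 * α + 2 + N + a)) 1 0 x * inner ℝ e x) • ∇ w x +
    (gaussProfile α t (2 * a) (2 * b) 0 x * euler w x) • e -
    ((t * ‖x‖ ^ (2 * α)) * gaussProfile α t (2 * b) 0 0 x * inner ℝ e x * euler w x) • x) +
    ((gaussProfile α t (a * (N - 4 - 2 * α) + a - 2 * α) (a + b * (N - 4 - 2 * α)) b x * w x) • e +
    ((t * ‖x‖ ^ (2 * α)) * gaussProfile α t (a - 2 + b * (N + (2 * α + 2))) (-b) 0 x *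
      inner ℝ e x * w x) • x))

/-- Integrating by parts moves all derivatives to explicit functions. What the flux does not absorb
is ⟨e,x⟩w times a polynomial of degree one in t|x|^{2α+2}, up to a common factor; its two
coefficients vanish precisely under the two linear conditions on a and b. -/
theorem hasDivAt_polarFlux (hα : 2 * α + 2 ≠ 0) (hx : x ≠ 0) {a b : ℝ}
    (ha : a * (3 * (2 * α + 2) - 2 * N) = 4 * N - 3 * (2 * α + 2))
    (hb : 3 * (N - 1) * b = 2 - 2 * a) {w : EuclideanSpace ℝ (Fin N) → ℝ}
    (hw : ContDiffAt ℝ 2 w x) :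
    HasDivAt (polarFlux α t a b e w)
      (polarDensity α t (linearGauss α t e) w x + ‖x‖ ^ (-2 * α - 2) *
        inner ℝ (residualField α t w x) (corrector α t a b e x)) x := by
  have hn := norm_pos_iff.2 hx
  have hP := fun a b c => hasGradAt_gaussProfile (t := t) hα hx a b c
  have hT := (hw.euler (m := 1) (by norm_num)).hasGradAt
  have hs := (hasGradAt_rpow (2 * α) hx).const_mul t
  have hw1 := (hw.of_le (m := 1) (by norm_num)).hasGradAt
  have he := hasGradAt_inner (x := x) e
  have d1 := HasDivAt.smul ((hP (-(2 * α + 2 + N + a)) 1 0).mul he) (hasDivAt_gradient hw)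
  have d2 := HasDivAt.smul ((hP (2 * a) (2 * b) 0).mul hT) (hasDivAt_const e)
  have d3 := HasDivAt.smul (((hs.mul (hP (2 * b) 0 0)).mul he).mul hT) hasDivAt_id
  have d4 := HasDivAt.smul ((hP (a * (N - 4 - 2 * α) + a - 2 * α) (a + b * (N - 4 - 2 * α)) b).mul hw1)
    (hasDivAt_const e)
  have d5 := HasDivAt.smul (((hs.mul (hP (a - 2 + b * (N + (2 * α + 2))) (-b) 0)).mul he).mul hw1)
    hasDivAt_id
  refine ((((d1.add d2).sub d3).add (d4.add d5)).const_smul t).congr ?_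
  have e1 : ‖x‖ ^ (2 * α) = ‖x‖ ^ (2 * α - 2) * ‖x‖ ^ (2 : ℝ) := by
    rw [← Real.rpow_add hn]; ring_nf
  have e2 : ‖x‖ ^ (2 * α + 2) = ‖x‖ ^ (2 * α - 2) * ‖x‖ ^ (2 : ℝ) * ‖x‖ ^ (2 : ℝ) := by
    rw [rpow_two_mul_add_two hx, e1]
  have e3 : ‖x‖ ^ (-2 * α - 2) = (‖x‖ ^ (2 * α - 2) * ‖x‖ ^ (2 : ℝ) * ‖x‖ ^ (2 : ℝ))⁻¹ := by
    rw [← e2, ← Real.rpow_neg hn.le]; ring_nf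
  have hc : 0 < ‖x‖ ^ (2 * α - 2) := Real.rpow_pos_of_pos hn _
  have hr : 0 < ‖x‖ ^ (2 : ℝ) := Real.rpow_pos_of_pos hn _
  unfold polarDensity residualField corrector gaussProfile
  rw [laplacian_linearGauss hα hx, gradient_linearGauss hα hx, gradient_auxFun α hw]
  simp only [inner_smul_left, inner_smul_right, inner_sub_right, real_inner_self_rpow x,
    inner_sub_left, conj_trivial, inner_add_left]
  rw [real_inner_comm e x, real_inner_comm x (∇ (euler w) x), real_inner_comm x (∇ w x),
    real_inner_comm e (∇ (euler w) x), real_inner_comm e (∇ w x), e3, e2, e1]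
  rw [show inner ℝ x (∇ w x) = euler w x from rfl]
  generalize ‖x‖ ^ (2 * α - 2) = c at *
  generalize ‖x‖ ^ (2 : ℝ) = r at *
  field_simp
  linear_combination (gaussFactor α t x * t * inner ℝ e x * w x * t * c ^ 2 * r ^ 3) * (((N + 3 * (2 * α + 2)) / 3 -
    t * c * r ^ 2) * hb + 1 / 3 * ha)

end LinearProfile

/-! ### The energy of the linear profile and its sign. -/

noncomputable section LinearProfileEnergy

variable {N : ℕ} {α t : ℝ} {x e : EuclideanSpace ℝ (Fin N)}

/-- The flux used to compute the energy of `linearGauss`. -/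
def selfFlux (α t c₀ c₁ c₂ d₀ d₁ d₂ : ℝ) (e x : EuclideanSpace ℝ (Fin N)) :
    EuclideanSpace ℝ (Fin N) :=
  t • ((gaussFactor α t x * gaussProfile α t c₀ c₁ c₂ x * inner ℝ e x) • e +
    (‖e‖ ^ 2 * (gaussFactor α t x * gaussProfile α t d₀ d₁ d₂ x)) • x)

/-- Put s = t|x|^{2α+2} and match coefficients. The powers s, s², s³ multiplying ⟨e,x⟩²/|x|² give
`h₃`, `h₂`, `h₁`, and the powers 1, s², s³ multiplying |e|² give `h₆`, `h₅`, `h₄`. Six coefficients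
are then spent, so the term |e|²s remains; its factor is the constant in the conclusion. -/
theorem hasDivAt_selfFlux (hα : 2 * α + 2 ≠ 0) (hx : x ≠ 0) {a b c₀ c₁ c₂ d₀ d₁ d₂ : ℝ}
    (h₁ : 2 + b ^ 2 = -2 * c₂)
    (h₂ : -3 * N - 4 * (2 * α + 2) + 2 * a * b = 2 * (2 * α + 2) * c₂ - 2 * c₁)
    (h₃ : (N + (2 * α + 2)) ^ 2 + 2 * (N + 4 * α + 2) = (2 * α + 2) * c₁ - 2 * c₀)
    (h₄ : b ^ 2 = 2 * d₂)
    (h₅ : -2 * a * b = c₂ + (N + 2 * (2 * α + 2)) * d₂ - 2 * d₁)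
    (h₆ : -(N + 4 * α + 2) = c₀ + N * d₀) :
    HasDivAt (selfFlux α t c₀ c₁ c₂ d₀ d₁ d₂ e)
      (uncertaintyDensity α t (linearGauss α t e) x -
        ‖x‖ ^ (-2 * α - 2) * ‖corrector α t a b e x‖ ^ 2 -
        (1 - a ^ 2 - c₁ - (N + (2 * α + 2)) * d₁ + 2 * d₀) * (t * ‖e‖ ^ 2 *
          (gaussFactor α t x * gaussProfile α t 0 1 0 x))) x := by
  have hn := norm_pos_iff.2 hx
  have hP := fun a b c => hasGradAt_gaussProfile (t := t) hα hx a b c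
  have hf := hasGradAt_gaussFactor (t := t) hα hx
  have he := hasGradAt_inner (x := x) e
  have g1 := HasDivAt.smul ((hf.mul (hP c₀ c₁ c₂)).mul he) (hasDivAt_const e)
  have g2 := HasDivAt.smul ((hf.mul (hP d₀ d₁ d₂)).const_mul (‖e‖ ^ 2)) hasDivAt_id
  refine ((g1.add g2).const_smul t).congr ?_
  clear g1 g2
  have e1 : ‖x‖ ^ (2 * α) = ‖x‖ ^ (2 * α - 2) * ‖x‖ ^ (2 : ℝ) := by
    rw [← Real.rpow_add hn]; ring_nf
  have e2 : ‖x‖ ^ (2 * α + 2) = ‖x‖ ^ (2 * α - 2) * ‖x‖ ^ (2 : ℝ) * ‖x‖ ^ (2 : ℝ) := by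
    rw [rpow_two_mul_add_two hx, e1]
  have e3 : ‖x‖ ^ (-2 * α - 2) = (‖x‖ ^ (2 * α - 2) * ‖x‖ ^ (2 : ℝ) * ‖x‖ ^ (2 : ℝ))⁻¹ := by
    rw [← e2, ← Real.rpow_neg hn.le]; ring_nf
  have hc : 0 < ‖x‖ ^ (2 * α - 2) := Real.rpow_pos_of_pos hn _
  have hr : 0 < ‖x‖ ^ (2 : ℝ) := Real.rpow_pos_of_pos hn _
  unfold uncertaintyDensity laplacianDensity weightedGradientDensity gradientDensity
  rw [sq_abs, laplacian_linearGauss hα hx, gradient_linearGauss hα hx,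
    ← real_inner_self_eq_norm_sq (corrector α t a b e x),
    ← real_inner_self_eq_norm_sq (gaussFactor α t x • e - _), ← real_inner_self_eq_norm_sq e]
  unfold corrector gaussProfile
  simp only [inner_smul_left, inner_smul_right, inner_sub_right, real_inner_self_rpow x,
    inner_sub_left, conj_trivial, inner_add_left]
  rw [real_inner_comm e x, e3, e2, e1]
  generalize ‖x‖ ^ (2 * α - 2) = c at *
  generalize ‖x‖ ^ (2 : ℝ) = r at *
  generalize gaussFactor α t x = f at *
  generalize inner ℝ e x = l at *
  generalize inner ℝ e e = m at *
  field_simp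
  linear_combination (t * f ^ 2 * c * r ^ 2) * (-(l ^ 2 * t ^ 3 * c ^ 3 * r ^ 5) * h₁ -
    (l ^ 2 * t ^ 2 * c ^ 2 * r ^ 3) * h₂ - (l ^ 2 * t * c * r) * h₃ + (m * t ^ 3 * c ^ 3 * r ^ 6) * h₄ -
    (m * t ^ 2 * c ^ 2 * r ^ 4) * h₅ - m * h₆)

/-- Here β stands for 2α+2. Eliminating all coefficients leaves a rational function of n and β whose
numerator has the factor β-n, which is zero at the end of the range N > 2α+2; the remaining cubic is
positive by the golden-ratio condition. -/
lemma corrector_energy_nonneg {n β a b c₀ c₁ c₂ d₀ d₁ d₂ : ℝ} (hβn : n ≤ β) (hn : 1 < n) (hβn' : β < n + 2)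
    (hn' : 0 < n - (√5 - 1) * (β / 2 - 1) - (√5 + 1))
    (ha : a * (3 * β - 2 * n) = 4 * n - 3 * β)
    (hb : 3 * (n - 1) * b = 2 - 2 * a)
    (h₁ : 2 + b ^ 2 = -2 * c₂)
    (h₂ : -3 * n - 4 * β + 2 * a * b = 2 * β * c₂ - 2 * c₁)
    (h₃ : (n + β) ^ 2 + 2 * (n + 2 * β - 2) = β * c₁ - 2 * c₀)
    (h₄ : b ^ 2 = 2 * d₂)
    (h₅ : -2 * a * b = c₂ + (n + 2 * β) * d₂ - 2 * d₁)
    (h₆ : -(n + 2 * β - 2) = c₀ + n * d₀) :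
    0 ≤ 1 - a ^ 2 - c₁ - (n + β) * d₁ + 2 * d₀ := by
  have h3 : 0 < 3 * β - 2 * n := by linarith
  have hn0 : 0 < n := by linarith
  have hn1 : 0 < n - 1 := by linarith
  -- closed form of the constant
  have hK : n * (1 - a ^ 2 - c₁ - (n + β) * d₁ + 2 * d₀) =
      n * (1 - a ^ 2) - (n - 1) * (n + β) * (a * b + b ^ 2 * (n + 2 * β) / 4) := by
    have hd2 : d₂ = b ^ 2 / 2 := by linarith
    have hc2 : c₂ = -(2 + b ^ 2) / 2 := by linarith
    have hc1 : c₁ = (2 * β * c₂ - (-3 * n - 4 * β + 2 * a * b)) / 2 := by linarith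
    have hc0 : c₀ = (β * c₁ - ((n + β) ^ 2 + 2 * (n + 2 * β - 2))) / 2 := by linarith
    have hd1 : d₁ = (c₂ + (n + 2 * β) * d₂ + 2 * a * b) / 2 := by linarith
    have hd0 : n * d₀ = -(n + 2 * β - 2) - c₀ := by linarith
    rw [hd1, hd2] 
    rw [hc0, hc1, hc2] at hd0
    rw [hc1, hc2]
    linear_combination 2 * hd0
  have ha' : a = (4 * n - 3 * β) / (3 * β - 2 * n) := by
    rw [eq_div_iff h3.ne']; exact ha
  have hb' : b = (2 - 2 * a) / (3 * (n - 1)) := by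
    rw [eq_div_iff (by positivity)]; linarith
  have hs5 : √5 ^ 2 = 5 := Real.sq_sqrt (by norm_num)
  have hs1 : (2.236 : ℝ) < √5 := Real.lt_sqrt_of_sq_lt (by norm_num)
  have hs2 : √5 < 2.237 := by
    rw [Real.sqrt_lt' (by norm_num)]; norm_num
  have hfac : n * (1 - a ^ 2) - (n - 1) * (n + β) * (a * b + b ^ 2 * (n + 2 * β) / 4) =
      4 * (β - n) * ((n - 1) * (3 * β ^ 2 - n * β - n ^ 2) - (β - n) * (n + β) * (n + 2 * β)) * 
      (1 / (3 * β - 2 * n) ^ 2 / (n - 1)) := by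
    clear hK h₁ h₂ h₃ h₄ h₅ h₆ ha hb hn'
    obtain ⟨δ, hδ⟩ : ∃ δ, δ = 3 * β - 2 * n := ⟨_, rfl⟩
    obtain rfl : β = (δ + 2 * n) / 3 := by linarith
    obtain ⟨m, rfl⟩ : ∃ m, n = m + 1 := ⟨n - 1, by ring⟩
    rw [← hδ] at h3 ha' ⊢
    rw [add_sub_cancel_right] at *
    have := h3.ne'
    have := hn1.ne'
    rw [hb', ha']
    field_simp
    ring
  have hmain : 0 ≤ (n - 1) * (3 * β ^ 2 - n * β - n ^ 2) - (β - n) * (n + β) * (n + 2 * β) := by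
    -- The hypothesis with √5 reads n > ((√5-1)/2)β + 2, and 0.618 is a rational lower bound for
    -- (√5-1)/2.
    have h4 : 0.618 * β + 2 < n := by nlinarith
    -- In terms of δ, which lies in [0, 2), the cubic is β(β(β-4δ-1) - 3δ) + δ²(β+1).
    obtain ⟨δ, rfl⟩ : ∃ δ, n = β - δ := ⟨β - n, by ring⟩
    have h5 : 1.4 ≤ β - 4 * δ - 1 := by linarith
    have h6 : 3 * δ ≤ β * (β - 4 * δ - 1) := by nlinarith
    have h7 : 0 ≤ β * (β * (β - 4 * δ - 1) - 3 * δ) := mul_nonneg (by linarith) (by linarith)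
    have h8 : 0 ≤ δ ^ 2 * (β + 1) := mul_nonneg (sq_nonneg _) (by linarith)
    linarith
  have : 0 ≤ n * (1 - a ^ 2 - c₁ - (n + β) * d₁ + 2 * d₀) := by
    rw [hK, hfac]
    have := sub_nonneg.2 hβn
    positivity
  exact nonneg_of_mul_nonneg_right this hn0

end LinearProfileEnergy

/-! ### Power bounds at the origin combined with rapid decay at infinity. -/

noncomputable section RapidDecay

variable {N : ℕ} {F G H : Type*} [NormedAddCommGroup F] [NormedAddCommGroup G]
  [NormedAddCommGroup H]

/-- `f = O(|x|^a)` near the origin, and `f` decays rapidly at infinity. -/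
def RapidBound (a : ℝ) (f : EuclideanSpace ℝ (Fin N) → F) : Prop :=
  ∀ M : ℝ, ∃ K : ℝ, 0 ≤ K ∧ (∀ x, x ≠ 0 → ‖x‖ ≤ 1 → ‖f x‖ ≤ K * ‖x‖ ^ a) ∧
    ∀ x, 1 ≤ ‖x‖ → ‖f x‖ ≤ K * ‖x‖ ^ (-M)

variable {a b : ℝ} {f : EuclideanSpace ℝ (Fin N) → F} {g : EuclideanSpace ℝ (Fin N) → G}
  {h : EuclideanSpace ℝ (Fin N) → H}

lemma RapidBound.mono (hf : RapidBound a f) (hab : b ≤ a) : RapidBound b f := by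
  intro M
  obtain ⟨K, hK, h0, h1⟩ := hf M
  refine ⟨K, hK, fun x hx hx1 => (h0 x hx hx1).trans ?_, h1⟩
  exact mul_le_mul_of_nonneg_left
    (Real.rpow_le_rpow_of_exponent_ge (norm_pos_iff.2 hx) hx1 hab) hK

lemma RapidBound.of_le (hf : RapidBound a f) (C p : ℝ)
    (hg : ∀ x, x ≠ 0 → ‖g x‖ ≤ C * ‖x‖ ^ p * ‖f x‖) : RapidBound (a + p) g := by
  intro M
  -- Since the decay order is arbitrary, the factor |x|^p at infinity is absorbed by asking f for
  -- order M + p.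
  obtain ⟨K, hK, h0, h1⟩ := hf (M + p)
  have hg' : ∀ x, x ≠ 0 → ‖g x‖ ≤ |C| * ‖x‖ ^ p * ‖f x‖ := fun x hx =>
    (hg x hx).trans (by gcongr; exact le_abs_self C)
  refine ⟨|C| * K, by positivity, fun x hx hx1 => (hg' x hx).trans ?_, fun x hx => ?_⟩
  · have hn := norm_pos_iff.2 hx
    calc _ ≤ |C| * ‖x‖ ^ p * (K * ‖x‖ ^ a) := by gcongr; exact h0 x hx hx1
      _ = |C| * K * (‖x‖ ^ a * ‖x‖ ^ p) := by ring
      _ = _ := by rw [← Real.rpow_add hn]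
  · have hn : 0 < ‖x‖ := by linarith
    refine (hg' x (norm_pos_iff.1 hn)).trans ?_
    calc _ ≤ |C| * ‖x‖ ^ p * (K * ‖x‖ ^ (-(M + p))) := by gcongr; exact h1 x hx
      _ = |C| * K * (‖x‖ ^ (-(M + p)) * ‖x‖ ^ p) := by ring
      _ = _ := by rw [← Real.rpow_add hn]; ring_nf

lemma RapidBound.of_norm_le (hf : RapidBound a f) (C : ℝ) (hg : ∀ x, x ≠ 0 → ‖g x‖ ≤ C * ‖f x‖) :
    RapidBound a g := by
  have := hf.of_le (g := g) C 0 fun x hx => by simpa using hg x hx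
  simpa using this

lemma RapidBound.add_of_le (hf : RapidBound a f) (hg : RapidBound a g)
    (hh : ∀ x, x ≠ 0 → ‖h x‖ ≤ ‖f x‖ + ‖g x‖) : RapidBound a h := by
  intro M
  obtain ⟨K, hK, h0, h1⟩ := hf M
  obtain ⟨K', hK', h0', h1'⟩ := hg M
  refine ⟨K + K', by positivity, fun x hx hx1 => (hh x hx).trans ?_, fun x hx => ?_⟩
  · rw [add_mul]; exact add_le_add (h0 x hx hx1) (h0' x hx hx1)
  · refine (hh x (norm_pos_iff.1 (by linarith))).trans ?_
    rw [add_mul]; exact add_le_add (h1 x hx) (h1' x hx)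

lemma RapidBound.mul_of_le (hf : RapidBound a f) (hg : RapidBound b g)
    (hh : ∀ x, x ≠ 0 → ‖h x‖ ≤ ‖f x‖ * ‖g x‖) : RapidBound (a + b) h := by
  intro M
  obtain ⟨K, hK, h0, h1⟩ := hf M
  -- All the decay is taken from f; boundedness of g at infinity is enough.
  obtain ⟨K', hK', h0', h1'⟩ := hg 0
  refine ⟨K * K', by positivity, fun x hx hx1 => (hh x hx).trans ?_, fun x hx => ?_⟩
  · rw [Real.rpow_add (norm_pos_iff.2 hx), mul_mul_mul_comm]
    exact mul_le_mul (h0 x hx hx1) (h0' x hx hx1) (norm_nonneg _) (by positivity)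
  · refine (hh x (norm_pos_iff.1 (by linarith))).trans ?_
    have := h1' x hx
    rw [neg_zero, Real.rpow_zero, mul_one] at this
    rw [mul_right_comm]
    exact mul_le_mul (h1 x hx) this (norm_nonneg _) (by positivity)

lemma RapidBound.add {f g : EuclideanSpace ℝ (Fin N) → F} (hf : RapidBound a f)
    (hg : RapidBound a g) : RapidBound a fun x => f x + g x :=
  hf.add_of_le hg fun _ _ => norm_add_le _ _

lemma RapidBound.sub {f g : EuclideanSpace ℝ (Fin N) → F} (hf : RapidBound a f)
    (hg : RapidBound a g) : RapidBound a fun x => f x - g x :=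
  hf.add_of_le hg fun _ _ => norm_sub_le _ _

lemma RapidBound.mul {f g : EuclideanSpace ℝ (Fin N) → ℝ} (hf : RapidBound a f)
    (hg : RapidBound b g) : RapidBound (a + b) fun x => f x * g x :=
  hf.mul_of_le hg fun _ _ => (norm_mul _ _).le

lemma RapidBound.rpow_mul {f : EuclideanSpace ℝ (Fin N) → ℝ} (hf : RapidBound a f) (p : ℝ) :
    RapidBound (a + p) fun x => ‖x‖ ^ p * f x :=
  hf.of_le 1 p fun x _ => by
    rw [norm_mul, one_mul, Real.norm_of_nonneg (Real.rpow_nonneg (norm_nonneg x) p)]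

lemma RapidBound.const_mul {f : EuclideanSpace ℝ (Fin N) → ℝ} (hf : RapidBound a f) (c : ℝ) :
    RapidBound a fun x => c * f x :=
  hf.of_norm_le ‖c‖ fun _ _ => (norm_mul _ _).le

lemma RapidBound.norm (hf : RapidBound a f) : RapidBound a fun x => ‖f x‖ :=
  hf.of_norm_le 1 fun _ _ => by simp

lemma RapidBound.congr {f g : EuclideanSpace ℝ (Fin N) → F} (hf : RapidBound a f)
    (h : ∀ x, x ≠ 0 → g x = f x) : RapidBound a g :=
  hf.of_norm_le 1 fun x hx => by rw [h x hx, one_mul]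

lemma RapidBound.of_near_zero (hf : RapidBound a f) {K : ℝ}
    (h : ∀ x, x ≠ 0 → ‖x‖ ≤ 1 → ‖f x‖ ≤ K * ‖x‖ ^ b) : RapidBound b f := by
  intro M
  obtain ⟨K', hK, h0, h1⟩ := hf M
  refine ⟨max K K', hK.trans (le_max_right _ _), fun x hx hx1 => (h x hx hx1).trans ?_,
    fun x hx => (h1 x hx).trans ?_⟩
  · gcongr; exact le_max_left _ _
  · gcongr; exact le_max_right _ _

lemma rapidBound_of_compact (hf : Continuous f) (hc : HasCompactSupport f) : RapidBound 0 f := by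
  intro M
  have hg : Continuous fun x : EuclideanSpace ℝ (Fin N) => ‖f x‖ * (1 + ‖x‖) ^ |M| :=
    hf.norm.mul (Continuous.rpow_const (by fun_prop) fun x => Or.inl (by positivity))
  obtain ⟨K, hK⟩ := hg.bounded_above_of_compact_support (hc.norm.mul_right)
  have hK0 : 0 ≤ K := (norm_nonneg _).trans (hK 0)
  have hK' : ∀ x, ‖f x‖ * (1 + ‖x‖) ^ |M| ≤ K := fun x => (le_abs_self _).trans (hK x)
  refine ⟨K, hK0, fun x _ _ => ?_, fun x hx => ?_⟩
  · rw [Real.rpow_zero, mul_one]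
    refine le_trans ?_ (hK' x)
    exact le_mul_of_one_le_right (norm_nonneg _)
      (Real.one_le_rpow (by linarith [norm_nonneg x]) (abs_nonneg _))
  · have hx0 : 0 < ‖x‖ := by linarith
    rw [Real.rpow_neg hx0.le, ← div_eq_mul_inv, le_div_iff₀ (by positivity)]
    refine le_trans ?_ (hK' x)
    gcongr
    exact (Real.rpow_le_rpow_of_exponent_le hx (le_abs_self M)).trans
      (Real.rpow_le_rpow hx0.le (by linarith) (abs_nonneg _))

lemma RapidBound.integrable (hN : 1 ≤ N) (hf : RapidBound a f) (ha : -N < a)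
    (hm : AEStronglyMeasurable f volume) : Integrable f := by
  obtain ⟨K, _, h0, h1⟩ := hf (N + 1)
  exact integrable_of_rpow_bounds hN hm ha (by linarith) h0 h1

/-- The divergence of a C¹ field is continuous, which makes the long densities measurable without
inspecting their formulas. -/
lemma continuousAt_of_hasDivAt {V : EuclideanSpace ℝ (Fin N) → EuclideanSpace ℝ (Fin N)}
    {d : EuclideanSpace ℝ (Fin N) → ℝ} (hV : ∀ x, x ≠ 0 → HasDivAt V (d x) x)
    {x : EuclideanSpace ℝ (Fin N)} (hx : x ≠ 0) : ContinuousAt d x := by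
  have h1 : ContinuousAt (fderiv ℝ V) x :=
    ((hV x hx).1.fderiv_right (m := 0) (by norm_num)).continuousAt
  have h2 : ContinuousAt (divergence V) x := by
    unfold divergence
    refine tendsto_finsetSum _ fun i _ => ?_
    have : ContinuousAt (fun y => EuclideanSpace.proj (𝕜 := ℝ) i (fderiv ℝ V y (EuclideanSpace.single i 1))) x := by
      fun_prop
    exact this
  refine h2.congr ?_
  filter_upwards [isOpen_compl_singleton.mem_nhds hx] with y hy
  exact (hV y hy).2

theorem integral_divergence_eq_zero_of_rapidBound (hN : 1 ≤ N)
    {V : EuclideanSpace ℝ (Fin N) → EuclideanSpace ℝ (Fin N)}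
    {d : EuclideanSpace ℝ (Fin N) → ℝ} (hV : ∀ x, x ≠ 0 → HasDivAt V (d x) x)
    (hVb : RapidBound a fun x => ‖V x‖ / ‖x‖) (ha : -N < a) (hd : RapidBound b d) (hb : -N < b) :
    Integrable d ∧ ∫ x, d x = 0 := by
  have := nontrivial_of_one_le hN
  have h1 : Integrable d := hd.integrable hN hb
    (aestronglyMeasurable_of_continuousOn_ne_zero fun x hx => continuousAt_of_hasDivAt hV hx)
  refine ⟨h1, integral_divergence_eq_zero hV (hVb.integrable hN ha ?_) h1⟩
  refine aestronglyMeasurable_of_continuousOn_ne_zero fun x hx => ?_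
  exact (hV x hx).1.continuousAt.norm.div continuousAt_id.norm (norm_ne_zero_iff.2 hx)

lemma gaussFactor_pos (α t : ℝ) (x : EuclideanSpace ℝ (Fin N)) : 0 < gaussFactor α t x :=
  Real.exp_pos _

lemma gaussFactor_le_one {α t : ℝ} (hα : 0 < 2 * α + 2) (ht : 0 < t)
    (x : EuclideanSpace ℝ (Fin N)) : gaussFactor α t x ≤ 1 := by
  unfold gaussFactor
  rw [Real.exp_le_one_iff, neg_mul, neg_nonpos]
  positivity

lemma rapidBound_gaussFactor {α t : ℝ} (hα : 0 < 2 * α + 2) (ht : 0 < t) :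
    RapidBound 0 (gaussFactor (N := N) α t) := by
  intro M
  set c := t / (2 * α + 2)
  have hc : 0 < c := div_pos ht hα
  set q := (|M| + 1) / (2 * α + 2) with hq
  have hq0 : 0 < q := by positivity
  refine ⟨max 1 (q ^ q * c ^ (-q)), by positivity, fun x _ _ => ?_, fun x hx => ?_⟩
  · rw [Real.norm_of_nonneg (gaussFactor_pos α t x).le, Real.rpow_zero, mul_one]
    exact (gaussFactor_le_one hα ht x).trans (le_max_left _ _)
  · have hn : 0 < ‖x‖ := by linarith
    rw [Real.norm_of_nonneg (gaussFactor_pos α t x).le, gaussFactor, neg_mul]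
    refine (exp_neg_le_rpow hq0 (by positivity)).trans ?_
    rw [Real.mul_rpow hc.le (by positivity), ← Real.rpow_mul hn.le, ← mul_assoc]
    refine mul_le_mul (le_max_right _ _) ?_ (by positivity) (by positivity)
    refine Real.rpow_le_rpow_of_exponent_le hx ?_
    have : (2 * α + 2) * -q = -(|M| + 1) := by
      rw [hq, mul_neg, mul_div_cancel₀ _ hα.ne']
    rw [this]; linarith [le_abs_self M]

lemma rapidBound_gaussProfile {α t : ℝ} (hα : 0 < 2 * α + 2) (ht : 0 < t) (a b c : ℝ) :
    RapidBound 0 (gaussProfile (N := N) α t a b c) := by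
  have h := rapidBound_gaussFactor (N := N) hα ht
  have h1 := ((h.const_mul (b * t)).rpow_mul (2 * α + 2)).mono (b := 0) (by linarith)
  have h2 := (((h.const_mul (c * t ^ 2)).rpow_mul (2 * α + 2)).rpow_mul (2 * α + 2)).mono (b := 0)
    (by linarith)
  refine (((h.const_mul a).add h1).add h2).congr fun x _ => ?_
  unfold gaussProfile
  ring

lemma rapidBound_gaussProfile_one {α t : ℝ} (hα : 0 < 2 * α + 2) (ht : 0 < t) (b c : ℝ) :
    RapidBound (2 * α + 2) (gaussProfile (N := N) α t 0 b c) := by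
  have h := ((rapidBound_gaussProfile (N := N) hα ht b c 0).const_mul t).rpow_mul (2 * α + 2)
  rw [zero_add] at h
  refine h.congr fun x _ => ?_
  unfold gaussProfile
  ring

end RapidDecay

/-! ### Removing the linear part of a test function at the origin. -/

noncomputable section Strip

variable {N : ℕ} {α t : ℝ} {e : EuclideanSpace ℝ (Fin N)}

lemma abs_gaussFactor_sub_one (hα : 0 < 2 * α + 2) (ht : 0 < t) (x : EuclideanSpace ℝ (Fin N)) :
    |gaussFactor α t x - 1| ≤ t / (2 * α + 2) * ‖x‖ ^ (2 * α + 2) := by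
  rw [abs_sub_comm, abs_of_nonneg (by linarith [gaussFactor_le_one hα ht x])]
  have := Real.add_one_le_exp (-(t / (2 * α + 2)) * ‖x‖ ^ (2 * α + 2))
  unfold gaussFactor
  linarith

lemma rapidBound_inner_mul {a : ℝ} {f : EuclideanSpace ℝ (Fin N) → ℝ} (hf : RapidBound a f)
    (e : EuclideanSpace ℝ (Fin N)) : RapidBound (a + 1) fun x => inner ℝ e x * f x :=
  hf.of_le ‖e‖ 1 fun x _ => by
    rw [norm_mul, Real.rpow_one]
    exact mul_le_mul_of_nonneg_right (norm_inner_le_norm _ _) (norm_nonneg _)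

lemma rapidBound_smul_const {a : ℝ} {f : EuclideanSpace ℝ (Fin N) → ℝ} (hf : RapidBound a f)
    (e : EuclideanSpace ℝ (Fin N)) : RapidBound a fun x => f x • e :=
  hf.of_norm_le ‖e‖ fun x _ => by rw [norm_smul, mul_comm]

lemma rapidBound_smul_self {a : ℝ} {f : EuclideanSpace ℝ (Fin N) → ℝ} (hf : RapidBound a f) :
    RapidBound (a + 1) fun x : EuclideanSpace ℝ (Fin N) => f x • x :=
  hf.of_le 1 1 fun x _ => by rw [norm_smul, Real.rpow_one, one_mul, mul_comm]

lemma rapidBound_smul {a b : ℝ} {f : EuclideanSpace ℝ (Fin N) → ℝ}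
    {g : EuclideanSpace ℝ (Fin N) → EuclideanSpace ℝ (Fin N)} (hf : RapidBound a f)
    (hg : RapidBound b g) : RapidBound (a + b) fun x => f x • g x :=
  hf.mul_of_le hg fun x _ => by rw [norm_smul]

lemma rapidBound_norm_sq {F : Type*} [NormedAddCommGroup F] {a b : ℝ}
    {f : EuclideanSpace ℝ (Fin N) → F} (hf : RapidBound a f) (hb : b ≤ a + a) :
    RapidBound b fun x => ‖f x‖ ^ 2 :=
  (hf.mul_of_le hf fun x _ => by rw [norm_pow, norm_norm, sq]).mono hb

lemma RapidBound.norm_div {a : ℝ} {f : EuclideanSpace ℝ (Fin N) → EuclideanSpace ℝ (Fin N)}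
    (hf : RapidBound a f) : RapidBound (a - 1) fun x => ‖f x‖ / ‖x‖ :=
  hf.of_le 1 (-1) fun x _ => by
    rw [_root_.norm_div, norm_norm, norm_norm, Real.rpow_neg_one, one_mul, div_eq_inv_mul]

lemma rapidBound_linearGauss (hα : 0 < 2 * α + 2) (ht : 0 < t) (e : EuclideanSpace ℝ (Fin N)) :
    RapidBound 1 (linearGauss α t e) := by
  have := rapidBound_inner_mul (rapidBound_gaussFactor (N := N) hα ht) e
  rwa [zero_add] at this

lemma rapidBound_inner_weight_gauss (hα : 0 < 2 * α + 2) (ht : 0 < t)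
    (e : EuclideanSpace ℝ (Fin N)) (a b c : ℝ) : RapidBound (2 * α + 2)
      fun x => (inner ℝ e x * (‖x‖ ^ (2 * α) * (t * gaussProfile α t a b c x))) • x := by
  have := rapidBound_smul_self (rapidBound_inner_mul
    (((rapidBound_gaussProfile (N := N) hα ht a b c).const_mul t).rpow_mul (2 * α)) e)
  exact this.mono (by linarith)

lemma rapidBound_gradient_linearGauss (hα : 0 < 2 * α + 2) (ht : 0 < t)
    (e : EuclideanSpace ℝ (Fin N)) : RapidBound 0 (∇ (linearGauss α t e)) := by
  refine ((rapidBound_smul_const (rapidBound_gaussFactor hα ht) e).sub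
    ((rapidBound_inner_weight_gauss hα ht e 1 0 0).mono hα.le)).congr fun x hx => ?_
  rw [gradient_linearGauss hα.ne' hx, gaussProfile]
  module

lemma rapidBound_gradient_euler_linearGauss (hα : 0 < 2 * α + 2) (ht : 0 < t)
    (e : EuclideanSpace ℝ (Fin N)) : RapidBound 0 (∇ (euler (linearGauss α t e))) := by
  refine ((rapidBound_smul_const (rapidBound_gaussProfile hα ht 1 (-1) 0) e).sub
    ((rapidBound_inner_weight_gauss hα ht e (1 + (2 * α + 2)) (-1) 0).mono hα.le)).congr
      fun x hx => ?_
  rw [gradient_euler_linearGauss hα.ne' hx, gaussProfile, gaussProfile]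
  module

lemma rapidBound_laplacian_linearGauss (hα : 0 < 2 * α + 2) (ht : 0 < t)
    (e : EuclideanSpace ℝ (Fin N)) : RapidBound (2 * α + 1) (Δ (linearGauss α t e)) := by
  have := rapidBound_inner_mul (((rapidBound_gaussProfile (N := N) hα ht
    (-(2 * α + 2) - N) 1 0).const_mul t).rpow_mul (2 * α)) e
  rw [zero_add] at this
  refine this.congr fun x hx => ?_
  rw [laplacian_linearGauss hα.ne' hx, gaussProfile]
  ring

/-- The Gaussian factor is 1 + O(|x|^{2α+2}), and |x|^{2α+2} ≤ |x| in the unit ball. -/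
lemma gradient_linearGauss_sub_le (hα : 0 ≤ α) (ht : 0 < t) (e : EuclideanSpace ℝ (Fin N)) :
    ∃ K, ∀ x : EuclideanSpace ℝ (Fin N), x ≠ 0 → ‖x‖ ≤ 1 → ‖∇ (linearGauss α t e) x - e‖ ≤ K * ‖x‖ ∧
      ‖∇ (euler (linearGauss α t e)) x - e‖ ≤ K * ‖x‖ := by
  have hβ : 0 < 2 * α + 2 := by linarith
  obtain ⟨K₁, hK₁, h₁, -⟩ := rapidBound_inner_weight_gauss hβ ht e 1 0 0 0
  obtain ⟨K₂, hK₂, h₂, -⟩ := rapidBound_inner_weight_gauss hβ ht e (1 + (2 * α + 2)) (-1) 0 0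
  refine ⟨t / (2 * α + 2) * ‖e‖ + t * ‖e‖ + K₁ + K₂, fun x hx hx1 => ?_⟩
  have hn := norm_pos_iff.2 hx
  have hr : ‖x‖ ^ (2 * α + 2) ≤ ‖x‖ := by
    simpa using Real.rpow_le_rpow_of_exponent_ge hn hx1 (show (1 : ℝ) ≤ 2 * α + 2 by linarith)
  have hf := abs_gaussFactor_sub_one hβ ht x
  have hf1 := gaussFactor_le_one hβ ht x
  have hf0 := (gaussFactor_pos α t x).le
  have hf' : ‖(gaussFactor α t x - 1) • e‖ ≤ t / (2 * α + 2) * ‖e‖ * ‖x‖ := by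
    rw [norm_smul, Real.norm_eq_abs]
    calc _ ≤ t / (2 * α + 2) * ‖x‖ ^ (2 * α + 2) * ‖e‖ := by gcongr
      _ ≤ t / (2 * α + 2) * ‖x‖ * ‖e‖ := by gcongr
      _ = _ := by ring
  have hf2 : ‖(gaussFactor α t x * (t * ‖x‖ ^ (2 * α + 2))) • e‖ ≤ t * ‖e‖ * ‖x‖ := by
    rw [norm_smul, Real.norm_of_nonneg (by positivity)]
    calc _ ≤ 1 * (t * ‖x‖) * ‖e‖ := by gcongr
      _ = _ := by ring
  have b₁ := (h₁ x hx hx1).trans (mul_le_mul_of_nonneg_left hr hK₁)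
  have b₂ := (h₂ x hx hx1).trans (mul_le_mul_of_nonneg_left hr hK₂)
  have p1 : 0 ≤ t / (2 * α + 2) * ‖e‖ * ‖x‖ := by positivity
  have p2 : 0 ≤ t * ‖e‖ * ‖x‖ := by positivity
  have p3 : 0 ≤ K₁ * ‖x‖ := by positivity
  have p4 : 0 ≤ K₂ * ‖x‖ := by positivity
  constructor
  · have : ∇ (linearGauss α t e) x - e = (gaussFactor α t x - 1) • e -
        (inner ℝ e x * (‖x‖ ^ (2 * α) * (t * gaussProfile α t 1 0 0 x))) • x := by
      rw [gradient_linearGauss hβ.ne' hx, gaussProfile]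
      module
    rw [this]
    refine (norm_sub_le _ _).trans ((add_le_add hf' b₁).trans ?_)
    linarith
  · have : ∇ (euler (linearGauss α t e)) x - e = (gaussFactor α t x - 1) • e -
        (gaussFactor α t x * (t * ‖x‖ ^ (2 * α + 2))) • e -
        (inner ℝ e x * (‖x‖ ^ (2 * α) * (t * gaussProfile α t (1 + (2 * α + 2)) (-1) 0 x))) • x := by
      rw [gradient_euler_linearGauss hβ.ne' hx, gaussProfile]
      module
    rw [this]
    refine (norm_sub_le _ _).trans ((add_le_add ((norm_sub_le _ _).trans
      (add_le_add hf' hf2)) b₂).trans ?_)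
    linarith

lemma exists_norm_sub_le_of_compact {F : Type*} [NormedAddCommGroup F] [NormedSpace ℝ F]
    {f : EuclideanSpace ℝ (Fin N) → F}
    (hf : ContDiff ℝ 1 f) (hc : HasCompactSupport f) : ∃ K : ℝ, ∀ x, ‖f x - f 0‖ ≤ K * ‖x‖ := by
  obtain ⟨K, hK⟩ := hf.lipschitzWith_of_hasCompactSupport hc (by norm_num)
  exact ⟨K, fun x => by simpa [dist_eq_norm] using hK.dist_le_mul x 0⟩

lemma hasCompactSupport_of_eventuallyEq {F G : Type*} [Zero F] [Zero G]
    {u : EuclideanSpace ℝ (Fin N) → F}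
    {f : EuclideanSpace ℝ (Fin N) → G} (hc : HasCompactSupport u)
    (h : ∀ x, u =ᶠ[nhds x] (fun _ => 0) → f x = 0) : HasCompactSupport f := by
  refine HasCompactSupport.of_support_subset_isCompact hc fun x hx => ?_
  by_contra hx'
  exact hx (h x (notMem_tsupport_iff_eventuallyEq.1 hx'))

/-- The estimates satisfied by a test function after subtraction of `linearGauss`. -/
structure FlatAtOrigin (w : EuclideanSpace ℝ (Fin N) → ℝ) : Prop where
  smooth : ∀ x, x ≠ 0 → ContDiffAt ℝ 3 w x
  self : RapidBound 0 w
  gradient : RapidBound 1 (∇ w)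
  gradient_euler : RapidBound 1 (∇ (euler w))
  laplacian : RapidBound 0 (Δ w)

/-- The gradients of u and of x·∇u both equal e at the origin and are Lipschitz. The subtracted
function has the same first-order behaviour, so the differences of gradients are O(|x|). -/
lemma flatAtOrigin_sub_linearGauss (hα : 0 ≤ α) (ht : 0 < t)
    {u : EuclideanSpace ℝ (Fin N) → ℝ} (hu : ContDiff ℝ 3 u) (hc : HasCompactSupport u) :
    FlatAtOrigin fun x => u x - linearGauss α t (∇ u 0) x := by
  have hβ : 0 < 2 * α + 2 := by linarith
  set e := ∇ u 0
  have hu2 : ContDiff ℝ 2 u := hu.of_le (by norm_num)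
  have hv : ∀ x, x ≠ 0 → ContDiffAt ℝ 3 (linearGauss α t e) x := fun x hx =>
    contDiffAt_linearGauss hx
  have hgu : ContDiff ℝ 2 (∇ u) :=
    contDiff_iff_contDiffAt.2 fun x => hu.contDiffAt.gradient (by norm_num)
  have hEu : ContDiff ℝ 2 (euler u) :=
    contDiff_iff_contDiffAt.2 fun x => hu.contDiffAt.euler (by norm_num)
  have hgEu : ContDiff ℝ 1 (∇ (euler u)) :=
    contDiff_iff_contDiffAt.2 fun x => hEu.contDiffAt.gradient (by norm_num)
  have hguc := hasCompactSupport_gradient hc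
  have hEuc : HasCompactSupport (euler u) := hasCompactSupport_of_eventuallyEq hc fun x hx => by
    simp [euler, hx.gradient_eq]
  have hgEuc := hasCompactSupport_gradient hEuc
  have hLc : HasCompactSupport (Δ u) := hasCompactSupport_of_eventuallyEq hc fun x hx => by
    rw [(InnerProductSpace.laplacian_congr_nhds hx).self_of_nhds]
    simp
  have gw : ∀ x, x ≠ 0 → ∇ (fun x => u x - linearGauss α t e x) x =
      ∇ u x - ∇ (linearGauss α t e) x := fun x hx =>
    ((hu.contDiffAt.of_le (by norm_num)).hasGradAt.sub
      ((hv x hx).of_le (by norm_num)).hasGradAt).2.gradient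
  have Ew : ∀ x, x ≠ 0 → euler (fun x => u x - linearGauss α t e x) x =
      euler u x - euler (linearGauss α t e) x := fun x hx => by
    rw [euler, gw x hx, inner_sub_right]; rfl
  have gEw : ∀ x, x ≠ 0 → ∇ (euler fun x => u x - linearGauss α t e x) x =
      ∇ (euler u) x - ∇ (euler (linearGauss α t e)) x := fun x hx => by
    refine (((hEu.contDiffAt.of_le (by norm_num)).hasGradAt.sub
      ((hv x hx).euler (m := 1) (by norm_num)).hasGradAt).congr_fun ?_).2.gradient
    filter_upwards [isOpen_compl_singleton.mem_nhds hx] with y hy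
    exact Ew y hy
  have lw : ∀ x, x ≠ 0 → (Δ fun x => u x - linearGauss α t e x) x =
      (Δ u) x - (Δ (linearGauss α t e)) x := fun x hx =>
    hu2.contDiffAt.laplacian_sub ((hv x hx).of_le (by norm_num))
  obtain ⟨K₁, h₁⟩ := exists_norm_sub_le_of_compact (hgu.of_le (by norm_num)) hguc
  obtain ⟨K₂, h₂⟩ := exists_norm_sub_le_of_compact hgEu hgEuc
  have h₂0 : ∇ (euler u) 0 = e := by rw [gradient_euler hu2.contDiffAt]; simp [e]
  obtain ⟨K₃, h₃⟩ := gradient_linearGauss_sub_le hα ht e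
  refine ⟨fun x hx => hu.contDiffAt.sub (hv x hx), ?_, ?_, ?_, ?_⟩
  · exact (rapidBound_of_compact hu.continuous hc).sub
      ((rapidBound_linearGauss hβ ht e).mono zero_le_one)
  · refine (((rapidBound_of_compact hgu.continuous hguc).sub
      (rapidBound_gradient_linearGauss hβ ht e)).congr gw).of_near_zero (K := K₁ + K₃)
        fun x hx hx1 => ?_
    rw [gw x hx, Real.rpow_one, ← sub_sub_sub_cancel_right _ _ e, add_mul]
    exact (norm_sub_le _ _).trans (add_le_add (h₁ x) (h₃ x hx hx1).1)
  · refine (((rapidBound_of_compact hgEu.continuous hgEuc).sub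
      (rapidBound_gradient_euler_linearGauss hβ ht e)).congr gEw).of_near_zero (K := K₂ + K₃)
        fun x hx hx1 => ?_
    rw [gEw x hx, Real.rpow_one, ← sub_sub_sub_cancel_right _ _ e, add_mul]
    exact (norm_sub_le _ _).trans (add_le_add (h₂0 ▸ h₂ x) (h₃ x hx hx1).2)
  · exact ((rapidBound_of_compact (continuous_laplacian hu2) hLc).sub
      ((rapidBound_laplacian_linearGauss hβ ht e).mono (by linarith))).congr lw

lemma FlatAtOrigin.rapidBound_gradient_auxFun {w : EuclideanSpace ℝ (Fin N) → ℝ} (hw : FlatAtOrigin w) :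
    RapidBound 1 (∇ (auxFun α w)) := by
  have h1 : RapidBound 1 fun x => (2 : ℝ) • ∇ (euler w) x :=
    hw.gradient_euler.of_norm_le ‖(2 : ℝ)‖ fun x _ => (norm_smul _ _).le
  have h2 : RapidBound 1 fun x => (N - 4 - 2 * α : ℝ) • ∇ w x :=
    hw.gradient.of_norm_le ‖(N - 4 - 2 * α : ℝ)‖ fun x _ => (norm_smul _ _).le
  exact (h1.add h2).congr fun x hx =>
    gradient_auxFun α ((hw.smooth x hx).of_le (by norm_num))

lemma FlatAtOrigin.rapidBound_residualField {w : EuclideanSpace ℝ (Fin N) → ℝ} (hw : FlatAtOrigin w)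
    (hα : 0 < 2 * α + 2) : RapidBound 1 (residualField α t w) := by
  have h1 : RapidBound 1 fun x => (t * ‖x‖ ^ (2 * α + 2)) • ∇ w x :=
    (hw.gradient.of_le |t| (2 * α + 2) fun x _ => by
      rw [norm_smul, norm_mul, Real.norm_of_nonneg (Real.rpow_nonneg (norm_nonneg x) _),
        Real.norm_eq_abs]).mono (by linarith)
  have h2 := rapidBound_smul_self hw.laplacian
  rw [zero_add] at h2
  exact (hw.rapidBound_gradient_auxFun.add h1).sub h2

end Strip

/-! ### The inequality for 2α < N ≤ 2α+2. -/

noncomputable section StripEnergy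

variable {N : ℕ} {α t : ℝ} {e : EuclideanSpace ℝ (Fin N)}

lemma rapidBound_uncertaintyDensity {w : EuclideanSpace ℝ (Fin N) → ℝ} {l p s : ℝ}
    (hα : 0 < 2 * α + 2)
    (hL : RapidBound l (Δ w)) (hp : RapidBound p (∇ w)) (h1 : s ≤ l + l - 2 * α)
    (h2 : s ≤ p + p) : RapidBound s (uncertaintyDensity α t w) := by
  have hg : RapidBound s (gradientDensity w) := rapidBound_norm_sq hp h2
  have hA : RapidBound s (laplacianDensity α w) := by
    refine (((rapidBound_norm_sq hL le_rfl).rpow_mul (-(2 * α))).mono (b := s)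
      (by linarith)).congr fun x _ => ?_
    rw [laplacianDensity, Real.rpow_neg (norm_nonneg x), Real.norm_eq_abs, div_eq_inv_mul]
  have hB : RapidBound s (weightedGradientDensity α w) :=
    (hg.rpow_mul (2 * α + 2)).mono (by linarith)
  exact (hA.add (hB.const_mul (t ^ 2))).sub (hg.const_mul (t * (N + 4 * α + 2)))

lemma FlatAtOrigin.rapidBound_euler {w : EuclideanSpace ℝ (Fin N) → ℝ} (hw : FlatAtOrigin w) :
    RapidBound 2 (euler w) := by
  have h := hw.gradient.of_le (g := euler w) 1 1 fun x _ => by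
    rw [Real.rpow_one, one_mul]; exact norm_inner_le_norm _ _
  exact h.mono (by norm_num)

/-- Its profiles have no constant term, so it vanishes to order 2α+2 and cancels the singular weight
|x|^{-2α-2}. -/
lemma rapidBound_corrector (hα : 0 < 2 * α + 2) (ht : 0 < t) (hα' : 0 ≤ α) (a b : ℝ)
    (e : EuclideanSpace ℝ (Fin N)) : RapidBound (2 * α + 2) (corrector α t a b e) := by
  have h1 := rapidBound_smul_const (rapidBound_gaussProfile_one (N := N) hα ht a b) e
  have h2 := rapidBound_smul_self (rapidBound_inner_mul
    (((rapidBound_gaussProfile_one (N := N) hα ht 1 0).const_mul (b * t)).rpow_mul (2 * α)) e)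
  refine (h1.sub (h2.mono (by linarith))).congr fun x _ => ?_
  rw [corrector]
  congr 2
  ring

/-- Flatness gains two powers of |x| in every quadratic expression, so everything is O(|x|^{-2α})
and N > 2α suffices. -/
lemma FlatAtOrigin.integral_density_sub {w : EuclideanSpace ℝ (Fin N) → ℝ} (hw : FlatAtOrigin w)
    (hN : 1 ≤ N) (hα : 0 ≤ α) (hNα : 0 < N - 2 * α) :
    Integrable (fun x => uncertaintyDensity α t w x -
      ‖x‖ ^ (-2 * α - 2) * ‖residualField α t w x‖ ^ 2) ∧
    ∫ x, (uncertaintyDensity α t w x -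
      ‖x‖ ^ (-2 * α - 2) * ‖residualField α t w x‖ ^ 2) = 0 := by
  have hβ : 0 < 2 * α + 2 := by linarith
  refine integral_divergence_eq_zero_of_rapidBound hN
    (fun x hx => hasDivAt_uncertaintyFlux α t hx (hw.smooth x hx)) (a := -2 * α) ?_ (by linarith)
    (b := -2 * α) ?_ (by linarith)
  · have hp := rapidBound_norm_sq hw.gradient (b := 2) (by norm_num)
    have hpc := (hw.gradient.norm.mul (hw.rapidBound_gradient_auxFun (α := α)).norm).mono (b := 2) (by norm_num)
    have h1 := ((((hpc.const_mul 4).add (hp.const_mul |N - 4 - 2 * α|)).add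
      (hp.const_mul |2 * (2 * α + 2)|)).rpow_mul (-2 * α - 2)).mono (b := -2 * α) (by linarith)
    have h2 := ((hp.const_mul 5).const_mul |t|).mono (b := -2 * α) (by linarith)
    refine (h1.add h2).of_norm_le 1 fun x hx => ?_
    rw [one_mul, Real.norm_of_nonneg (by positivity), Real.norm_of_nonneg (by positivity)]
    exact norm_uncertaintyFlux_le α t w hx
  · exact (rapidBound_uncertaintyDensity hβ hw.laplacian hw.gradient (by linarith)
      (by linarith)).sub (((rapidBound_norm_sq (hw.rapidBound_residualField hβ) (b := 2)
        (by norm_num)).rpow_mul (-2 * α - 2)).mono (by linarith))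

lemma FlatAtOrigin.integral_polar_add {w : EuclideanSpace ℝ (Fin N) → ℝ} (hw : FlatAtOrigin w)
    (hN : 1 < N) (hα : 0 ≤ α) (ht : 0 < t) {a b : ℝ}
    (ha : a * (3 * (2 * α + 2) - 2 * N) = 4 * N - 3 * (2 * α + 2))
    (hb : 3 * (N - 1) * b = 2 - 2 * a) (e : EuclideanSpace ℝ (Fin N)) :
    Integrable (fun x => polarDensity α t (linearGauss α t e) w x + ‖x‖ ^ (-2 * α - 2) *
        inner ℝ (residualField α t w x) (corrector α t a b e x)) ∧
    ∫ x, (polarDensity α t (linearGauss α t e) w x + ‖x‖ ^ (-2 * α - 2) *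
        inner ℝ (residualField α t w x) (corrector α t a b e x)) = 0 := by
  have hβ : 0 < 2 * α + 2 := by linarith
  have hN' : (1 : ℝ) < N := by exact_mod_cast hN
  have hP := fun a b c => rapidBound_gaussProfile (N := N) hβ ht a b c
  refine integral_divergence_eq_zero_of_rapidBound hN.le (fun x hx => hasDivAt_polarFlux hβ.ne' hx ha hb
    ((hw.smooth x hx).of_le (by norm_num))) (a := -1) ?_ (by linarith) (b := 0) ?_ (by linarith)
  · have f1 := rapidBound_smul (rapidBound_inner_mul (hP (-(2 * α + 2 + N + a)) 1 0) e) hw.gradient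
    have f2 := rapidBound_smul_const ((hP (2 * a) (2 * b) 0).mul hw.rapidBound_euler) e
    have f3 := rapidBound_smul_self ((rapidBound_inner_mul
      (((hP (2 * b) 0 0).const_mul t).rpow_mul (2 * α)) e).mul hw.rapidBound_euler)
    have f4 := rapidBound_smul_const ((hP (a * (N - 4 - 2 * α) + a - 2 * α)
      (a + b * (N - 4 - 2 * α)) b).mul hw.self) e
    have f5 := rapidBound_smul_self ((rapidBound_inner_mul
      (((hP (a - 2 + b * (N + (2 * α + 2))) (-b) 0).const_mul t).rpow_mul (2 * α)) e).mul hw.self)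
    have hsum := (((f1.mono (b := 0) (by norm_num)).add (f2.mono (b := 0) (by norm_num))).sub
      (f3.mono (b := 0) (by linarith))).add ((f4.mono (b := 0) (by norm_num)).add
        (f5.mono (b := 0) (by linarith)))
    have := (hsum.of_norm_le (g := polarFlux α t a b e w) |t| fun x _ => by
      rw [polarFlux, norm_smul, Real.norm_eq_abs]
      refine le_of_eq ?_
      congr 4 <;> congr 2 <;> ring).norm_div
    rwa [zero_sub] at this
  · have hv := rapidBound_laplacian_linearGauss (N := N) hβ ht e
    have p1 := ((hv.mul hw.laplacian).rpow_mul (-(2 * α))).mono (b := 0) (by linarith)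
    have p2 : RapidBound 1 fun x => inner ℝ (∇ (linearGauss α t e) x) (∇ w x) := by
      have := (rapidBound_gradient_linearGauss (N := N) hβ ht e).mul_of_le hw.gradient
        (h := fun x => inner ℝ (∇ (linearGauss α t e) x) (∇ w x)) fun x _ => norm_inner_le_norm _ _
      rwa [zero_add] at this
    have p3 := ((p2.const_mul (t ^ 2)).rpow_mul (2 * α + 2)).mono (b := 0) (by linarith)
    have p4 := (p2.const_mul (t * (N + 4 * α + 2))).mono (b := 0) (by norm_num)
    have p5 := (((hw.rapidBound_residualField (t := t) hβ).mul_of_le (rapidBound_corrector hβ ht hα a b e)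
      (h := fun x => inner ℝ (residualField α t w x) (corrector α t a b e x))
        fun x _ => norm_inner_le_norm _ _).rpow_mul (-2 * α - 2)).mono (b := 0) (by linarith)
    refine ((p1.add (p3.sub p4)).add p5).congr fun x _ => ?_
    rw [polarDensity, Real.rpow_neg (norm_nonneg x)]
    ring

lemma integral_linearGauss_energy (hN : 1 ≤ N) (hα : 0 ≤ α) (ht : 0 < t)
    {a b c₀ c₁ c₂ d₀ d₁ d₂ : ℝ}
    (h₁ : 2 + b ^ 2 = -2 * c₂)
    (h₂ : -3 * N - 4 * (2 * α + 2) + 2 * a * b = 2 * (2 * α + 2) * c₂ - 2 * c₁)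
    (h₃ : (N + (2 * α + 2)) ^ 2 + 2 * (N + 4 * α + 2) = (2 * α + 2) * c₁ - 2 * c₀)
    (h₄ : b ^ 2 = 2 * d₂)
    (h₅ : -2 * a * b = c₂ + (N + 2 * (2 * α + 2)) * d₂ - 2 * d₁)
    (h₆ : -(N + 4 * α + 2) = c₀ + N * d₀) (e : EuclideanSpace ℝ (Fin N)) :
    Integrable (fun x => uncertaintyDensity α t (linearGauss α t e) x -
        ‖x‖ ^ (-2 * α - 2) * ‖corrector α t a b e x‖ ^ 2 -
        (1 - a ^ 2 - c₁ - (N + (2 * α + 2)) * d₁ + 2 * d₀) * (t * ‖e‖ ^ 2 *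
          (gaussFactor α t x * gaussProfile α t 0 1 0 x))) ∧
    ∫ x, (uncertaintyDensity α t (linearGauss α t e) x -
        ‖x‖ ^ (-2 * α - 2) * ‖corrector α t a b e x‖ ^ 2 -
        (1 - a ^ 2 - c₁ - (N + (2 * α + 2)) * d₁ + 2 * d₀) * (t * ‖e‖ ^ 2 *
          (gaussFactor α t x * gaussProfile α t 0 1 0 x))) = 0 := by
  have hβ : 0 < 2 * α + 2 := by linarith
  have hN' : (1 : ℝ) ≤ N := by exact_mod_cast hN
  have hf := rapidBound_gaussFactor (N := N) hβ ht
  have hP := fun a b c => rapidBound_gaussProfile (N := N) hβ ht a b c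
  refine integral_divergence_eq_zero_of_rapidBound hN
    (fun x hx => hasDivAt_selfFlux hβ.ne' hx h₁ h₂ h₃ h₄ h₅ h₆) (a := 0) ?_ (by linarith)
    (b := 0) ?_ (by linarith)
  · have f1 := rapidBound_smul_const (rapidBound_inner_mul (hf.mul (hP c₀ c₁ c₂)) e) e
    have f2 := rapidBound_smul_self ((hf.mul (hP d₀ d₁ d₂)).const_mul (‖e‖ ^ 2))
    have := ((f1.add f2).of_norm_le (g := selfFlux α t c₀ c₁ c₂ d₀ d₁ d₂ e) |t| fun x _ => by
      rw [selfFlux, norm_smul, Real.norm_eq_abs]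
      refine le_of_eq ?_
      congr 4
      ring).norm_div
    exact this.mono (by norm_num)
  · have hv := rapidBound_laplacian_linearGauss (N := N) hβ ht e
    have q1 := rapidBound_uncertaintyDensity (t := t) (s := 0) hβ hv
      (rapidBound_gradient_linearGauss (N := N) hβ ht e) (by linarith) (by norm_num)
    have q2 := ((rapidBound_norm_sq (rapidBound_corrector hβ ht hα a b e) le_rfl).rpow_mul
      (-2 * α - 2)).mono (b := 0) (by linarith)
    have q3 := (((hf.mul (hP 0 1 0)).const_mul (t * ‖e‖ ^ 2)).const_mul
      (1 - a ^ 2 - c₁ - (N + (2 * α + 2)) * d₁ + 2 * d₀)).mono (b := 0) (by norm_num)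
    exact (q1.sub q2).sub q3

/-- The inequality in the range where linear functions are not negligible at the origin. -/
theorem uncertaintyPrinciple_of_le (hα : 0 < α + 1) (h0 : 0 < N - 2 * α)
    (h1 : N ≤ 2 * α + 2) (h2 : 0 < N - (√5 - 1) * α - (√5 + 1)) :
    UncertaintyPrinciple α (testSpace N α) (|N + 4 * α + 2| / 2) := by
  have hs1 : (2.236 : ℝ) < √5 := Real.lt_sqrt_of_sq_lt (by norm_num)
  have hs2 : √5 < 2.237 := by
    rw [Real.sqrt_lt' (by norm_num)]; norm_num
  -- N lies above (√5-1)α + √5 + 1 and at most at 2α+2, which forces (3-√5)α > √5-1.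
  have hα1 : 1 < α := by nlinarith
  have hN1 : (1 : ℝ) < N := by nlinarith
  have hN : 1 < N := by exact_mod_cast hN1
  have := nontrivial_of_one_le hN.le
  rintro u ⟨hu, hc, hA, hB⟩
  have hu3 : ContDiff ℝ 3 u := by exact_mod_cast contDiff_infty.1 hu 3
  have hD := integrable_gradientDensity (hu3.of_le (by norm_num)) hc
  -- the coefficients
  obtain ⟨a, ha⟩ : ∃ a : ℝ, a * (3 * (2 * α + 2) - 2 * N) = 4 * N - 3 * (2 * α + 2) :=
    ⟨(4 * N - 3 * (2 * α + 2)) / (3 * (2 * α + 2) - 2 * N), div_mul_cancel₀ _ (by nlinarith)⟩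
  obtain ⟨b, hb⟩ : ∃ b : ℝ, 3 * (N - 1) * b = 2 - 2 * a :=
    ⟨(2 - 2 * a) / (3 * (N - 1)), mul_div_cancel₀ _ (by nlinarith)⟩
  obtain ⟨c₂, h₁⟩ : ∃ c₂ : ℝ, 2 + b ^ 2 = -2 * c₂ := ⟨-(2 + b ^ 2) / 2, by ring⟩
  obtain ⟨c₁, h₂⟩ : ∃ c₁ : ℝ, -3 * N - 4 * (2 * α + 2) + 2 * a * b = 2 * (2 * α + 2) * c₂ - 2 * c₁ :=
    ⟨(2 * (2 * α + 2) * c₂ - (-3 * N - 4 * (2 * α + 2) + 2 * a * b)) / 2, by ring⟩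
  obtain ⟨c₀, h₃⟩ : ∃ c₀ : ℝ, (N + (2 * α + 2)) ^ 2 + 2 * (N + 4 * α + 2) = (2 * α + 2) * c₁ - 2 * c₀ :=
    ⟨((2 * α + 2) * c₁ - ((N + (2 * α + 2)) ^ 2 + 2 * (N + 4 * α + 2))) / 2, by ring⟩
  obtain ⟨d₂, h₄⟩ : ∃ d₂ : ℝ, b ^ 2 = 2 * d₂ := ⟨b ^ 2 / 2, by ring⟩
  obtain ⟨d₁, h₅⟩ : ∃ d₁ : ℝ, -2 * a * b = c₂ + (N + 2 * (2 * α + 2)) * d₂ - 2 * d₁ :=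
    ⟨(c₂ + (N + 2 * (2 * α + 2)) * d₂ + 2 * a * b) / 2, by ring⟩
  obtain ⟨d₀, h₆⟩ : ∃ d₀ : ℝ, -(N + 4 * α + 2) = c₀ + N * d₀ :=
    ⟨(-(N + 4 * α + 2) - c₀) / N, by field_simp; ring⟩
  have hK := corrector_energy_nonneg (n := N) (β := 2 * α + 2) (c₀ := c₀) (d₀ := d₀) h1 hN1 (by linarith)
    (by convert h2 using 3; ring) ha hb h₁ h₂ (by linarith) h₄ h₅ (by linarith)
  set e := ∇ u 0
  have key : ∀ t : ℝ, 0 < t → 0 ≤ ∫ x, uncertaintyDensity α t u x := by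
    intro t ht
    have hw := flatAtOrigin_sub_linearGauss (α := α) (by linarith) ht hu3 hc
    set w := fun x => u x - linearGauss α t e x
    obtain ⟨i1, z1⟩ := hw.integral_density_sub (t := t) hN.le (by linarith) h0
    obtain ⟨i2, z2⟩ := hw.integral_polar_add hN (by linarith) ht ha hb e
    obtain ⟨i3, z3⟩ := integral_linearGauss_energy (t := t) hN.le (by linarith) ht h₁ h₂ h₃ h₄ h₅ h₆ e
    have hq : Integrable (uncertaintyDensity α t u) :=
      (hA.add (hB.const_mul (t ^ 2))).sub (hD.const_mul (t * (N + 4 * α + 2)))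
    have i12 := (i1.add (i2.const_mul 2)).add i3
    have z12 := integral_add (i1.add (i2.const_mul 2)) i3
    have z12' := integral_add i1 (i2.const_mul 2)
    simp only [Pi.add_apply] at z12 z12'
    rw [z12', integral_const_mul, z1, z2, z3] at z12
    have hfin := integral_sub hq i12
    simp only [Pi.add_apply] at hfin
    rw [z12] at hfin
    -- From the density of u one subtracts the three expressions of integral zero. What remains is
    -- W|R(w) - c|² plus the nonnegative multiple of the leftover term.
    have hpos : 0 ≤ ∫ x, (uncertaintyDensity α t u x - (uncertaintyDensity α t w x -
        ‖x‖ ^ (-2 * α - 2) * ‖residualField α t w x‖ ^ 2 + 2 * (polarDensity α t (linearGauss α t e) w x +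
        ‖x‖ ^ (-2 * α - 2) * inner ℝ (residualField α t w x) (corrector α t a b e x)) +
        (uncertaintyDensity α t (linearGauss α t e) x -
        ‖x‖ ^ (-2 * α - 2) * ‖corrector α t a b e x‖ ^ 2 -
        (1 - a ^ 2 - c₁ - (N + (2 * α + 2)) * d₁ + 2 * d₀) * (t * ‖e‖ ^ 2 *
          (gaussFactor α t x * gaussProfile α t 0 1 0 x))))) := by
      refine integral_nonneg_of_ae ?_
      filter_upwards [Measure.ae_ne volume (0 : EuclideanSpace ℝ (Fin N))] with x hx
      have hvx : ContDiffAt ℝ 2 (linearGauss α t e) x := contDiffAt_linearGauss hx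
      have hwx : ContDiffAt ℝ 2 w x := (hw.smooth x hx).of_le (by norm_num)
      have huw : u = fun y => w y + linearGauss α t e y := by ext y; simp [w]
      have g1 : ∇ u x = ∇ w x + ∇ (linearGauss α t e) x := by
        conv_lhs => rw [huw]
        exact ((hwx.of_le (by norm_num)).hasGradAt.add (hvx.of_le (by norm_num)).hasGradAt).2.gradient
      have g2 : (Δ u) x = (Δ w) x + (Δ (linearGauss α t e)) x := by
        conv_lhs => rw [huw]
        exact hwx.laplacian_add hvx
      have hdens : uncertaintyDensity α t u x = uncertaintyDensity α t w x +
          2 * polarDensity α t (linearGauss α t e) w x +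
            uncertaintyDensity α t (linearGauss α t e) x := by
        unfold uncertaintyDensity polarDensity laplacianDensity weightedGradientDensity gradientDensity
        rw [g1, g2, norm_add_sq_real, sq_abs, sq_abs, sq_abs, real_inner_comm (∇ w x)]
        ring
      have hsq := norm_sub_sq_real (residualField α t w x) (corrector α t a b e x)
      have h1 : 0 ≤ ‖x‖ ^ (-2 * α - 2) * ‖residualField α t w x - corrector α t a b e x‖ ^ 2 := by
        positivity
      have h2 : 0 ≤ (1 - a ^ 2 - c₁ - (N + (2 * α + 2)) * d₁ + 2 * d₀) * (t * ‖e‖ ^ 2 *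
          (gaussFactor α t x * gaussProfile α t 0 1 0 x)) := by
        have := (gaussFactor_pos α t x).le
        have : 0 ≤ gaussProfile α t 0 1 0 x := by
          unfold gaussProfile
          have : 0 ≤ ‖x‖ ^ (2 * α + 2) := by positivity
          simp only [zero_add, one_mul, zero_mul, add_zero]
          positivity
        positivity
      rw [hsq] at h1
      simp only [Pi.zero_apply]
      rw [hdens]
      linarith
    linarith
  rw [ge_iff_le, ← abs_two, ← abs_div]
  refine uncertainty_of_quadratic_pos (integral_nonneg (laplacianDensity_nonneg α u))
    (integral_nonneg (weightedGradientDensity_nonneg α u))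
    (integral_nonneg (gradientDensity_nonneg u)) (by linarith) fun t ht => ?_
  have := key t ht
  rw [integral_uncertaintyDensity hA hB hD] at this
  linarith

end StripEnergy

/-! ### The extremal functions attain equality. -/

noncomputable section Extremal

variable {N : ℕ} {α σ p : ℝ} {x : EuclideanSpace ℝ (Fin N)}

lemma continuousAt_gaussFactor (hx : x ≠ 0) (α t : ℝ) : ContinuousAt (gaussFactor α t) x := by
  have := (hasGradAt_rpow (2 * α + 2) hx).1.continuousAt
  unfold gaussFactor
  fun_prop

lemma gaussFactor_sq_le_rpow (hσ : 0 < σ * (2 * α + 2)) {q : ℝ} (hq : 0 < q) :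
    ∃ K, 0 ≤ K ∧ ∀ x : EuclideanSpace ℝ (Fin N), x ≠ 0 →
      gaussFactor α σ x * gaussFactor α σ x ≤ K * ‖x‖ ^ (-(2 * α + 2) * q) := by
  have hc : 0 < 2 * (σ / (2 * α + 2)) := by
    rcases lt_trichotomy (2 * α + 2) 0 with h | h | h
    · have : σ < 0 := by nlinarith
      exact mul_pos two_pos (div_pos_of_neg_of_neg this h)
    · simp [h] at hσ
    · have : 0 < σ := by nlinarith
      positivity
  refine ⟨q ^ q * (2 * (σ / (2 * α + 2))) ^ (-q), by positivity, fun x hx => ?_⟩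
  have hn := norm_pos_iff.2 hx
  have h := exp_neg_le_rpow hq (y := 2 * (σ / (2 * α + 2)) * ‖x‖ ^ (2 * α + 2)) (by positivity)
  rw [Real.mul_rpow hc.le (by positivity), ← Real.rpow_mul hn.le] at h
  rw [gaussFactor, ← Real.exp_add]
  convert h using 1
  · congr 1; ring
  · rw [mul_assoc]; ring_nf

lemma gaussFactor_sq_le_one (hσ : 0 < σ * (2 * α + 2)) (x : EuclideanSpace ℝ (Fin N)) :
    gaussFactor α σ x * gaussFactor α σ x ≤ 1 := by
  have hc : 0 ≤ σ / (2 * α + 2) := by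
    rw [← mul_div_mul_right σ _ (show (2 * α + 2) ≠ 0 by rintro h; simp [h] at hσ)]
    exact div_nonneg hσ.le (mul_self_nonneg _)
  have : gaussFactor α σ x ≤ 1 := by
    unfold gaussFactor
    rw [Real.exp_le_one_iff, neg_mul, neg_nonpos]
    positivity
  exact mul_le_one₀ this (gaussFactor_pos α σ x).le this

/-- If σ and 2α+2 are positive, the exponential decays at infinity and N+p > 0 settles the origin.
If both are negative, it vanishes rapidly at the origin and N+p < 0 settles infinity. The exponent q
is large enough to win at the end governed by the exponential. -/
lemma integrable_rpow_mul_gaussFactor_sq (hN : 1 ≤ N) (hσ : 0 < σ * (2 * α + 2))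
    (hp : 0 < σ * (N + p)) :
    Integrable fun x : EuclideanSpace ℝ (Fin N) => ‖x‖ ^ p * (gaussFactor α σ x * gaussFactor α σ x) := by
  have := nontrivial_of_one_le hN
  have hm : AEStronglyMeasurable (fun x : EuclideanSpace ℝ (Fin N) =>
      ‖x‖ ^ p * (gaussFactor α σ x * gaussFactor α σ x)) volume := by
    refine aestronglyMeasurable_of_continuousOn_ne_zero fun x hx => ?_
    have h1 := (hasGradAt_rpow p hx).1.continuousAt
    have h2 := continuousAt_gaussFactor hx α σ
    fun_prop
  have hbound1 : ∀ x : EuclideanSpace ℝ (Fin N),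
      ‖‖x‖ ^ p * (gaussFactor α σ x * gaussFactor α σ x)‖ ≤ 1 * ‖x‖ ^ p := fun x => by
    rw [Real.norm_of_nonneg (mul_nonneg (by positivity) (mul_self_nonneg _)), mul_comm]
    exact mul_le_mul_of_nonneg_right (gaussFactor_sq_le_one hσ x) (by positivity)
  set q := (|p| + N + 1) / |2 * α + 2| with hq
  have hβ0 : 2 * α + 2 ≠ 0 := by rintro h; simp [h] at hσ
  have hq0 : 0 < q := by have := abs_pos.2 hβ0; positivity
  have hβq : |2 * α + 2| * q = |p| + N + 1 := by
    rw [hq, mul_div_cancel₀ _ (abs_pos.2 hβ0).ne']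
  obtain ⟨K, hK, hKb⟩ := gaussFactor_sq_le_rpow (N := N) hσ hq0
  have hbound2 : ∀ x : EuclideanSpace ℝ (Fin N), x ≠ 0 →
      ‖‖x‖ ^ p * (gaussFactor α σ x * gaussFactor α σ x)‖ ≤ K * ‖x‖ ^ (p - (2 * α + 2) * q) := by
    intro x hx
    have hn := norm_pos_iff.2 hx
    rw [Real.norm_of_nonneg (mul_nonneg (by positivity) (mul_self_nonneg _))]
    calc _ ≤ ‖x‖ ^ p * (K * ‖x‖ ^ (-(2 * α + 2) * q)) :=
        mul_le_mul_of_nonneg_left (hKb x hx) (by positivity)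
      _ = K * (‖x‖ ^ p * ‖x‖ ^ (-(2 * α + 2) * q)) := by ring
      _ = _ := by rw [← Real.rpow_add hn]; ring_nf
  rcases lt_or_gt_of_ne hβ0 with h | h
  · have hs : σ < 0 := by nlinarith
    have hpN : (N : ℝ) + p < 0 := by nlinarith
    rw [abs_of_neg h] at hβq
    refine integrable_of_rpow_bounds hN hm (K := max 1 K) (a := p - (2 * α + 2) * q) (b := p) ?_ (by linarith)
      (fun x hx _ => (hbound2 x hx).trans ?_) fun x _ => (hbound1 x).trans ?_
    · linarith [neg_abs_le p]
    · gcongr; exact le_max_right _ _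
    · gcongr; exact le_max_left _ _
  · have hs : 0 < σ := by nlinarith
    have hpN : 0 < (N : ℝ) + p := by nlinarith
    rw [abs_of_pos h] at hβq
    refine integrable_of_rpow_bounds hN hm (K := max 1 K) (a := p) (b := p - (2 * α + 2) * q)
      (by linarith) ?_ (fun x hx _ => (hbound1 x).trans ?_)
      fun x hx => (hbound2 x (norm_pos_iff.1 (by linarith))).trans ?_
    · linarith [le_abs_self p]
    · gcongr; exact le_max_left _ _
    · gcongr; exact le_max_right _ _

/-- Integrate the divergence of |x|^p f² x, where f is the Gaussian factor. -/
lemma integral_rpow_mul_gaussFactor_sq (hN : 1 ≤ N) (hσ : 0 < σ * (2 * α + 2))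
    (hp : 0 < σ * (N + p)) :
    (N + p) * ∫ x : EuclideanSpace ℝ (Fin N), ‖x‖ ^ p * (gaussFactor α σ x * gaussFactor α σ x) =
      2 * σ * ∫ x : EuclideanSpace ℝ (Fin N),
        ‖x‖ ^ (p + (2 * α + 2)) * (gaussFactor α σ x * gaussFactor α σ x) := by
  have := nontrivial_of_one_le hN
  have hβ0 : 2 * α + 2 ≠ 0 := by rintro h; simp [h] at hσ
  have i1 := integrable_rpow_mul_gaussFactor_sq hN hσ hp
  have i2 := integrable_rpow_mul_gaussFactor_sq (N := N) (p := p + (2 * α + 2)) hN hσ (by linarith)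
  have hd : ∀ x : EuclideanSpace ℝ (Fin N), x ≠ 0 →
      HasDivAt (fun y => ‖y‖ ^ p • (gaussFactor α σ y * gaussFactor α σ y) • y)
        ((N + p) * (‖x‖ ^ p * (gaussFactor α σ x * gaussFactor α σ x)) -
          2 * σ * (‖x‖ ^ (p + (2 * α + 2)) * (gaussFactor α σ x * gaussFactor α σ x))) x := by
    intro x hx
    have hg := hasGradAt_gaussFactor (t := σ) hβ0 hx
    refine (hasDivAt_rpow_smul_self hx (hg.mul hg) p).congr ?_
    rw [Real.rpow_add (norm_pos_iff.2 hx), rpow_two_mul_add_two hx]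
    simp only [inner_add_left, inner_smul_left, conj_trivial, real_inner_self_rpow]
    ring
  have h0 := integral_divergence_eq_zero hd (i1.congr ?_) ((i1.const_mul _).sub (i2.const_mul _))
  · rw [integral_sub (i1.const_mul _) (i2.const_mul _), integral_const_mul, integral_const_mul] at h0
    linarith
  · filter_upwards [Measure.ae_ne volume (0 : EuclideanSpace ℝ (Fin N))] with x hx
    have hn := norm_pos_iff.2 hx
    rw [norm_smul, norm_smul, Real.norm_of_nonneg (mul_self_nonneg _),
      Real.norm_of_nonneg (by positivity)]
    field_simp

lemma gradient_gaussFactor (hβ : 2 * α + 2 ≠ 0) (hx : x ≠ 0) :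
    ∇ (gaussFactor α σ) x = (-(σ * ‖x‖ ^ (2 * α)) * gaussFactor α σ x) • x :=
  (hasGradAt_gaussFactor hβ hx).2.gradient

lemma laplacian_gaussFactor (hβ : 2 * α + 2 ≠ 0) (hx : x ≠ 0) :
    (Δ (gaussFactor α σ)) x = -(σ * ‖x‖ ^ (2 * α)) * gaussFactor α σ x *
      (N + 2 * α - σ * ‖x‖ ^ (2 * α + 2)) := by
  have h2 : ContDiffAt ℝ 2 (fun y : EuclideanSpace ℝ (Fin N) => ‖y‖ ^ (2 * α + 2)) x :=
    ContDiffAt.rpow_const_of_ne (contDiffAt_norm ℝ hx) (norm_ne_zero_iff.2 hx)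
  have hc : ContDiffAt ℝ 2 (gaussFactor α σ) x :=
    Real.contDiff_exp.contDiffAt.comp x (contDiffAt_const.mul h2)
  have hg := hasGradAt_gaussFactor (t := σ) hβ hx
  have h1 := (hasDivAt_rpow_smul_self hx hg (2 * α)).const_smul (-σ)
  have h3 := h1.congr_fun (G := ∇ (gaussFactor α σ)) (by
    filter_upwards [isOpen_compl_singleton.mem_nhds hx] with y hy
    rw [gradient_gaussFactor hβ hy, smul_smul, smul_smul]
    congr 1
    ring)
  rw [← (hasDivAt_gradient hc).2, h3.2, inner_smul_left, real_inner_self_rpow, conj_trivial,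
    rpow_two_mul_add_two hx]
  ring

theorem attainsUncertainty_gaussFactor (hN : 1 ≤ N) (hσ1 : σ ^ 2 = 1) (hσ : 0 < σ * (2 * α + 2))
    (hσN : 0 < σ * (N + 2 * α)) :
    AttainsUncertainty (N := N) α (gaussFactor α σ) (σ * (N + 4 * α + 2) / 2) := by
  have := nontrivial_of_one_le hN
  have hβ0 : 2 * α + 2 ≠ 0 := by rintro h; simp [h] at hσ
  have hne := Measure.ae_ne volume (0 : EuclideanSpace ℝ (Fin N))
  have i0 := integrable_rpow_mul_gaussFactor_sq (N := N) (p := 2 * α) hN hσ hσN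
  have i1 := integrable_rpow_mul_gaussFactor_sq (N := N) (p := 2 * α + (2 * α + 2)) hN hσ (by linarith)
  have i2 := integrable_rpow_mul_gaussFactor_sq (N := N) (p := 2 * α + (2 * α + 2) + (2 * α + 2)) hN hσ
    (by linarith)
  have r0 := integral_rpow_mul_gaussFactor_sq (N := N) (p := 2 * α) hN hσ hσN
  have r1 := integral_rpow_mul_gaussFactor_sq (N := N) (p := 2 * α + (2 * α + 2)) hN hσ (by linarith)
  have eD : gradientDensity (gaussFactor α σ) =ᵐ[volume] fun x : EuclideanSpace ℝ (Fin N) =>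
      ‖x‖ ^ (2 * α + (2 * α + 2)) * (gaussFactor α σ x * gaussFactor α σ x) := by
    filter_upwards [hne] with x hx
    rw [gradientDensity, gradient_gaussFactor hβ0 hx, ← real_inner_self_eq_norm_sq, inner_smul_left,
      inner_smul_right, real_inner_self_rpow, conj_trivial, Real.rpow_add (norm_pos_iff.2 hx),
      rpow_two_mul_add_two hx]
    linear_combination (‖x‖ ^ (2 * α) * ‖x‖ ^ (2 * α) * ‖x‖ ^ (2 : ℝ) *
      (gaussFactor α σ x * gaussFactor α σ x)) * hσ1
  have eB : weightedGradientDensity α (gaussFactor α σ) =ᵐ[volume] fun x : EuclideanSpace ℝ (Fin N) =>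
      ‖x‖ ^ (2 * α + (2 * α + 2) + (2 * α + 2)) * (gaussFactor α σ x * gaussFactor α σ x) := by
    filter_upwards [eD, hne] with x hx hx0
    rw [gradientDensity] at hx
    rw [weightedGradientDensity, hx, Real.rpow_add (norm_pos_iff.2 hx0) (2 * α + (2 * α + 2))]
    ring
  have eA : laplacianDensity α (gaussFactor α σ) =ᵐ[volume] fun x : EuclideanSpace ℝ (Fin N) =>
      (N + 2 * α) ^ 2 * (‖x‖ ^ (2 * α) * (gaussFactor α σ x * gaussFactor α σ x)) -
      2 * σ * (N + 2 * α) * (‖x‖ ^ (2 * α + (2 * α + 2)) * (gaussFactor α σ x * gaussFactor α σ x)) +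
      ‖x‖ ^ (2 * α + (2 * α + 2) + (2 * α + 2)) * (gaussFactor α σ x * gaussFactor α σ x) := by
    filter_upwards [hne] with x hx
    have hn := norm_pos_iff.2 hx
    have hr : 0 < ‖x‖ ^ (2 * α) := Real.rpow_pos_of_pos hn _
    rw [laplacianDensity, sq_abs, laplacian_gaussFactor hβ0 hx, Real.rpow_add hn (2 * α + (2 * α + 2)),
      Real.rpow_add hn (2 * α) (2 * α + 2)]
    generalize ‖x‖ ^ (2 * α) = r at *
    generalize ‖x‖ ^ (2 * α + 2) = s at *
    generalize gaussFactor α σ x = g at *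
    field_simp
    linear_combination (g ^ 2 * ((N + 2 * α - σ * s) ^ 2 + s ^ 2)) * hσ1
  have hpos : 0 < ∫ x : EuclideanSpace ℝ (Fin N),
      ‖x‖ ^ (2 * α + (2 * α + 2)) * (gaussFactor α σ x * gaussFactor α σ x) := by
    refine (integral_pos_iff_support_of_nonneg (fun x => mul_nonneg (by positivity)
      (mul_self_nonneg _)) i1).2 ?_
    have hsub : ({0}ᶜ : Set (EuclideanSpace ℝ (Fin N))) ⊆ Function.support fun x =>
        ‖x‖ ^ (2 * α + (2 * α + 2)) * (gaussFactor α σ x * gaussFactor α σ x) := fun x hx => by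
      have hn := norm_pos_iff.2 hx
      have := gaussFactor_pos α σ x
      have h1 : 0 < ‖x‖ ^ (2 * α + (2 * α + 2)) := Real.rpow_pos_of_pos hn _
      exact (by positivity : 0 < ‖x‖ ^ (2 * α + (2 * α + 2)) *
        (gaussFactor α σ x * gaussFactor α σ x)).ne'
    refine lt_of_lt_of_le ?_ (measure_mono hsub)
    exact isOpen_compl_singleton.measure_pos volume ⟨_, (exists_ne (0 : EuclideanSpace ℝ (Fin N))).choose_spec⟩
  have IA : Integrable (laplacianDensity α (gaussFactor (N := N) α σ)) :=
    (((i0.const_mul _).sub (i1.const_mul _)).add i2).congr eA.symm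
  refine ⟨IA, i2.congr eB.symm, i1.congr eD.symm, ?_, ?_⟩
  · rwa [integral_congr_ae eD]
  · rw [uncertaintyProduct, integral_congr_ae eD, integral_congr_ae eB, integral_congr_ae eA,
      integral_add (f := fun x : EuclideanSpace ℝ (Fin N) =>
        (N + 2 * α) ^ 2 * (‖x‖ ^ (2 * α) * (gaussFactor α σ x * gaussFactor α σ x)) -
        2 * σ * (N + 2 * α) *
          (‖x‖ ^ (2 * α + (2 * α + 2)) * (gaussFactor α σ x * gaussFactor α σ x)))
        ((i0.const_mul _).sub (i1.const_mul _)) i2,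
      integral_sub (i0.const_mul _) (i1.const_mul _), integral_const_mul, integral_const_mul]
    generalize ∫ x : EuclideanSpace ℝ (Fin N),
      ‖x‖ ^ (2 * α + (2 * α + 2) + (2 * α + 2)) * (gaussFactor α σ x * gaussFactor α σ x) = B at *
    generalize ∫ x : EuclideanSpace ℝ (Fin N),
      ‖x‖ ^ (2 * α + (2 * α + 2)) * (gaussFactor α σ x * gaussFactor α σ x) = D at *
    generalize ∫ x : EuclideanSpace ℝ (Fin N),
      ‖x‖ ^ (2 * α) * (gaussFactor α σ x * gaussFactor α σ x) = J at *
    -- The recurrence at p = 4α+2 fixes the ratio of B to D; at p = 2α it makes the Laplacian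
    -- integral equal to B. Hence the product of square roots is B itself.
    have hB : B = σ * (N + 4 * α + 2) / 2 * D := by
      linear_combination (-σ / 2) * r1 - B * hσ1
    have hA : (N + 2 * α) ^ 2 * J - 2 * σ * (N + 2 * α) * D + B = B := by
      linear_combination (N + 2 * α) * r0
    have hB0 : 0 ≤ B := by
      rw [hB]
      have : 0 < σ * (N + 4 * α + 2) := by linarith
      positivity
    rw [hA, Real.mul_self_sqrt hB0, hB]

end Extremal

/-! ### Radial functions in the logarithmic variable. -/

noncomputable section Radial

variable {N : ℕ} {α : ℝ}

/-- Off the origin `u` is radial up to a constant, with radial derivative `-v(log r)/r`,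
where `v'` stands for the derivative of `v`. -/
def HasRadialProfile (u : EuclideanSpace ℝ (Fin N) → ℝ) (v v' : ℝ → ℝ) : Prop :=
  ∀ x : EuclideanSpace ℝ (Fin N), x ≠ 0 →
    ∇ u x = (-(‖x‖ ^ (-2 : ℝ) * v (Real.log ‖x‖))) • x ∧
    (Δ u) x = -(‖x‖ ^ (-2 : ℝ) * (v' (Real.log ‖x‖) + (N - 2) * v (Real.log ‖x‖)))

lemma hasGradAt_log_norm {x : EuclideanSpace ℝ (Fin N)} (hx : x ≠ 0) :
    HasGradAt (fun y : EuclideanSpace ℝ (Fin N) => Real.log ‖y‖) (‖x‖ ^ (-2 : ℝ) • x) x := by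
  have hn := norm_pos_iff.2 hx
  refine ((hasGradAt_norm hx).comp (Real.contDiffAt_log.2 hn.ne')
    (Real.hasDerivAt_log hn.ne')).congr ?_
  rw [smul_smul, Real.rpow_neg hn.le, Real.rpow_two]
  congr 1
  field_simp

lemma hasRadialProfile_of_eqOn {u : EuclideanSpace ℝ (Fin N) → ℝ} {g v v' : ℝ → ℝ}
    (hu : ∀ x, x ≠ 0 → u x = g (Real.log ‖x‖)) (hg : ContDiff ℝ 2 g)
    (hgv : ∀ y, HasDerivAt g (-v y) y) (hv : ContDiff ℝ 1 v) (hv' : ∀ y, HasDerivAt v (v' y) y) :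
    HasRadialProfile u v v' := by
  have hev : ∀ x : EuclideanSpace ℝ (Fin N), x ≠ 0 →
      u =ᶠ[nhds x] fun y => g (Real.log ‖y‖) := fun x hx => by
    filter_upwards [isOpen_compl_singleton.mem_nhds hx] with y hy using hu y hy
  have hgrad : ∀ x : EuclideanSpace ℝ (Fin N), x ≠ 0 →
      ∇ u x = (-(‖x‖ ^ (-2 : ℝ) * v (Real.log ‖x‖))) • x := fun x hx => by
    have h := ((hasGradAt_log_norm hx).comp (hg.contDiffAt.of_le (by norm_num)) (hgv _)).congr_fun
      (hev x hx)
    rw [h.2.gradient, smul_smul]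
    congr 1
    ring
  intro x hx
  refine ⟨hgrad x hx, ?_⟩
  have hlog : ContDiffAt ℝ 2 (fun y : EuclideanSpace ℝ (Fin N) => Real.log ‖y‖) x :=
    (contDiffAt_norm ℝ hx).log (norm_ne_zero_iff.2 hx)
  have hu2 : ContDiffAt ℝ 2 u x := (hg.contDiffAt.comp x hlog).congr_of_eventuallyEq (hev x hx)
  have h1 := (hasDivAt_rpow_smul_self hx ((hasGradAt_log_norm hx).comp hv.contDiffAt (hv' _))
    (-2)).const_smul (-1)
  have h2 := h1.congr_fun (G := ∇ u) (by
    filter_upwards [isOpen_compl_singleton.mem_nhds hx] with y hy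
    rw [hgrad y hy, smul_smul, smul_smul]
    congr 1
    ring)
  have hn := norm_pos_iff.2 hx
  have e : ‖x‖ ^ (-2 : ℝ) * ‖x‖ ^ (2 : ℝ) = 1 := by rw [← Real.rpow_add hn]; norm_num
  rw [← (hasDivAt_gradient hu2).2, h2.2, inner_smul_left, inner_smul_left, real_inner_self_rpow,
    conj_trivial, conj_trivial, e]
  ring

/-- Every smooth compactly supported profile in the variable `log r` is realised by a smooth
compactly supported function, constant near the origin. -/
theorem exists_hasRadialProfile {w : ℝ → ℝ} (hw : ContDiff ℝ ∞ w) (hc : HasCompactSupport w) :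
    ∃ u : EuclideanSpace ℝ (Fin N) → ℝ, ContDiff ℝ ∞ u ∧ HasCompactSupport u ∧
      HasRadialProfile u w (deriv w) ∧
      (∫ y, w y = 0 → (0 : EuclideanSpace ℝ (Fin N)) ∉ tsupport u) := by
  obtain ⟨R, hR⟩ := hc.isCompact.isBounded.subset_closedBall 0
  have hz : ∀ y, R < |y| → w y = 0 := fun y hy => by
    by_contra h
    have := hR (subset_tsupport w h)
    rw [mem_closedBall_zero_iff, Real.norm_eq_abs] at this
    linarith
  set S := |R| + 1 with hS
  have hS0 : 0 < S := by positivity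
  have hRS : R < S := by linarith [le_abs_self R]
  -- The function sought is G(log r). The primitive starts at S, beyond the support of w, so it
  -- vanishes for large r, and for small r it is constant, which gives smoothness at the origin.
  set G : ℝ → ℝ := fun y => ∫ s in y..S, w s with hGdef
  have hG' : ∀ y, HasDerivAt G (-w y) y := fun y =>
    intervalIntegral.integral_hasDerivAt_left (hw.continuous.intervalIntegrable _ _)
      hw.continuous.stronglyMeasurable.stronglyMeasurableAtFilter hw.continuous.continuousAt
  have hGs : ContDiff ℝ ∞ G := by
    rw [contDiff_infty_iff_deriv]
    refine ⟨fun y => (hG' y).differentiableAt, ?_⟩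
    rw [show deriv G = fun y => -w y from funext fun y => (hG' y).deriv]
    exact hw.neg
  have hGtop : ∀ y, S ≤ y → G y = 0 := fun y hy => by
    rw [hGdef, show (fun y => ∫ s in y..S, w s) y = ∫ s in y..S, w s from rfl,
      intervalIntegral.integral_congr (g := fun _ => 0), intervalIntegral.integral_zero]
    intro s hs
    rw [Set.uIcc_of_ge hy] at hs
    exact hz s (by rw [abs_of_pos (by linarith [hs.1])]; linarith [hs.1])
  have hGbot : ∀ y, y ≤ -S → G y = G (-S) := fun y hy => by
    have h1 := intervalIntegral.integral_add_adjacent_intervals (a := y) (b := -S) (c := S)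
      (hw.continuous.intervalIntegrable (μ := volume) _ _) (hw.continuous.intervalIntegrable _ _)
    have h2 : ∫ s in y..(-S), w s = 0 := by
      rw [intervalIntegral.integral_congr (g := fun _ => 0), intervalIntegral.integral_zero]
      intro s hs
      rw [Set.uIcc_of_le hy] at hs
      exact hz s (by rw [abs_of_neg (by linarith [hs.2])]; linarith [hs.2])
    rw [h2, zero_add] at h1
    exact h1.symm
  set u : EuclideanSpace ℝ (Fin N) → ℝ := fun x => if x = 0 then G (-S) else G (Real.log ‖x‖)
    with hudef
  have hu : ∀ x, x ≠ 0 → u x = G (Real.log ‖x‖) := fun x hx => if_neg hx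
  have hu0 : u =ᶠ[nhds 0] fun _ => G (-S) := by
    filter_upwards [Metric.ball_mem_nhds (0 : EuclideanSpace ℝ (Fin N)) (Real.exp_pos (-S))] with x hx
    by_cases h : x = 0
    · simp [hudef, h]
    · rw [hu x h]
      rw [mem_ball_zero_iff] at hx
      exact hGbot _ ((Real.log_lt_iff_lt_exp (norm_pos_iff.2 h)).2 hx).le
  refine ⟨u, contDiff_iff_contDiffAt.2 fun x => ?_, ?_, ?_, fun h0 => ?_⟩
  · by_cases h : x = 0
    · subst h
      exact contDiffAt_const.congr_of_eventuallyEq hu0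
    · have hlog : ContDiffAt ℝ ∞ (fun y : EuclideanSpace ℝ (Fin N) => Real.log ‖y‖) x :=
        (contDiffAt_norm ℝ h).log (norm_ne_zero_iff.2 h)
      refine (hGs.contDiffAt.comp x hlog).congr_of_eventuallyEq ?_
      filter_upwards [isOpen_compl_singleton.mem_nhds h] with y hy using hu y hy
  · refine HasCompactSupport.intro (isCompact_closedBall 0 (Real.exp S)) fun x hx => ?_
    rw [mem_closedBall_zero_iff, not_le] at hx
    have hn : 0 < ‖x‖ := (Real.exp_pos S).trans hx
    rw [hu x (norm_pos_iff.1 hn)]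
    exact hGtop _ ((Real.lt_log_iff_exp_lt hn).2 hx).le
  · exact hasRadialProfile_of_eqOn hu (hGs.of_le (by norm_cast)) hG'
      (hw.of_le (by norm_cast))
      fun y => ((hw.differentiable (by simp)) y).hasDerivAt
  · rw [notMem_tsupport_iff_eventuallyEq]
    -- The constant value near the origin is the full integral of w.
    have : G (-S) = 0 := by
      rw [← h0]
      refine intervalIntegral.integral_eq_integral_of_support_subset fun y hy => ?_
      have : |y| ≤ R := by
        by_contra h
        exact hy (hz y (not_le.1 h))
      exact ⟨by linarith [neg_abs_le y], by linarith [le_abs_self y]⟩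
    rw [this] at hu0
    exact hu0

variable {u : EuclideanSpace ℝ (Fin N) → ℝ} {v v' : ℝ → ℝ}

lemma HasRadialProfile.gradientDensity_eq (h : HasRadialProfile u v v')
    {x : EuclideanSpace ℝ (Fin N)} (hx : x ≠ 0) :
    gradientDensity u x = ‖x‖ ^ (-2 : ℝ) * v (Real.log ‖x‖) ^ 2 := by
  have hn := norm_pos_iff.2 hx
  have e : ‖x‖ ^ (-2 : ℝ) * ‖x‖ ^ (2 : ℝ) = 1 := by rw [← Real.rpow_add hn]; norm_num
  rw [gradientDensity, (h x hx).1, ← real_inner_self_eq_norm_sq, inner_smul_left,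
    inner_smul_right, real_inner_self_rpow, conj_trivial]
  linear_combination (‖x‖ ^ (-2 : ℝ) * v (Real.log ‖x‖) ^ 2) * e

lemma HasRadialProfile.weightedGradientDensity_eq (h : HasRadialProfile u v v')
    {x : EuclideanSpace ℝ (Fin N)} (hx : x ≠ 0) :
    weightedGradientDensity α u x = ‖x‖ ^ (2 * α) * v (Real.log ‖x‖) ^ 2 := by
  have hn := norm_pos_iff.2 hx
  have h1 := h.gradientDensity_eq hx
  rw [gradientDensity] at h1
  rw [weightedGradientDensity, h1, ← mul_assoc, ← Real.rpow_add hn]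
  ring_nf

lemma HasRadialProfile.laplacianDensity_eq (h : HasRadialProfile u v v')
    {x : EuclideanSpace ℝ (Fin N)} (hx : x ≠ 0) :
    laplacianDensity α u x =
      ‖x‖ ^ (-4 - 2 * α) * (v' (Real.log ‖x‖) + (N - 2) * v (Real.log ‖x‖)) ^ 2 := by
  have hn := norm_pos_iff.2 hx
  rw [laplacianDensity, sq_abs, (h x hx).2, show -4 - 2 * α = -2 + -2 - 2 * α by ring,
    Real.rpow_sub hn, Real.rpow_add hn]
  ring

end Radial

/-! ### Passing to the limit in the inequality along profiles. -/

noncomputable section ProfileLimit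

open Filter Topology

variable {N : ℕ} {α : ℝ} {u φ : EuclideanSpace ℝ (Fin N) → ℝ} {v v' : ℝ → ℝ}

lemma measurable_laplacianDensity (α : ℝ) (hu : ContDiff ℝ 2 u) :
    Measurable (laplacianDensity α u) := by
  have := (continuous_laplacian hu).measurable
  unfold laplacianDensity
  fun_prop

lemma measurable_gradientDensity (hu : ContDiff ℝ 1 u) : Measurable (gradientDensity u) := by
  have := (continuous_gradient hu).measurable
  unfold gradientDensity
  fun_prop

lemma measurable_weightedGradientDensity (α : ℝ) (hu : ContDiff ℝ 1 u) :
    Measurable (weightedGradientDensity α u) := by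
  have := (continuous_gradient hu).measurable
  unfold weightedGradientDensity
  fun_prop

/-- If the profiles of test functions converge, with a square integrable majorant, to the profile
of `φ`, then the uncertainty principle for these test functions passes to `φ`. -/
theorem uncertainty_of_tendsto_profile [Nontrivial (EuclideanSpace ℝ (Fin N))]
    {X : Set (EuclideanSpace ℝ (Fin N) → ℝ)} {C : ℝ} (hX : UncertaintyPrinciple α X C)
    {w : ℕ → ℝ → ℝ} {m : ℝ → ℝ} (hw : ∀ n, ContDiff ℝ ∞ (w n))
    (hc : ∀ n, HasCompactSupport (w n))
    (hmem : ∀ n (u : EuclideanSpace ℝ (Fin N) → ℝ), u ∈ testSpace N α →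
      (∫ y, w n y = 0 → (0 : EuclideanSpace ℝ (Fin N)) ∉ tsupport u) → u ∈ X)
    (hφ : HasRadialProfile φ v v')
    (hlim : ∀ y, Tendsto (fun n => w n y) atTop (𝓝 (v y)))
    (hlim' : ∀ y, Tendsto (fun n => deriv (w n) y) atTop (𝓝 (v' y)))
    (hb : ∀ n y, |w n y| ≤ m y) (hb' : ∀ n y, |deriv (w n) y| ≤ m y)
    (hA : Integrable fun x : EuclideanSpace ℝ (Fin N) => ‖x‖ ^ (-4 - 2 * α) * m (Real.log ‖x‖) ^ 2)
    (hB : Integrable fun x : EuclideanSpace ℝ (Fin N) => ‖x‖ ^ (2 * α) * m (Real.log ‖x‖) ^ 2)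
    (hD : Integrable fun x : EuclideanSpace ℝ (Fin N) => ‖x‖ ^ (-2 : ℝ) * m (Real.log ‖x‖) ^ 2) :
    C * ∫ x, gradientDensity φ x ≤ uncertaintyProduct α φ := by
  have hne := Measure.ae_ne volume (0 : EuclideanSpace ℝ (Fin N))
  choose u hus huc hup hu0 using fun n => exists_hasRadialProfile (N := N) (hw n) (hc n)
  have h1 : ∀ n, ContDiff ℝ 1 (u n) := fun n => (hus n).of_le (by norm_cast)
  have h2 : ∀ n, ContDiff ℝ 2 (u n) := fun n => (hus n).of_le (by norm_cast)
  have bA : ∀ n, ∀ᵐ x : EuclideanSpace ℝ (Fin N), ‖laplacianDensity α (u n) x‖ ≤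
      (1 + |(N : ℝ) - 2|) ^ 2 * (‖x‖ ^ (-4 - 2 * α) * m (Real.log ‖x‖) ^ 2) := fun n => by
    filter_upwards [hne] with x hx
    rw [(hup n).laplacianDensity_eq hx, Real.norm_of_nonneg (by positivity), mul_left_comm,
      ← mul_pow]
    refine mul_le_mul_of_nonneg_left (sq_le_sq' ?_ ?_) (by positivity) <;>
    · have := hb' n (Real.log ‖x‖)
      have h3 : |((N : ℝ) - 2) * w n (Real.log ‖x‖)| ≤ |(N : ℝ) - 2| * m (Real.log ‖x‖) := by
        rw [abs_mul]
        exact mul_le_mul_of_nonneg_left (hb n _) (abs_nonneg _)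
      linarith [abs_le.1 this, abs_le.1 h3]
  have bB : ∀ n, ∀ᵐ x : EuclideanSpace ℝ (Fin N), ‖weightedGradientDensity α (u n) x‖ ≤
      ‖x‖ ^ (2 * α) * m (Real.log ‖x‖) ^ 2 := fun n => by
    filter_upwards [hne] with x hx
    rw [(hup n).weightedGradientDensity_eq hx, Real.norm_of_nonneg (by positivity)]
    exact mul_le_mul_of_nonneg_left (sq_le_sq' (neg_le_of_abs_le (hb n _)) (le_of_abs_le (hb n _)))
      (by positivity)
  have bD : ∀ n, ∀ᵐ x : EuclideanSpace ℝ (Fin N), ‖gradientDensity (u n) x‖ ≤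
      ‖x‖ ^ (-2 : ℝ) * m (Real.log ‖x‖) ^ 2 := fun n => by
    filter_upwards [hne] with x hx
    rw [(hup n).gradientDensity_eq hx, Real.norm_of_nonneg (by positivity)]
    exact mul_le_mul_of_nonneg_left (sq_le_sq' (neg_le_of_abs_le (hb n _)) (le_of_abs_le (hb n _)))
      (by positivity)
  have mA := fun n => (measurable_laplacianDensity α (h2 n)).aestronglyMeasurable (μ := volume)
  have mB := fun n => (measurable_weightedGradientDensity α (h1 n)).aestronglyMeasurable (μ := volume)
  have mD := fun n => (measurable_gradientDensity (h1 n)).aestronglyMeasurable (μ := volume)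
  have tA : Tendsto (fun n => ∫ x, laplacianDensity α (u n) x) atTop
      (𝓝 (∫ x, laplacianDensity α φ x)) := by
    refine tendsto_integral_of_dominated_convergence _ mA (hA.const_mul _) bA ?_
    filter_upwards [hne] with x hx
    simp only [(hup _).laplacianDensity_eq hx, hφ.laplacianDensity_eq hx]
    exact (((hlim' _).add ((hlim _).const_mul _)).pow 2).const_mul _
  have tB : Tendsto (fun n => ∫ x, weightedGradientDensity α (u n) x) atTop
      (𝓝 (∫ x, weightedGradientDensity α φ x)) := by
    refine tendsto_integral_of_dominated_convergence _ mB hB bB ?_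
    filter_upwards [hne] with x hx
    simp only [(hup _).weightedGradientDensity_eq hx, hφ.weightedGradientDensity_eq hx]
    exact ((hlim _).pow 2).const_mul _
  have tD : Tendsto (fun n => ∫ x, gradientDensity (u n) x) atTop
      (𝓝 (∫ x, gradientDensity φ x)) := by
    refine tendsto_integral_of_dominated_convergence _ mD hD bD ?_
    filter_upwards [hne] with x hx
    simp only [(hup _).gradientDensity_eq hx, hφ.gradientDensity_eq hx]
    exact ((hlim _).pow 2).const_mul _
  refine le_of_tendsto_of_tendsto' (tD.const_mul C) (tA.sqrt.mul tB.sqrt) fun n => ?_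
  exact hX (u n) (hmem n _ ⟨hus n, huc n, (hA.const_mul _).mono' (mA n) (bA n),
    hB.mono' (mB n) (bB n)⟩ (hu0 n))

end ProfileLimit

/-! ### The extremal profile and the two majorants. -/

noncomputable section Profiles

open Filter Topology

variable {N : ℕ} {α σ p : ℝ}

/-- The radial profile of the Gaussian type extremal, in the variable `y = log r`. -/
def gaussRadial (α σ y : ℝ) : ℝ :=
  σ * Real.exp ((2 * α + 2) * y) * Real.exp (-(σ / (2 * α + 2) * Real.exp ((2 * α + 2) * y)))

/-- The factor 1 + exp((2α+2)y) leaves room for the derivative of the profile, which carries one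
more such exponential than the profile. -/
def gaussMajorant (α σ y : ℝ) : ℝ :=
  (1 + Real.exp ((2 * α + 2) * y)) * (Real.exp ((2 * α + 2) * y) *
    Real.exp (-(σ / (2 * α + 2) * Real.exp ((2 * α + 2) * y))))

lemma contDiff_gaussRadial (α σ : ℝ) : ContDiff ℝ ∞ (gaussRadial α σ) := by
  unfold gaussRadial
  fun_prop

lemma hasDerivAt_gaussRadial (hβ : 2 * α + 2 ≠ 0) (y : ℝ) :
    HasDerivAt (gaussRadial α σ)
      ((2 * α + 2 - σ * Real.exp ((2 * α + 2) * y)) * gaussRadial α σ y) y := by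
  have h1 : HasDerivAt (fun y => Real.exp ((2 * α + 2) * y))
      (Real.exp ((2 * α + 2) * y) * (2 * α + 2)) y := by
    simpa using ((hasDerivAt_id y).const_mul (2 * α + 2)).exp
  refine ((h1.const_mul σ).mul (h1.const_mul (σ / (2 * α + 2))).fun_neg.exp).congr_deriv ?_
  rw [gaussRadial]
  set E := Real.exp ((2 * α + 2) * y)
  linear_combination (-(σ * E * Real.exp (-(σ / (2 * α + 2) * E)) * E)) *
    div_mul_cancel₀ σ hβ

lemma exp_mul_log_norm {x : EuclideanSpace ℝ (Fin N)} (hx : x ≠ 0) (b : ℝ) :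
    Real.exp (b * Real.log ‖x‖) = ‖x‖ ^ b := by
  rw [Real.rpow_def_of_pos (norm_pos_iff.2 hx), mul_comm]

lemma gaussRadial_log_norm {x : EuclideanSpace ℝ (Fin N)} (hx : x ≠ 0) :
    gaussRadial α σ (Real.log ‖x‖) = σ * ‖x‖ ^ (2 * α + 2) * gaussFactor α σ x := by
  rw [gaussRadial, exp_mul_log_norm hx, gaussFactor, neg_mul]

lemma hasRadialProfile_gaussFactor (hβ : 2 * α + 2 ≠ 0) :
    HasRadialProfile (N := N) (gaussFactor α σ) (gaussRadial α σ)
      fun y => (2 * α + 2 - σ * Real.exp ((2 * α + 2) * y)) * gaussRadial α σ y := by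
  intro x hx
  have hn := norm_pos_iff.2 hx
  have e : ‖x‖ ^ (-2 : ℝ) * ‖x‖ ^ (2 * α + 2) = ‖x‖ ^ (2 * α) := by
    rw [← Real.rpow_add hn]; ring_nf
  dsimp only
  rw [gradient_gaussFactor hβ hx, laplacian_gaussFactor hβ hx, gaussRadial_log_norm hx,
    exp_mul_log_norm hx, ← e]
  exact ⟨by congr 1; ring, by ring⟩

lemma abs_eq_one_of_sq_eq_one (hσ1 : σ ^ 2 = 1) : |σ| = 1 :=
  (pow_eq_one_iff_of_nonneg (abs_nonneg σ) two_ne_zero).1 (by rw [sq_abs, hσ1])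

lemma gaussMajorant_nonneg (α σ y : ℝ) : 0 ≤ gaussMajorant α σ y := by
  unfold gaussMajorant; positivity

lemma abs_gaussRadial_le (hσ1 : σ ^ 2 = 1) (α y : ℝ) :
    |gaussRadial α σ y| ≤ gaussMajorant α σ y := by
  have hs := abs_eq_one_of_sq_eq_one hσ1
  rw [gaussRadial, gaussMajorant, mul_assoc, abs_mul, hs, one_mul, abs_of_pos (by positivity)]
  refine le_mul_of_one_le_left (by positivity) ?_
  linarith [Real.exp_pos ((2 * α + 2) * y)]

lemma abs_deriv_gaussRadial_le (hσ1 : σ ^ 2 = 1) (α y : ℝ) :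
    |(2 * α + 2 - σ * Real.exp ((2 * α + 2) * y)) * gaussRadial α σ y| ≤
      (|2 * α + 2| + 1) * gaussMajorant α σ y := by
  have hs := abs_eq_one_of_sq_eq_one hσ1
  rw [gaussRadial, gaussMajorant, abs_mul, mul_assoc σ, abs_mul σ, hs, one_mul, ← mul_assoc,
    abs_of_pos (a := Real.exp _ * Real.exp _) (by positivity)]
  refine mul_le_mul_of_nonneg_right ?_ (by positivity)
  have h := abs_sub (2 * α + 2) (σ * Real.exp ((2 * α + 2) * y))
  rw [abs_mul σ, hs, one_mul, Real.abs_exp] at h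
  have h0 := Real.exp_pos ((2 * α + 2) * y)
  nlinarith [abs_nonneg (2 * α + 2)]

lemma integrable_gaussMajorant (hN : 1 ≤ N) (hσ : 0 < σ * (2 * α + 2))
    (hp : 0 < σ * (N + p + 2 * (2 * α + 2))) :
    Integrable fun x : EuclideanSpace ℝ (Fin N) =>
      ‖x‖ ^ p * gaussMajorant α σ (Real.log ‖x‖) ^ 2 := by
  have := nontrivial_of_one_le hN
  have i2 := integrable_rpow_mul_gaussFactor_sq (N := N) (p := p + 2 * (2 * α + 2)) hN hσ
    (by linarith)
  have i3 := integrable_rpow_mul_gaussFactor_sq (N := N)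
    (p := p + 2 * (2 * α + 2) + (2 * α + 2)) hN hσ (by linarith)
  have i4 := integrable_rpow_mul_gaussFactor_sq (N := N)
    (p := p + 2 * (2 * α + 2) + (2 * α + 2) + (2 * α + 2)) hN hσ (by linarith)
  refine ((i2.add (i3.const_mul 2)).add i4).congr ?_
  filter_upwards [Measure.ae_ne volume (0 : EuclideanSpace ℝ (Fin N))] with x hx
  have hn := norm_pos_iff.2 hx
  simp only [Pi.add_apply]
  rw [gaussMajorant, exp_mul_log_norm hx, ← neg_mul, ← gaussFactor,
    Real.rpow_add hn (p + 2 * (2 * α + 2) + (2 * α + 2)), Real.rpow_add hn (p + 2 * (2 * α + 2)),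
    Real.rpow_add hn p, two_mul (2 * α + 2), Real.rpow_add hn (2 * α + 2)]
  ring

/-- The majorant `1/|y|` on `(-∞, -1]` of slowly spreading bumps. -/
def spreadMajorant (y : ℝ) : ℝ := if y ≤ -1 then |y|⁻¹ else 0

lemma spreadMajorant_nonneg (y : ℝ) : 0 ≤ spreadMajorant y := by
  unfold spreadMajorant; split_ifs <;> positivity

/-- Where f(y/L) ≠ 0 one has L ≤ |y| ≤ 2L, so 1/L ≤ 2/|y|, a bound independent of L. -/
lemma abs_dilate_le_spreadMajorant {f : ℝ → ℝ} {K L : ℝ} (hf : ∀ s, |f s| ≤ K)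
    (hs : ∀ s, f s ≠ 0 → s ∈ Set.Icc (-2) (-1)) (hL : 1 ≤ L) (y : ℝ) :
    |f (y / L)| / L ≤ 2 * K * spreadMajorant y := by
  have hK : 0 ≤ K := (abs_nonneg _).trans (hf 0)
  have hL0 : 0 < L := by linarith
  by_cases h : f (y / L) = 0
  · rw [h, abs_zero, zero_div]
    exact mul_nonneg (by positivity) (spreadMajorant_nonneg y)
  · obtain ⟨h1, h2⟩ := hs _ h
    rw [le_div_iff₀ hL0] at h1
    rw [div_le_iff₀ hL0] at h2
    have hy : y ≤ -1 := by linarith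
    rw [spreadMajorant, if_pos hy, abs_of_neg (a := y) (by linarith), div_le_iff₀ hL0, mul_assoc,
      ← div_eq_inv_mul]
    have : 1 ≤ 2 * (L / -y) := by
      rw [← mul_div_assoc, le_div_iff₀ (by linarith)]; linarith
    nlinarith [hf (y / L)]

/-- The endpoint p = -N is the main case: |x|^{-N}dx is a multiple of dy in y = log r, and 1/y² is
integrable on (-∞, -1]. Larger p only helps because |x| ≤ 1 there. -/
lemma integrable_spreadMajorant (hN : 1 ≤ N) (hp : -(N : ℝ) ≤ p) :
    Integrable fun x : EuclideanSpace ℝ (Fin N) =>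
      ‖x‖ ^ p * spreadMajorant (Real.log ‖x‖) ^ 2 := by
  have := nontrivial_of_one_le hN
  have hρ : Measurable spreadMajorant :=
    Measurable.ite measurableSet_Iic (by fun_prop) measurable_const
  have hint : Integrable fun x : EuclideanSpace ℝ (Fin N) =>
      ‖x‖ ^ (-N : ℝ) * spreadMajorant (Real.log ‖x‖) ^ 2 := by
    refine (integrable_fun_norm_addHaar volume
      (f := fun r => r ^ (-N : ℝ) * spreadMajorant (Real.log r) ^ 2)).2 ?_
    have hI : IntegrableOn (fun r : ℝ => r⁻¹ / Real.log r ^ 2) (Set.Ioc 0 (Real.exp (-1))) := by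
      refine intervalIntegral.integrableOn_deriv_of_nonneg (g := fun r => -(Real.log r)⁻¹)
        (fun r hr => ?_) (fun r hr => ?_) fun r hr => ?_
      · rcases hr.1.eq_or_lt with h | h
        · subst h
          have h1 : Tendsto (fun r => -(Real.log r)⁻¹) (𝓝[>] 0) (𝓝 0) := by
            simpa using (tendsto_inv_atBot_zero.comp Real.tendsto_log_nhdsGT_zero).neg
          -- The conventions log 0 = 0 and 0⁻¹ = 0 give the primitive the value 0 at the origin,
          -- which is also its limit.
          have h2 : ContinuousWithinAt (fun r => -(Real.log r)⁻¹) (Set.Ioi 0) 0 := by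
            simpa [ContinuousWithinAt] using h1
          exact (continuousWithinAt_Ioi_iff_Ici.1 h2).mono Set.Icc_subset_Ici_self
        · have : Real.log r ≤ -1 := (Real.log_le_iff_le_exp h).2 hr.2
          exact ((Real.continuousAt_log h.ne').inv₀ (by linarith)).neg.continuousWithinAt
      · have : Real.log r < -1 := (Real.log_lt_iff_lt_exp hr.1).2 hr.2
        refine ((Real.hasDerivAt_log hr.1.ne').inv (by linarith)).neg.congr_deriv ?_
        ring
      · have := hr.1
        positivity
    have hI' := (integrable_indicator_iff measurableSet_Ioc).2 hI
    refine hI'.integrableOn.congr_fun (fun r hr => ?_) measurableSet_Ioi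
    have hr0 : (0 : ℝ) < r := hr
    have hle : r ≤ Real.exp (-1) ↔ Real.log r ≤ -1 := (Real.log_le_iff_le_exp hr0).symm
    have hpow : r ^ (N - 1) * r ^ (-N : ℝ) = r⁻¹ := by
      rw [← Real.rpow_natCast, ← Real.rpow_add hr0, Nat.cast_sub hN, ← Real.rpow_neg_one]
      push_cast
      ring_nf
    simp only [finrank_euclideanSpace, Fintype.card_fin, smul_eq_mul, Set.indicator, Set.mem_Ioc,
      hr0, true_and, hle, spreadMajorant]
    rw [← mul_assoc, hpow]
    split_ifs
    · rw [inv_pow, sq_abs, div_eq_mul_inv]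
    · simp
  refine hint.mono' (Measurable.aestronglyMeasurable (by fun_prop)) ?_
  filter_upwards [Measure.ae_ne volume (0 : EuclideanSpace ℝ (Fin N))] with x hx
  have hn := norm_pos_iff.2 hx
  rw [Real.norm_of_nonneg (by positivity)]
  by_cases h : Real.log ‖x‖ ≤ -1
  · refine mul_le_mul_of_nonneg_right (Real.rpow_le_rpow_of_exponent_ge hn ?_ hp) (sq_nonneg _)
    exact ((Real.log_le_iff_le_exp hn).1 h).trans (Real.exp_le_one_iff.2 (by norm_num))
  · simp [spreadMajorant, h]

end Profiles

/-! ### Truncated extremals and sharpness of the constant. -/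

noncomputable section Optimality

open Filter Topology

variable {N : ℕ} {α σ p : ℝ}

/-- The truncation of the extremal profile at scale `L`, corrected by a multiple of a bump. -/
def truncatedProfile (α σ : ℝ) (θ κ : ℝ → ℝ) (c L y : ℝ) : ℝ :=
  gaussRadial α σ y * θ (y / L) - c / L * κ (y / L)

lemma contDiff_truncatedProfile {θ κ : ℝ → ℝ} (hθ : ContDiff ℝ ∞ θ) (hκ : ContDiff ℝ ∞ κ)
    (α σ c L : ℝ) : ContDiff ℝ ∞ (truncatedProfile α σ θ κ c L) := by
  have h0 := contDiff_gaussRadial α σ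
  have hL : ContDiff ℝ ∞ fun y : ℝ => y / L := contDiff_id.div_const L
  exact (h0.mul (hθ.comp hL)).sub (contDiff_const.mul (hκ.comp hL))

lemma HasCompactSupport.comp_div {θ : ℝ → ℝ} (hθ : HasCompactSupport θ) {L : ℝ} (hL : L ≠ 0) :
    HasCompactSupport fun y => θ (y / L) := by
  simp only [div_eq_mul_inv]
  exact hθ.comp_homeomorph (Homeomorph.mulRight₀ L⁻¹ (inv_ne_zero hL))

lemma hasCompactSupport_truncatedProfile {θ κ : ℝ → ℝ} (hθ : HasCompactSupport θ)
    (hκ : HasCompactSupport κ) (α σ c : ℝ) {L : ℝ} (hL : L ≠ 0) :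
    HasCompactSupport (truncatedProfile α σ θ κ c L) :=
  (hθ.comp_div hL).mul_left.sub (hκ.comp_div hL).mul_left

lemma hasDerivAt_truncatedProfile {θ κ : ℝ → ℝ} (hθ : ContDiff ℝ ∞ θ) (hκ : ContDiff ℝ ∞ κ)
    (hβ : 2 * α + 2 ≠ 0) (σ c L y : ℝ) :
    HasDerivAt (truncatedProfile α σ θ κ c L)
      ((2 * α + 2 - σ * Real.exp ((2 * α + 2) * y)) * gaussRadial α σ y * θ (y / L) +
        gaussRadial α σ y * (deriv θ (y / L) / L) - c / L * (deriv κ (y / L) / L)) y := by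
  have hL : HasDerivAt (fun y : ℝ => y / L) (1 / L) y := (hasDerivAt_id y).div_const L
  have h1 := (hθ.differentiable (by simp) (y / L)).hasDerivAt.comp y hL
  have h2 := (hκ.differentiable (by simp) (y / L)).hasDerivAt.comp y hL
  refine (((hasDerivAt_gaussRadial hβ y).mul h1).sub (h2.const_mul (c / L))).congr_deriv ?_
  simp only [Function.comp_apply]
  ring

lemma tendsto_div_succ (y : ℝ) : Tendsto (fun n : ℕ => y / ((n : ℝ) + 1)) atTop (𝓝 0) := by
  simpa [div_eq_mul_inv] using tendsto_one_div_add_atTop_nhds_zero_nat.const_mul y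

lemma abs_truncation_le {a b c d K K₀ ρ M B L : ℝ} (ha : |a| ≤ M) (hb : |b| ≤ B) (hc : |c| ≤ K₀)
    (hd : |d| / L ≤ K * ρ) (hL : 0 < L) :
    |a * b - c / L * d| ≤ M * B + K₀ * (K * ρ) := by
  refine (abs_sub _ _).trans (add_le_add ?_ ?_)
  · rw [abs_mul]
    exact mul_le_mul ha hb (abs_nonneg _) ((abs_nonneg _).trans ha)
  · rw [abs_mul, abs_div, abs_of_pos hL, div_mul_eq_mul_div, mul_div_assoc]
    exact mul_le_mul hc hd (by positivity) ((abs_nonneg _).trans hc)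

/-- One argument serves both test classes. With K₀ = 0 there is no correcting bump and no dimension
condition; otherwise the three weights in (*) must be at least as integrable near 0 as
|x|^{-N}/(log|x|)². -/
theorem le_of_uncertaintyPrinciple_of_truncation (hN : 1 ≤ N) (hσ1 : σ ^ 2 = 1)
    (hσ : 0 < σ * (2 * α + 2)) (hσN : 0 < σ * (N + 2 * α))
    {X : Set (EuclideanSpace ℝ (Fin N) → ℝ)} {C : ℝ} (hX : UncertaintyPrinciple α X C)
    {θ κ : ℝ → ℝ} (hθ : ContDiff ℝ ∞ θ) (hθc : HasCompactSupport θ) (hθ0 : θ 0 = 1)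
    (hκ : ContDiff ℝ ∞ κ) (hκs : tsupport κ ⊆ Set.Icc (-2) (-1))
    {c : ℕ → ℝ} {K₀ : ℝ} (hc : ∀ n, |c n| ≤ K₀)
    (hK₀ : K₀ = 0 ∨ (-(N : ℝ) ≤ -4 - 2 * α ∧ -(N : ℝ) ≤ 2 * α ∧ -(N : ℝ) ≤ -2))
    (hmem : ∀ (n : ℕ) (u : EuclideanSpace ℝ (Fin N) → ℝ), u ∈ testSpace N α →
      (∫ y, truncatedProfile α σ θ κ (c n) (n + 1) y = 0 →
        (0 : EuclideanSpace ℝ (Fin N)) ∉ tsupport u) → u ∈ X) :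
    C ≤ σ * (N + 4 * α + 2) / 2 := by
  have := nontrivial_of_one_le hN
  have hβ : 2 * α + 2 ≠ 0 := by rintro h; simp [h] at hσ
  have hL : ∀ n : ℕ, (1 : ℝ) ≤ (n : ℝ) + 1 := fun n => by linarith [n.cast_nonneg (α := ℝ)]
  have hL0 : ∀ n : ℕ, (0 : ℝ) < (n : ℝ) + 1 := fun n => by linarith [hL n]
  have hκc : HasCompactSupport κ := isCompact_Icc.of_isClosed_subset (isClosed_tsupport κ) hκs
  have hsκ : ∀ s, κ s ≠ 0 → s ∈ Set.Icc (-2) (-1) := fun s hs => hκs (subset_tsupport κ hs)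
  have hsκ' : ∀ s, deriv κ s ≠ 0 → s ∈ Set.Icc (-2) (-1) := fun s hs =>
    hκs (support_deriv_subset hs)
  have hθ' : Continuous (deriv θ) := hθ.continuous_deriv (by simp)
  have hκ' : Continuous (deriv κ) := hκ.continuous_deriv (by simp)
  obtain ⟨K1, hK1⟩ := hθc.exists_bound_of_continuous hθ.continuous
  obtain ⟨K2, hK2⟩ := hθc.deriv.exists_bound_of_continuous hθ'
  obtain ⟨K3, hK3⟩ := hκc.exists_bound_of_continuous hκ.continuous
  obtain ⟨K4, hK4⟩ := hκc.deriv.exists_bound_of_continuous hκ'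
  simp only [Real.norm_eq_abs] at hK1 hK2 hK3 hK4
  have K1p := (abs_nonneg _).trans (hK1 0)
  have K2p := (abs_nonneg _).trans (hK2 0)
  have hK₀p := (abs_nonneg _).trans (hc 0)
  set K := (|2 * α + 2| + 1) * K1 + K2 with hK
  set M := 2 * (max K3 K4) * K₀ with hM
  -- The majorant is a square root so that m² is a plain sum, integrated term by term without a
  -- cross term.
  set m : ℝ → ℝ := fun y =>
    √(2 * (K * gaussMajorant α σ y) ^ 2 + 2 * (M * spreadMajorant y) ^ 2) with hm
  have hle : ∀ y s, s ≤ K * gaussMajorant α σ y + M * spreadMajorant y → s ≤ m y := fun y s hs => by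
    refine hs.trans (Real.le_sqrt_of_sq_le ?_)
    nlinarith [sq_nonneg (K * gaussMajorant α σ y - M * spreadMajorant y)]
  have hI : ∀ p : ℝ, 0 < σ * (N + p + 2 * (2 * α + 2)) → (K₀ = 0 ∨ -(N : ℝ) ≤ p) →
      Integrable fun x : EuclideanSpace ℝ (Fin N) => ‖x‖ ^ p * m (Real.log ‖x‖) ^ 2 := by
    intro p hp hp'
    have h1 := (integrable_gaussMajorant (N := N) hN hσ hp).const_mul (2 * K ^ 2)
    have h2 : Integrable fun x : EuclideanSpace ℝ (Fin N) =>
        2 * M ^ 2 * (‖x‖ ^ p * spreadMajorant (Real.log ‖x‖) ^ 2) := by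
      rcases hp' with h | h
      · simp [hM, h]
      · exact (integrable_spreadMajorant hN h).const_mul _
    refine (h1.add h2).congr (.of_forall fun x => ?_)
    simp only [hm, Pi.add_apply]
    rw [Real.sq_sqrt (by positivity)]
    ring
  have hd := fun n : ℕ => hasDerivAt_truncatedProfile hθ hκ hβ σ (c n) ((n : ℝ) + 1)
  have hsp : ∀ y, 0 ≤ spreadMajorant y := spreadMajorant_nonneg
  have hgp : ∀ y, 0 ≤ gaussMajorant α σ y := gaussMajorant_nonneg α σ
  have hκ1 : ∀ (n : ℕ) y, |κ (y / ((n : ℝ) + 1))| / ((n : ℝ) + 1) ≤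
      2 * max K3 K4 * spreadMajorant y := fun n y =>
    abs_dilate_le_spreadMajorant (fun s => (hK3 s).trans (le_max_left _ _)) hsκ (hL n) y
  have hκ2 : ∀ (n : ℕ) y, |deriv κ (y / ((n : ℝ) + 1))| / ((n : ℝ) + 1) ≤
      2 * max K3 K4 * spreadMajorant y := fun n y =>
    abs_dilate_le_spreadMajorant (fun s => (hK4 s).trans (le_max_right _ _)) hsκ' (hL n) y
  -- The support of the correcting bump escapes to -∞, so at each fixed y it eventually contributes
  -- nothing.
  have hev : ∀ y, ∀ᶠ n : ℕ in atTop, y / ((n : ℝ) + 1) ∉ Set.Icc (-2 : ℝ) (-1) := fun y => by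
    filter_upwards [(tendsto_div_succ y).eventually (lt_mem_nhds (show (-1 : ℝ) < 0 by norm_num))]
      with n hn h
    exact absurd h.2 (not_le.2 hn)
  have hfin := uncertainty_of_tendsto_profile hX
    (w := fun n => truncatedProfile α σ θ κ (c n) (n + 1)) (m := m)
    (fun n => contDiff_truncatedProfile hθ hκ _ _ _ _)
    (fun n => hasCompactSupport_truncatedProfile hθc hκc _ _ _ (hL0 n).ne') hmem
    (hasRadialProfile_gaussFactor (σ := σ) hβ) (fun y => ?_) (fun y => ?_) (fun n y => ?_) (fun n y => ?_)
    (hI _ (by linarith) (hK₀.imp_right fun h => h.1))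
    (hI _ (by linarith) (hK₀.imp_right fun h => h.2.1))
    (hI _ (by linarith) (hK₀.imp_right fun h => h.2.2))
  · obtain ⟨-, -, -, hpos, heq⟩ := attainsUncertainty_gaussFactor hN hσ1 hσ hσN
    rw [heq] at hfin
    exact le_of_mul_le_mul_right hfin hpos
  · have h1 : Tendsto (fun n : ℕ => gaussRadial α σ y * θ (y / ((n : ℝ) + 1))) atTop
        (𝓝 (gaussRadial α σ y)) := by
      simpa [hθ0] using ((hθ.continuous.tendsto 0).comp (tendsto_div_succ y)).const_mul
        (gaussRadial α σ y)
    refine h1.congr' ?_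
    filter_upwards [hev y] with n hn
    rw [truncatedProfile, not_imp_comm.1 (hsκ _) hn, mul_zero, sub_zero]
  · simp only [(hd _ y).deriv]
    have h1 := ((hθ.continuous.tendsto 0).comp (tendsto_div_succ y)).const_mul
      ((2 * α + 2 - σ * Real.exp ((2 * α + 2) * y)) * gaussRadial α σ y)
    have h2 := (((hθ'.tendsto 0).comp (tendsto_div_succ y)).mul
      tendsto_one_div_add_atTop_nhds_zero_nat).const_mul (gaussRadial α σ y)
    have h3 := h1.add h2
    rw [hθ0, mul_one, mul_zero, mul_zero, add_zero] at h3
    refine h3.congr' ?_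
    filter_upwards [hev y] with n hn
    rw [not_imp_comm.1 (hsκ' _) hn, zero_div, mul_zero, sub_zero, Function.comp_apply,
      Function.comp_apply, mul_one_div]
  · refine hle y _ ((abs_truncation_le (abs_gaussRadial_le hσ1 α y) (hK1 _) (hc n) (hκ1 n y)
      (hL0 n)).trans ?_)
    have : K1 ≤ K := by rw [hK]; nlinarith [abs_nonneg (2 * α + 2)]
    have := mul_le_mul_of_nonneg_left this (hgp y)
    rw [hM]
    linarith
  · rw [(hd n y).deriv]
    have h2 : |gaussRadial α σ y * (deriv θ (y / ((n : ℝ) + 1)) / ((n : ℝ) + 1))| ≤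
        gaussMajorant α σ y * K2 := by
      rw [abs_mul, abs_div, abs_of_pos (hL0 n)]
      exact mul_le_mul (abs_gaussRadial_le hσ1 α y)
        ((div_le_self (abs_nonneg _) (hL n)).trans (hK2 _)) (by have := hL0 n; positivity) (hgp y)
    have h3 : |deriv κ (y / ((n : ℝ) + 1)) / ((n : ℝ) + 1)| / ((n : ℝ) + 1) ≤
        2 * max K3 K4 * spreadMajorant y := by
      rw [abs_div, abs_of_pos (hL0 n)]
      exact (div_le_self (by have := hL0 n; positivity) (hL n)).trans (hκ2 n y)
    have h1 := abs_truncation_le (abs_deriv_gaussRadial_le hσ1 α y) (hK1 (y / ((n : ℝ) + 1)))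
      (hc n) h3 (hL0 n)
    refine hle y _ ?_
    rw [add_sub_right_comm]
    refine (abs_add_le _ _).trans ((add_le_add h1 h2).trans ?_)
    rw [hM, hK]
    linarith

lemma exists_smooth_cutoff : ∃ θ : ℝ → ℝ, ContDiff ℝ ∞ θ ∧ HasCompactSupport θ ∧ θ 0 = 1 ∧
    ∀ y, |θ y| ≤ 1 := by
  let f : ContDiffBump (0 : ℝ) := ⟨1, 2, one_pos, one_lt_two⟩
  exact ⟨f, f.contDiff, f.hasCompactSupport,
    f.one_of_mem_closedBall (Metric.mem_closedBall_self zero_le_one),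
    fun y => by rw [abs_of_nonneg f.nonneg]; exact f.le_one⟩

lemma exists_smooth_bump : ∃ κ : ℝ → ℝ, ContDiff ℝ ∞ κ ∧ tsupport κ ⊆ Set.Icc (-2) (-1) ∧
    ∫ y, κ y = 1 := by
  let f : ContDiffBump (-3 / 2 : ℝ) := ⟨1 / 4, 1 / 2, by norm_num, by norm_num⟩
  refine ⟨f.normed volume, f.contDiff_normed, ?_, f.integral_normed⟩
  rw [f.tsupport_normed_eq, Real.closedBall_eq_Icc]
  norm_num

theorem le_of_uncertaintyPrinciple_testSpace (hN : 1 ≤ N) (hσ1 : σ ^ 2 = 1)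
    (hσ : 0 < σ * (2 * α + 2)) (hσN : 0 < σ * (N + 2 * α)) {C : ℝ}
    (hX : UncertaintyPrinciple α (testSpace N α) C) : C ≤ σ * (N + 4 * α + 2) / 2 := by
  obtain ⟨θ, hθ, hθc, hθ0, -⟩ := exists_smooth_cutoff
  obtain ⟨κ, hκ, hκs, -⟩ := exists_smooth_bump
  exact le_of_uncertaintyPrinciple_of_truncation hN hσ1 hσ hσN hX hθ hθc hθ0 hκ hκs
    (c := fun _ => 0) (K₀ := 0) (by simp) (.inl rfl) fun _ _ hu _ => hu

/-- This bounds the masses of the truncated profiles uniformly. At -∞ the profile is at most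
exp((2α+2)y); on the right half-line it is the derivative of minus the Gaussian factor. -/
lemma integrable_gaussRadial (hα : 0 < 2 * α + 2) : Integrable (gaussRadial α 1) := by
  have hpos : ∀ y, 0 ≤ gaussRadial α 1 y := fun y => by unfold gaussRadial; positivity
  rw [← integrableOn_univ, ← Set.Iic_union_Ioi (a := (0 : ℝ))]
  refine IntegrableOn.union ?_ ?_
  · refine (integrableOn_exp_mul_Iic hα 0).mono'
      (contDiff_gaussRadial α 1).continuous.aestronglyMeasurable (.of_forall fun y => ?_)
    rw [Real.norm_of_nonneg (hpos y), gaussRadial, one_mul]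
    refine mul_le_of_le_one_right (by positivity) ?_
    rw [Real.exp_le_one_iff, neg_nonpos]
    positivity
  · have hE : Tendsto (fun y => Real.exp ((2 * α + 2) * y)) atTop atTop :=
      Real.tendsto_exp_atTop.comp (tendsto_id.const_mul_atTop hα)
    refine integrableOn_Ioi_deriv_of_nonneg' (l := 0)
      (g := fun y => -Real.exp (-(1 / (2 * α + 2) * Real.exp ((2 * α + 2) * y))))
      (fun y _ => ?_) (fun y _ => hpos y) ?_
    · have h1 : HasDerivAt (fun y => Real.exp ((2 * α + 2) * y))
          (Real.exp ((2 * α + 2) * y) * (2 * α + 2)) y := by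
        simpa using ((hasDerivAt_id y).const_mul (2 * α + 2)).exp
      refine (h1.const_mul (1 / (2 * α + 2))).fun_neg.exp.fun_neg.congr_deriv ?_
      rw [gaussRadial]
      set E := Real.exp ((2 * α + 2) * y)
      linear_combination (E * Real.exp (-(1 / (2 * α + 2) * E))) * div_mul_cancel₀ 1 hα.ne'
    · simpa using (Real.tendsto_exp_neg_atTop_nhds_zero.comp
        (hE.const_mul_atTop (one_div_pos.2 hα))).neg

theorem le_of_uncertaintyPrinciple_puncturedTestSpace (hN : 1 ≤ N) (hα : 0 < α + 1)
    (h4 : 2 * α + 4 ≤ N) {C : ℝ}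
    (hX : UncertaintyPrinciple α (puncturedTestSpace N α) C) : C ≤ (N + 4 * α + 2) / 2 := by
  obtain ⟨θ, hθ, hθc, hθ0, hθ1⟩ := exists_smooth_cutoff
  obtain ⟨κ, hκ, hκs, hκ1⟩ := exists_smooth_bump
  have hκc : HasCompactSupport κ := isCompact_Icc.of_isClosed_subset (isClosed_tsupport κ) hκs
  have hv := integrable_gaussRadial (α := α) (by linarith)
  have h := le_of_uncertaintyPrinciple_of_truncation (σ := 1) hN (by norm_num) (by linarith)
    (by linarith) hX hθ hθc hθ0 hκ hκs
    -- The dilated bump (c/L)κ(y/L) has mass c, so this choice gives the corrected profile integral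
    -- zero.
    (c := fun n => ∫ y, gaussRadial α 1 y * θ (y / ((n : ℝ) + 1)))
    (K₀ := ∫ y, ‖gaussRadial α 1 y‖) (fun n => ?_)
    (.inr ⟨by linarith, by linarith, by linarith⟩) fun n u hu h0 => ⟨hu, h0 ?_⟩
  · linarith
  · rw [← Real.norm_eq_abs]
    refine norm_integral_le_of_norm_le hv.norm (.of_forall fun y => ?_)
    rw [norm_mul]
    exact mul_le_of_le_one_right (norm_nonneg _) (hθ1 _)
  · have hL : (n : ℝ) + 1 ≠ 0 := by positivity
    have hL0 : (0 : ℝ) < (n : ℝ) + 1 := by positivity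
    have i1 : Integrable fun y => gaussRadial α 1 y * θ (y / ((n : ℝ) + 1)) :=
      ((contDiff_gaussRadial α 1).continuous.mul
        (hθ.continuous.comp (continuous_id.div_const _))).integrable_of_hasCompactSupport
        (hθc.comp_div hL).mul_left
    have i2 : Integrable fun y => κ (y / ((n : ℝ) + 1)) :=
      (hκ.continuous.comp (continuous_id.div_const _)).integrable_of_hasCompactSupport
        (hκc.comp_div hL)
    simp only [truncatedProfile]
    rw [integral_sub i1 (i2.const_mul _), integral_const_mul,
      Measure.integral_comp_div κ, hκ1, abs_of_pos hL0, smul_eq_mul, mul_one,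
      div_mul_cancel₀ _ hL, sub_self]

end Optimality

/-! ### Assembly of the cases. -/

theorem theorem2p8 (N : ℕ) (hN : 1 ≤ N) (α : ℝ) :
    -- the inequality in the three parameter regions
    (((0 < α + 1 ∧ 0 < N - 2 * α ∧ 0 < N - (√5 - 1) * α - (√5 + 1)) ∨
      (N + 2 * α < 0 ∧ 0 < N + (√5 + 1) * α + (√5 - 1) ∧
        0 < N - 2 * √2 * α - 2 * √2) ∨
      (α + 1 < 0 ∧ 0 < N + 4 * α + 2)) →
      UncertaintyPrinciple α (testSpace N α) (|N + 4 * α + 2| / 2)) ∧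
    -- optimality and attainment, both signs positive
    (0 < α + 1 → 0 < N + 2 * α →
      (∀ C : ℝ, UncertaintyPrinciple α (testSpace N α) C → C ≤ (N + 4 * α + 2) / 2) ∧
      (2 * α + 4 ≤ N →
        ∀ C : ℝ, UncertaintyPrinciple α (puncturedTestSpace N α) C →
          C ≤ (N + 4 * α + 2) / 2) ∧
      AttainsUncertainty α
        (fun x : EuclideanSpace ℝ (Fin N) =>
          Real.exp (-(‖x‖ ^ (2 * (α + 1)) / (2 * (α + 1)))))
        ((N + 4 * α + 2) / 2)) ∧
    -- optimality and attainment, both signs negative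
    (α + 1 < 0 → N + 2 * α < 0 →
      (∀ C : ℝ, UncertaintyPrinciple α (testSpace N α) C → C ≤ -((N + 4 * α + 2) / 2)) ∧
      AttainsUncertainty α
        (fun x : EuclideanSpace ℝ (Fin N) =>
          Real.exp (‖x‖ ^ (2 * (α + 1)) / (2 * (α + 1))))
        (-((N + 4 * α + 2) / 2))) := by
  refine ⟨?_, fun h1 h2 => ⟨fun C hC => ?_, fun h4 C hC => ?_, ?_⟩, fun h1 h2 => ⟨fun C hC => ?_, ?_⟩⟩
  · rintro (⟨h1, h2, h3⟩ | ⟨h1, h2, h3⟩ | ⟨h1, h2⟩)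
    · by_cases h : 2 * α + 2 < N
      · exact uncertaintyPrinciple_of_lt hN h
      · exact uncertaintyPrinciple_of_le h1 h2 (not_lt.1 h) h3
    · refine uncertaintyPrinciple_of_lt hN ?_
      -- If N ≤ 2α+2, then N ≥ 1 gives 2α ≥ -1, whereas N + 2α < 0 gives 2α < -1.
      by_contra! h
      have hN' : (1 : ℝ) ≤ N := by exact_mod_cast hN
      nlinarith
    · refine uncertaintyPrinciple_of_lt hN ?_
      linarith [N.cast_nonneg (α := ℝ)]
  · simpa using le_of_uncertaintyPrinciple_testSpace (σ := 1) hN (by norm_num) (by linarith)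
      (by linarith) hC
  · exact le_of_uncertaintyPrinciple_puncturedTestSpace hN h1 h4 hC
  · convert attainsUncertainty_gaussFactor (N := N) (α := α) (σ := 1) hN (by norm_num)
      (by linarith) (by linarith) using 1
    · funext x
      rw [gaussFactor, mul_add, mul_one]
      ring_nf
    · ring
  · have := le_of_uncertaintyPrinciple_testSpace (σ := -1) hN (by norm_num) (by linarith)
      (by linarith) hC
    linarith
  · convert attainsUncertainty_gaussFactor (N := N) (α := α) (σ := -1) hN (by norm_num)
      (by linarith) (by linarith) using 1
    · funext x
      rw [gaussFactor, mul_add, mul_one]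
      ring_nf
    · ring
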